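/- **Setting.** An ellipsoid in $\mathbb{R}^d$ ($d\ge 1$) is given by a centre $c$ and a positive semidefinite shape matrix $M$, as the set $c+M^{1/2}B$ with $B$ the closed unit ball. It is $\{x:(x-c)^\top M^{-1}(x-c)\le 1\}$ if $M\succ 0$, and flat, of volume $0$, if $M$ is singular. For $M\succ0$ its condition number is $\sqrt{\lambda_{\max}(M)/\lambda_{\min}(M)}$. The D-optimal design problem for points $x_i\in\mathbb{R}^m$ is to maximize $\log\det\big(\sum_i w_i x_ix_i^\top\big)$ (with $\log 0=-\infty$) subject to $w_i\ge 0$ and $\sum_i w_i\le m$. The computational model is a randomized real RAM with exact arithmetic and comparisons and independent coins of prescribed real bias, at unit cost per instruction, with a subroutine that returns an exact optimal solution of any D-optimal design problem. $T_{\mathrm{SDP}}\ge 1$ is the maximal running time of the subroutine on instances with at most $n$ points in dimension $d+1$. **Algorithm.** The input is $a_1,\dots,a_n\in\mathbb{R}^d$ (repetitions allowed), $\alpha$ and $\gamma$; the constants are $c_1,c_2,c_3$. If $\gamma\le\alpha$, return a single point. Otherwise do the following $c_3(\lfloor\log_2 n\rfloor+1)$ times, for every $(k_1,k_2)\in[n]^2$: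 1. Make active the points $a_i$ in the closed ball with centre $a_{k_1}$ and radius $\|a_{k_1}-a_{k_2}\|$. 2. Repeat $\lceil c_1\alpha n/(\gamma d)\rceil$ times: solve the D-optimal design problem for the lifted active points $(a_i,1)\in\mathbb{R}^{d+1}$ to get weights $w_i$, and drop each active point independently with probability $w_i$ (read as $1$ if $w_i>1$). 3. Let $E$ be a minimum volume ellipsoid enclosing the remaining points. It is obtained from an optimal design $w$ of the lifted remaining points as the ellipsoid with centre $c=\frac1{d+1}\sum_i w_ia_i$ and shape matrix $\frac{d}{d+1}\sum_i w_i(a_i-c)(a_i-c)^\top$. If the remaining points lie in a hyperplane, $E$ is the flat ellipsoid given by their mean $\mu$ and scatter matrix $\sum_i(a_i-\mu)(a_i-\mu)^\top$; if there are none, $E$ is a single point. 4. Keep $E$ as a candidate if it contains at least $(1-c_2\alpha/\gamma)n$ of the points. Return a candidate of smallest volume (a single point if there is no candidate). **Theorem.** There are universal constants $c_1,c_2,c_3,K\in\mathbb{N}$ and a sequence $\varepsilon(n)\to0$ such that the following holds for all $n$, all $d\ge1$, all $a_1,\dots,a_n\in\mathbb{R}^d$, and all $0<\alpha<1$, $0<\gamma<1$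 with $\gamma d\le\alpha n$. * The running time of the algorithm, on every outcome of its coins, is at most $K(n+d)^K\cdot T_{\mathrm{SDP}}$. * Let $\beta\ge1$, and let $E^\star$ be any ellipsoid with positive definite shape matrix and condition number at most $\beta$ that contains $a_i$ for at least $(1-\alpha)n$ indices $i$. Then with probability at least $1-\varepsilon(n)$ the algorithm outputs an ellipsoid $\widehat E$ that contains $a_i$ for at least $(1-c_2\alpha/\gamma)n$ indices $i$ and satisfies $$\mathrm{vol}(\widehat E)\le(4\beta)^{2\gamma(d+1)}\,\mathrm{vol}(E^\star).$$ -/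

import Mathlib

open MeasureTheory Filter
open scoped ENNReal Topology Matrix

/-! ## Ellipsoids -/

/-- The description `(c, M)` of an ellipsoid in dimension `d`, with entries in `R`. -/
structure EllipsoidData (R : Type) (d : ℕ) where
  center : Fin d → R
  shape : Fin d → Fin d → R

namespace EllipsoidData

variable {d : ℕ}

/-- The shape matrix `M` of the ellipsoid. -/
def shapeMatrix (E : EllipsoidData ℝ d) : Matrix (Fin d) (Fin d) ℝ := Matrix.of E.shape

/-- The point set of the ellipsoid with centre `c` and positive semidefinite shape matrix `M`:
the image `c + M^{1/2} B` of the unit ball `B`, written as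
`{c + M z : zᵀ M z ≤ 1}` (put `u = M^{1/2} z`).
It is `{x : (x - c)ᵀ M⁻¹ (x - c) ≤ 1}` when `M` is positive definite, see
`mem_toSet_iff_of_posDef`, and a flat ellipsoid when `M` is singular. -/
def toSet (E : EllipsoidData ℝ d) : Set (EuclideanSpace ℝ (Fin d)) :=
  {x | ∃ z : Fin d → ℝ, (∀ j, x j = E.center j + (E.shapeMatrix *ᵥ z) j) ∧
    z ⬝ᵥ (E.shapeMatrix *ᵥ z) ≤ 1}

theorem mem_toSet_iff_of_posDef (E : EllipsoidData ℝ d) (hE : E.shapeMatrix.PosDef)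
    (x : EuclideanSpace ℝ (Fin d)) :
    x ∈ E.toSet ↔
      (fun j => x j - E.center j) ⬝ᵥ (E.shapeMatrix⁻¹ *ᵥ fun j => x j - E.center j) ≤ 1 := by
  have hu : IsUnit E.shapeMatrix.det := (Matrix.isUnit_iff_isUnit_det _).1 hE.isUnit
  constructor
  · rintro ⟨z, hz, h1⟩
    have hv : (fun j => x j - E.center j) = E.shapeMatrix *ᵥ z := by
      funext j
      rw [hz j]
      ring
    rw [hv, Matrix.mulVec_mulVec, Matrix.nonsing_inv_mul _ hu, Matrix.one_mulVec, dotProduct_comm]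
    exact h1
  · intro h
    refine ⟨E.shapeMatrix⁻¹ *ᵥ fun j => x j - E.center j, ?_, ?_⟩
    · intro j
      rw [Matrix.mulVec_mulVec, Matrix.mul_nonsing_inv _ hu, Matrix.one_mulVec]
      ring
    · rw [Matrix.mulVec_mulVec, Matrix.mul_nonsing_inv _ hu, Matrix.one_mulVec, dotProduct_comm]
      exact h

end EllipsoidData

/-- The condition number `√(λ_max(M) / λ_min(M))` of the ellipsoid with shape matrix `M`, i.e. the
ratio of its longest to its shortest axis. -/
noncomputable def ellipsoidCondNumber {d : ℕ} (M : Matrix (Fin d) (Fin d) ℝ)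
    (hM : M.IsHermitian) : ℝ :=
  Real.sqrt ((⨆ i, hM.eigenvalues i) / (⨅ i, hM.eigenvalues i))

/-! ## The D-optimal design problem -/

/-- The second moment matrix `∑_{i ∈ S} w_i x_i x_iᵀ`. -/
def designMatrix {n m : ℕ} (x : Fin n → Fin m → ℝ) (S : Finset (Fin n)) (w : Fin n → ℝ) :
    Matrix (Fin m) (Fin m) ℝ :=
  ∑ i ∈ S, w i • Matrix.vecMulVec (x i) (x i)

/-- Feasibility for the dual of the origin-centred minimum volume ellipsoid problem of the points
`x_i`, `i ∈ S`, in dimension `m`: nonnegative weights of total at most `m`. -/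
def IsDualFeasible {n m : ℕ} (S : Finset (Fin n)) (w : Fin n → ℝ) : Prop :=
  (∀ i ∈ S, 0 ≤ w i) ∧ ∑ i ∈ S, w i ≤ m

/-- Optimality for that dual, the D-optimal design problem. The objective is `log det`, with
`log 0 = -∞`; as `log` is increasing we compare the determinants. -/
def IsDualOptimal {n m : ℕ} (x : Fin n → Fin m → ℝ) (S : Finset (Fin n)) (w : Fin n → ℝ) : Prop :=
  IsDualFeasible (m := m) S w ∧
    ∀ w' : Fin n → ℝ, IsDualFeasible (m := m) S w' →
      (designMatrix x S w').det ≤ (designMatrix x S w).det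

/-- A function from instances (points in dimension `m`, and the set of those that are active)
to weights. -/
abbrev DualSolver : Type := ∀ n m : ℕ, (Fin n → Fin m → ℝ) → Finset (Fin n) → Fin n → ℝ

/-- The solver solves every instance to optimality. -/
def DualSolver.IsExact (sol : DualSolver) : Prop :=
  ∀ (n m : ℕ) (x : Fin n → Fin m → ℝ) (S : Finset (Fin n)), IsDualOptimal x S (sol n m x S)

/-! ## Randomized real-number programs -/

/-- The arithmetic operations of a real random access machine. -/
inductive ArithOp
  | add | sub | mul | div

/-- Programs of a randomized real random access machine with a subroutine for D-optimal design.
`R` is the type of real registers. Programs below are written for an arbitrary `R`, so that they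
can produce and inspect real numbers through these instructions only. -/
inductive Prog (R : Type) (β : Type) : Type
  /-- halt with a result -/
  | ret (b : β)
  /-- one step of integer bookkeeping -/
  | tick (next : Prog R β)
  /-- load an integer constant -/
  | lit (k : ℕ) (next : R → Prog R β)
  /-- arithmetic -/
  | arith (op : ArithOp) (x y : R) (next : R → Prog R β)
  /-- the comparison `x ≤ y` -/
  | le (x y : R) (next : Bool → Prog R β)
  /-- a fresh coin that shows `true` with probability `p` -/
  | coin (p : R) (next : Bool → Prog R β)
  /-- call the solver for the D-optimal design problem -/
  | dual (n m : ℕ) (x : Fin n → Fin m → R) (S : Finset (Fin n)) (next : (Fin n → R) → Prog R β)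

namespace Prog

/-- Sequential composition. -/
def bind {R β γ : Type} : Prog R β → (β → Prog R γ) → Prog R γ
  | ret b, g => g b
  | tick p, g => tick (bind p g)
  | lit k f, g => lit k fun r => bind (f r) g
  | arith op x y f, g => arith op x y fun r => bind (f r) g
  | le x y f, g => le x y fun b => bind (f b) g
  | coin p f, g => coin p fun b => bind (f b) g
  | dual n m x S f, g => dual n m x S fun w => bind (f w) g

instance {R : Type} : Monad (Prog R) where
  pure := ret
  bind := bind

/-- The coin with success probability `p`, truncated to `[0, 1]`. -/
noncomputable def coinPMF (p : ℝ) : PMF Bool :=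
  PMF.ofFintype (fun b => cond b (min (ENNReal.ofReal p) 1) (1 - min (ENNReal.ofReal p) 1))
    (by simp)

/-- The real value of an arithmetic operation. -/
noncomputable def evalArith : ArithOp → ℝ → ℝ → ℝ
  | .add, x, y => x + y
  | .sub, x, y => x - y
  | .mul, x, y => x * y
  | .div, x, y => x / y

/-- The law of the result of a program; all coins are independent. -/
noncomputable def output {β : Type} (sol : DualSolver) : Prog ℝ β → PMF β
  | ret b => PMF.pure b
  | tick p => output sol p
  | lit k f => output sol (f (k : ℝ))
  | arith op x y f => output sol (f (evalArith op x y))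
  | le x y f => output sol (f (decide (x ≤ y)))
  | coin p f => (coinPMF p).bind fun b => output sol (f b)
  | dual n m x S f => output sol (f (sol n m x S))

/-- The worst-case running time of a program over all outcomes of its coins. Every instruction
takes one step, except that a call of the solver on `N` points in dimension `m` takes `N * m` steps
to write the instance down, and `T N m` steps to solve it. -/
noncomputable def time {β : Type} (sol : DualSolver) (T : ℕ → ℕ → ℕ) : Prog ℝ β → ℕ
  | ret _ => 0
  | tick p => time sol T p + 1
  | lit k f => time sol T (f (k : ℝ)) + 1
  | arith op x y f => time sol T (f (evalArith op x y)) + 1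
  | le x y f => time sol T (f (decide (x ≤ y))) + 1
  | coin _ f => max (time sol T (f true)) (time sol T (f false)) + 1
  | dual n m x S f => time sol T (f (sol n m x S)) + (S.card * m + T S.card m)

/-! ### Single instructions and loops -/

section Basic

variable {R : Type}

def const (k : ℕ) : Prog R R := lit k ret
def add (x y : R) : Prog R R := arith .add x y ret
def sub (x y : R) : Prog R R := arith .sub x y ret
def mul (x y : R) : Prog R R := arith .mul x y ret
def div (x y : R) : Prog R R := arith .div x y ret
def leq (x y : R) : Prog R Bool := le x y ret
def flip (p : R) : Prog R Bool := coin p ret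
def solveDual {n m : ℕ} (x : Fin n → Fin m → R) (S : Finset (Fin n)) : Prog R (Fin n → R) :=
  dual n m x S ret

/-- `for i in l do s := body s i`; one step is charged for each pass. -/
def forEach {ι σ : Type} : List ι → σ → (σ → ι → Prog R σ) → Prog R σ
  | [], s, _ => pure s
  | i :: l, s, body => tick do
      let s' ← body s i
      forEach l s' body

/-- Compute the vector with entries `f i`. -/
def tabulate {β : Type} : (n : ℕ) → (Fin n → Prog R β) → Prog R (Fin n → β)
  | 0, _ => pure Fin.elim0
  | n + 1, f => do
      let b ← f 0
      let v ← tabulate n fun i => f i.succ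
      pure (Fin.cons (α := fun _ => β) b v)

/-- Compute the sum of the `f i`. -/
def sumOver : (n : ℕ) → (Fin n → Prog R R) → Prog R R
  | 0, _ => const 0
  | n + 1, f => do
      let x ← f 0
      let s ← sumOver n fun i => f i.succ
      add x s

/-- Compute the conjunction of the `f i`. -/
def allOf : (n : ℕ) → (Fin n → Prog R Bool) → Prog R Bool
  | 0, _ => tick (pure true)
  | n + 1, f => do
      let b ← f 0
      let c ← allOf n fun i => f i.succ
      pure (b && c)

end Basic

/-! ### Linear algebra -/

section LinearAlgebra

variable {R : Type}

/-- One step of Gaussian elimination: the Schur complement of the (nonzero) entry `A 0 0`. -/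
def schur (m : ℕ) (A : Fin (m + 1) → Fin (m + 1) → R) : Prog R (Fin m → Fin m → R) :=
  tabulate m fun i => tabulate m fun j => do
    let t ← mul (A i.succ 0) (A 0 j.succ)
    let u ← div t (A 0 0)
    sub (A i.succ j.succ) u

/-- The determinant of a positive semidefinite matrix, by Gaussian elimination. -/
def psdDet : (m : ℕ) → (Fin m → Fin m → R) → Prog R R
  | 0, _ => const 1
  | m + 1, A => do
      let zero ← const 0
      let singular ← leq (A 0 0) zero
      if singular then pure zero
      else do
        let B ← schur m A
        let t ← psdDet m B
        mul (A 0 0) t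

/-- Whether a symmetric matrix is positive semidefinite, by Gaussian elimination: a pivot must be
positive, or else it must vanish together with its row. -/
def isPSD : (m : ℕ) → (Fin m → Fin m → R) → Prog R Bool
  | 0, _ => tick (pure true)
  | m + 1, A => do
      let zero ← const 0
      let nonpos ← leq (A 0 0) zero
      if nonpos then do
        let rowZero ← allOf (m + 1) fun j => do
          let b ← leq (A 0 j) zero
          let c ← leq zero (A 0 j)
          pure (b && c)
        if rowZero then isPSD m fun i j => A i.succ j.succ
        else pure false
      else do
        let B ← schur m A
        isPSD m B

/-- The squared Euclidean distance. -/
def sqDist {d : ℕ} (x y : Fin d → R) : Prog R R :=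
  sumOver d fun j => do
    let t ← sub (x j) (y j)
    mul t t

/-- Whether `x` lies in the ellipsoid `(c, M)`: whether `M - (x - c) (x - c)ᵀ` is positive
semidefinite. -/
def isInside {d : ℕ} (x : Fin d → R) (E : EllipsoidData R d) : Prog R Bool := do
  let v ← tabulate d fun j => sub (x j) (E.center j)
  let A ← tabulate d fun j => tabulate d fun k => do
    let t ← mul (v j) (v k)
    sub (E.shape j k) t
  isPSD d A

/-- The sum of the `f i` over `i ∈ S`. -/
def sumOn {n : ℕ} (S : Finset (Fin n)) (f : Fin n → Prog R R) : Prog R R :=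
  sumOver n fun i => if i ∈ S then f i else const 0

/-- The lifted point `(x, 1)`; `one` is a register that holds `1`. -/
def liftPoint {d : ℕ} (one : R) (x : Fin d → R) : Fin (d + 1) → R :=
  Fin.snoc (α := fun _ => R) x one

/-- The ellipsoid with centre `c = (∑_{i ∈ S} w_i a_i) / W` and
shape matrix `s * ∑_{i ∈ S} w_i (a_i - c) (a_i - c)ᵀ`. -/
def weightedEllipsoid {n d : ℕ} (a : Fin n → Fin d → R) (S : Finset (Fin n)) (w : Fin n → R)
    (W s : R) : Prog R (EllipsoidData R d) := do
  let c ← tabulate d fun j => do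
    let t ← sumOn S fun i => mul (w i) (a i j)
    div t W
  let M ← tabulate d fun j => tabulate d fun k => do
    let t ← sumOn S fun i => do
      let x ← sub (a i j) (c j)
      let y ← sub (a i k) (c k)
      let z ← mul x y
      mul (w i) z
    mul s t
  pure ⟨c, M⟩

/-- The single point `0`, as an ellipsoid with shape matrix `0`. -/
def pointEllipsoid (d : ℕ) : Prog R (EllipsoidData R d) := do
  let zero ← const 0
  pure ⟨fun _ => zero, fun _ _ => zero⟩

end LinearAlgebra

/-! ### The algorithm -/

section Algorithm

variable {R : Type} {n d : ℕ}

/-- The ellipsoid enclosing the points `a_i`, `i ∈ S`, of minimum volume. If the lifted points span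
`ℝ^{d+1}`, it is read off from the optimal weights `w` of the D-optimal design for them: the centre
is `c = ∑ w_i a_i / (d + 1)` and the shape matrix `d / (d + 1) * ∑ w_i (a_i - c) (a_i - c)ᵀ`.
Otherwise the `a_i` lie in a hyperplane, and a flat ellipsoid (of volume `0`) that contains them is
given by their mean and their scatter matrix. -/
def enclosingEllipsoid (a : Fin n → Fin d → R) (S : Finset (Fin n)) :
    Prog R (EllipsoidData R d) := do
  let one ← const 1
  let w ← solveDual (fun i => liftPoint one (a i)) S
  let H ← tabulate (d + 1) fun j => tabulate (d + 1) fun k => sumOn S fun i => do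
    let t ← mul (liftPoint one (a i) j) (liftPoint one (a i) k)
    mul (w i) t
  let δ ← psdDet (d + 1) H
  let zero ← const 0
  let degenerate ← leq δ zero
  if degenerate then do
    let N ← sumOn S fun _ => const 1
    let nonempty ← leq one N
    if nonempty then weightedEllipsoid a S (fun _ => one) N one
    else pointEllipsoid d
  else do
    let x ← const d
    let y ← const (d + 1)
    let s ← div x y
    weightedEllipsoid a S w y s

/-- The points in the closed ball with centre `a_{k₁}` and radius `‖a_{k₁} - a_{k₂}‖`. -/
def pointsInBall (a : Fin n → Fin d → R) (k₁ k₂ : Fin n) : Prog R (Finset (Fin n)) := do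
  let r ← sqDist (a k₁) (a k₂)
  forEach (List.finRange n) ∅ fun S i => do
    let s ← sqDist (a i) (a k₁)
    let inside ← leq s r
    if inside then pure (insert i S) else pure S

/-- Solve the D-optimal design problem for the lifted active points, and drop each active point
independently with probability equal to its weight. -/
def removalRound (a : Fin n → Fin d → R) (S : Finset (Fin n)) : Prog R (Finset (Fin n)) := do
  let one ← const 1
  let w ← solveDual (fun i => liftPoint one (a i)) S
  forEach (List.finRange n) S fun S' i =>
    if i ∈ S then do
      let drop ← flip (w i)
      if drop then pure (S'.erase i) else pure S'
    else pure S'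

/-- Perform the removal round for each `j = 0, 1, 2, …` with `j γ d < c α n`, that is,
`⌈c α n / (γ d)⌉` times. (Only used for `α < γ`, so that `j < c n` is no restriction.) -/
def removalRounds (c : ℕ) (a : Fin n → Fin d → R) (α γ : R) (S : Finset (Fin n)) :
    Prog R (Finset (Fin n)) :=
  forEach (List.range (c * n)) S fun S' j => do
    let x ← const (j * d)
    let x' ← mul x γ
    let y ← const (c * n)
    let y' ← mul y α
    let done ← leq y' x'
    if done then pure S' else removalRound a S'

/-- Whether the ellipsoid contains at least `(1 - c α / γ) n` of the points. -/
def coversEnough (c : ℕ) (a : Fin n → Fin d → R) (α γ : R) (E : EllipsoidData R d) :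
    Prog R Bool := do
  let N ← sumOver n fun i => do
    let inside ← isInside (a i) E
    if inside then const 1 else const 0
  let x ← mul N γ
  let k ← const c
  let t ← mul k α
  let u ← sub γ t
  let m ← const n
  let y ← mul u m
  leq y x

/-- Add a candidate: keep the one with the smaller volume, i.e. the smaller determinant, of the
ellipsoids found so far. -/
def keepSmaller (best : Option (EllipsoidData R d)) (E : EllipsoidData R d) :
    Prog R (Option (EllipsoidData R d)) :=
  match best with
  | none => tick (pure (some E))
  | some F => do
      let x ← psdDet d F.shape
      let y ← psdDet d E.shape
      let keep ← leq x y
      if keep then pure (some F) else pure (some E)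

/-- One pass of the main step, for one candidate ball. -/
def tryBall (cIter cCov : ℕ) (a : Fin n → Fin d → R) (α γ : R)
    (best : Option (EllipsoidData R d)) (k₁ k₂ : Fin n) :
    Prog R (Option (EllipsoidData R d)) := do
  let S ← pointsInBall a k₁ k₂
  let S' ← removalRounds cIter a α γ S
  let E ← enclosingEllipsoid a S'
  let good ← coversEnough cCov a α γ E
  if good then keepSmaller best E else pure best

/-- The whole algorithm. The input consists of the points `a`, the miscoverage `α` and the
parameter `γ`; the constants are those in the number `cIter α n / (γ d)` of removal rounds, in the
coverage `(1 - cCov α / γ) n`, and in the number `cRep log n` of repetitions. For `γ ≤ α` the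
coverage is void, and the algorithm returns a point. -/
def confidenceEllipsoid (cIter cCov cRep : ℕ) (a : Fin n → Fin d → R) (α γ : R) :
    Prog R (EllipsoidData R d) := do
  let trivialCase ← leq γ α
  if trivialCase then pointEllipsoid d
  else do
    let best ← forEach (List.range (cRep * (Nat.log 2 n + 1))) none fun s _ =>
      forEach (List.finRange n) s fun s k₁ =>
        forEach (List.finRange n) s fun s k₂ => tryBall cIter cCov a α γ s k₁ k₂
    match best with
    | some E => pure E
    | none => pointEllipsoid d

end Algorithm

end Prog

/-! ## The guarantee -/

/-- `T_SDP`: the largest time `T N (d + 1)` that the solver needs for one of the instances with at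
most `n` lifted points, in dimension `d + 1`. -/
def sdpTime (T : ℕ → ℕ → ℕ) (n d : ℕ) : ℕ :=
  (Finset.range (n + 1)).sup fun N => T N (d + 1)

open Classical in
/-- The number of indices `i` with `a_i` in the ellipsoid. -/
noncomputable def coverage {n d : ℕ} (a : Fin n → EuclideanSpace ℝ (Fin d))
    (E : EllipsoidData ℝ d) : ℕ :=
  (Finset.univ.filter fun i => a i ∈ E.toSet).card

/-! Write `Estar` as `(c, M)` and measure distances by `M⁻¹`. Call the points in `Estar` inliers and
the others, at most `α n` of them, outliers. If `k₁` is an inlier and `k₂` an inlier farthest from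
it, the ball contains all inliers, and all of it lies in the ellipsoid enlarged by `2β + 1 ≤ 3β`
(`exists_good_ball`, `quad_le_of_condNumber`). All pairs are tried, so it suffices to analyse this
one.

The heart is a determinant estimate, `IsDualOptimal.det_lifted_le`. Suppose that an optimal design
of the lifted active points puts weight at most `κ` on outliers, and multiply the outlier weights by
`θ = 1 / (9β²)`. Then the weighted sum of squared distances from `c` is at most `d + 1`, and the
inequality of arithmetic and geometric means for eigenvalues bounds the new determinant by `det M`
times the constant `(d + 1) ((d + 1) / d) ^ d`. Reweighting costs at most a factor `θ ^ κ`: if `P`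
is the outlier part of the second moment matrix, in coordinates where the whole matrix is `I`, the
determinant is multiplied by `det (I - (1 - θ) P) ≥ θ ^ tr P`, and `tr P` is the outlier weight by
complementary slackness (`IsDualOptimal.det_mul_rpow_le`). So the optimal determinant is at most
`(4β) ^ (2κ) det M` times the constant, which is exactly the ratio between the determinant of a
lifted design and that of the shape matrix read off from it (`det_enclosingEllipsoid_le`).

The rest is a potential argument. Call an active set bad if some design on it violates this bound
for `κ = 2γ(d + 1)`. On a bad set the optimal weights put at least `κ` on outliers, so a round
removes at least `κ` outliers in expectation, while only `α n` exist. Badness passes to supersets,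
so a set that is bad at the end was bad throughout; after `2αn / (γd)` rounds this has probability
at most 1/4 (`mul_expect_bad_le`). A round removes at most `d + 1` points in expectation, so by
Markov's inequality too many points are lost with probability at most 1/4. Hence the good ball
yields a small candidate of large coverage with probability at least 1/2 (`expect_failure_le`). A
success is never lost, and `⌊log₂ n⌋ + 1` passes bring the failure probability below `1 / n`
(`expect_mainLoop_le`).

What remains is that the programs compute what they should: coin-free parts reduce to values, and
Gaussian elimination decides semidefiniteness and computes determinants (`eval_isPSD`,
`eval_psdDet`). -/

namespace Prog

variable {β δ : Type} (sol : DualSolver)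

/-! ## Semantics of programs: expectations, supports and deterministic values -/

/-- A real number, truncated to `[0, 1]`. -/
noncomputable def clamp (p : ℝ) : ℝ := max 0 (min p 1)

theorem clamp_nonneg (p : ℝ) : 0 ≤ clamp p := le_max_left _ _

theorem clamp_le_one (p : ℝ) : clamp p ≤ 1 := max_le zero_le_one (min_le_right _ _)

theorem clamp_le_self {p : ℝ} (hp : 0 ≤ p) : clamp p ≤ p := max_le hp (min_le_left _ _)

theorem clamp_eq_self {p : ℝ} (hp : 0 ≤ p) (hp' : p ≤ 1) : clamp p = p := by
  simp [clamp, hp, hp']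

theorem ofReal_clamp (p : ℝ) : ENNReal.ofReal (clamp p) = min (ENNReal.ofReal p) 1 := by
  rw [clamp, ENNReal.ofReal_max, ENNReal.ofReal_min]
  simp

/-- The expectation of `f` at the result of a program. -/
noncomputable def expect : Prog ℝ β → (β → ℝ) → ℝ
  | ret b, f => f b
  | tick p, f => expect p f
  | lit k g, f => expect (g (k : ℝ)) f
  | arith op x y g, f => expect (g (evalArith op x y)) f
  | le x y g, f => expect (g (decide (x ≤ y))) f
  | coin p g, f => clamp p * expect (g true) f + (1 - clamp p) * expect (g false) f
  | dual n m x S g, f => expect (g (sol n m x S)) f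

/-- All outcomes of a program satisfy `P`. -/
def Sat : Prog ℝ β → (β → Prop) → Prop
  | ret b, P => P b
  | tick p, P => Sat p P
  | lit k g, P => Sat (g (k : ℝ)) P
  | arith op x y g, P => Sat (g (evalArith op x y)) P
  | le x y g, P => Sat (g (decide (x ≤ y))) P
  -- Both outcomes count, even one of probability zero.
  | coin _ g, P => Sat (g true) P ∧ Sat (g false) P
  | dual n m x S g, P => Sat (g (sol n m x S)) P

/-- The result of a program when all coins show `true`. -/
noncomputable def eval : Prog ℝ β → β
  | ret b => b
  | tick p => eval p
  | lit k g => eval (g (k : ℝ))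
  | arith op x y g => eval (g (evalArith op x y))
  | le x y g => eval (g (decide (x ≤ y)))
  -- An arbitrary default: the value matters only for coin-free programs.
  | coin _ g => eval (g true)
  | dual n m x S g => eval (g (sol n m x S))

/-- The program flips no coin. -/
def CoinFree : Prog ℝ β → Prop
  | ret _ => True
  | tick p => CoinFree p
  | lit _ g => ∀ r, CoinFree (g r)
  | arith _ _ _ g => ∀ r, CoinFree (g r)
  | le _ _ g => ∀ b, CoinFree (g b)
  | coin _ _ => False
  | dual _ _ _ _ g => ∀ w, CoinFree (g w)

theorem bind_eq (p : Prog ℝ β) (g : β → Prog ℝ δ) : p >>= g = bind p g := rfl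

theorem expect_bind (p : Prog ℝ β) (g : β → Prog ℝ δ) (f : δ → ℝ) :
    expect sol (p >>= g) f = expect sol p fun b => expect sol (g b) f := by
  rw [bind_eq]
  induction p <;> simp_all [-Bool.forall_bool, bind, expect]

@[simp] theorem expect_pure (b : β) (f : β → ℝ) : expect sol (pure b : Prog ℝ β) f = f b := rfl

@[simp] theorem expect_tick (p : Prog ℝ β) (f : β → ℝ) :
    expect sol (tick p) f = expect sol p f := rfl

theorem expect_flip (p : ℝ) (f : Bool → ℝ) :
    expect sol (flip p) f = clamp p * f true + (1 - clamp p) * f false := rfl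

theorem expect_const (p : Prog ℝ β) (c : ℝ) : expect sol p (fun _ => c) = c := by
  induction p <;> simp_all [-Bool.forall_bool, expect]
  ring

theorem expect_add (p : Prog ℝ β) (f g : β → ℝ) :
    expect sol p (fun b => f b + g b) = expect sol p f + expect sol p g := by
  induction p <;> simp_all [-Bool.forall_bool, expect]
  ring

theorem expect_const_mul (p : Prog ℝ β) (c : ℝ) (f : β → ℝ) :
    expect sol p (fun b => c * f b) = c * expect sol p f := by
  induction p <;> simp_all [-Bool.forall_bool, expect]
  ring

theorem expect_sub (p : Prog ℝ β) (f g : β → ℝ) :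
    expect sol p (fun b => f b - g b) = expect sol p f - expect sol p g := by
  have h := expect_add sol p f fun b => -1 * g b
  rw [expect_const_mul] at h
  simpa [sub_eq_add_neg] using h

@[simp] theorem sat_bind (p : Prog ℝ β) (g : β → Prog ℝ δ) (P : δ → Prop) :
    Sat sol (p >>= g) P ↔ Sat sol p fun b => Sat sol (g b) P := by
  rw [bind_eq]
  induction p <;> simp_all [-Bool.forall_bool, bind, Sat]

@[simp] theorem sat_pure (b : β) (P : β → Prop) : Sat sol (pure b : Prog ℝ β) P ↔ P b := Iff.rfl

@[simp] theorem sat_tick (p : Prog ℝ β) (P : β → Prop) : Sat sol (tick p) P ↔ Sat sol p P :=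
  Iff.rfl

@[simp] theorem sat_flip (p : ℝ) (P : Bool → Prop) :
    Sat sol (flip p) P ↔ P true ∧ P false := Iff.rfl

theorem Sat.mono {sol : DualSolver} {p : Prog ℝ β} {P Q : β → Prop} (h : Sat sol p P)
    (hPQ : ∀ b, P b → Q b) : Sat sol p Q := by
  induction p <;> simp_all [-Bool.forall_bool, Sat]

/-- Monotonicity in the form that loop invariants need: the comparison is required only for outcomes
that satisfy the invariant. -/
theorem expect_le_of_sat {p : Prog ℝ β} {P : β → Prop} {f g : β → ℝ} (h : Sat sol p P)
    (hfg : ∀ b, P b → f b ≤ g b) : expect sol p f ≤ expect sol p g := by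
  induction p with
  | ret b => exact hfg b h
  | tick p ih => exact ih h
  | lit k g ih => exact ih _ h
  | arith op x y g ih => exact ih _ h
  | le x y g ih => exact ih _ h
  | coin p g ih =>
    have := clamp_nonneg p
    have := clamp_le_one p
    exact add_le_add (mul_le_mul_of_nonneg_left (ih _ h.1) (by linarith))
      (mul_le_mul_of_nonneg_left (ih _ h.2) (by linarith))
  | dual n m x S g ih => exact ih _ h

theorem sat_true (p : Prog ℝ β) : Sat sol p fun _ => True := by
  induction p <;> simp_all [-Bool.forall_bool, Sat]

theorem expect_mono (p : Prog ℝ β) {f g : β → ℝ} (hfg : ∀ b, f b ≤ g b) :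
    expect sol p f ≤ expect sol p g :=
  expect_le_of_sat sol (sat_true sol p) fun b _ => hfg b

theorem expect_le_const {p : Prog ℝ β} {P : β → Prop} {f : β → ℝ} {c : ℝ} (h : Sat sol p P)
    (hf : ∀ b, P b → f b ≤ c) : expect sol p f ≤ c :=
  (expect_le_of_sat sol h hf).trans_eq (expect_const sol p c)

theorem const_le_expect {p : Prog ℝ β} {P : β → Prop} {f : β → ℝ} {c : ℝ} (h : Sat sol p P)
    (hf : ∀ b, P b → c ≤ f b) : c ≤ expect sol p f :=
  (expect_const sol p c).symm.trans_le (expect_le_of_sat sol h hf)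

theorem CoinFree.sat_iff {sol : DualSolver} {p : Prog ℝ β} (h : CoinFree p) (P : β → Prop) :
    Sat sol p P ↔ P (eval sol p) := by
  induction p <;> simp_all [-Bool.forall_bool, Sat, CoinFree, eval]

theorem CoinFree.expect_eq {sol : DualSolver} {p : Prog ℝ β} (h : CoinFree p) (f : β → ℝ) :
    expect sol p f = f (eval sol p) := by
  induction p <;> simp_all [-Bool.forall_bool, expect, CoinFree, eval]

/-- The bridge from the law of the output to real expectations of indicators, to which linear
arithmetic applies. -/
theorem output_toOuterMeasure (p : Prog ℝ β) (s : Set β) :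
    (output sol p).toOuterMeasure s = ENNReal.ofReal (expect sol p (s.indicator 1)) := by
  have hnn : ∀ p : Prog ℝ β, 0 ≤ expect sol p (s.indicator 1) := fun p =>
    const_le_expect sol (sat_true sol p) fun b _ => Set.indicator_nonneg (fun _ _ => zero_le_one) b
  induction p with
  | ret b =>
    classical
    simp only [output, PMF.toOuterMeasure_pure_apply, expect, Set.indicator_apply]
    split_ifs <;> simp
  | tick p ih => exact ih
  | lit k g ih => exact ih _
  | arith op x y g ih => exact ih _
  | le x y g ih => exact ih _
  | dual n m x S g ih => exact ih _
  | coin p g ih =>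
    have h1 : (0 : ℝ) ≤ 1 - clamp p := sub_nonneg.2 (clamp_le_one p)
    simp only [output, expect, PMF.toOuterMeasure_bind_apply, tsum_bool, ih]
    rw [ENNReal.ofReal_add (mul_nonneg (clamp_nonneg p) (hnn _)) (mul_nonneg h1 (hnn _)),
      ENNReal.ofReal_mul (clamp_nonneg p), ENNReal.ofReal_mul h1, ENNReal.ofReal_sub _
      (clamp_nonneg p), ofReal_clamp, add_comm]
    simp [coinPMF, PMF.ofFintype_apply]

/-! ### Deterministic values -/

@[simp] theorem eval_bind (p : Prog ℝ β) (g : β → Prog ℝ δ) :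
    eval sol (p >>= g) = eval sol (g (eval sol p)) := by
  rw [bind_eq]
  induction p <;> simp_all [-Bool.forall_bool, bind, eval]

@[simp] theorem eval_pure (b : β) : eval sol (pure b : Prog ℝ β) = b := rfl
@[simp] theorem eval_tick (p : Prog ℝ β) : eval sol (tick p) = eval sol p := rfl
@[simp] theorem eval_const (k : ℕ) : eval sol (const k : Prog ℝ ℝ) = k := rfl
@[simp] theorem eval_add (x y : ℝ) : eval sol (add x y) = x + y := rfl
@[simp] theorem eval_sub (x y : ℝ) : eval sol (sub x y) = x - y := rfl
@[simp] theorem eval_mul (x y : ℝ) : eval sol (mul x y) = x * y := rfl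
@[simp] theorem eval_div (x y : ℝ) : eval sol (div x y) = x / y := rfl
@[simp] theorem eval_leq (x y : ℝ) : eval sol (leq x y) = decide (x ≤ y) := rfl
@[simp] theorem eval_solveDual {n m : ℕ} (x : Fin n → Fin m → ℝ) (S : Finset (Fin n)) :
    eval sol (solveDual x S) = sol n m x S := rfl

@[simp] theorem eval_tabulate (n : ℕ) (f : Fin n → Prog ℝ β) :
    eval sol (tabulate n f) = fun i => eval sol (f i) := by
  induction n with
  | zero => funext i; exact i.elim0
  | succ n ih =>
    simp only [tabulate, eval_bind, ih, eval_pure]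
    funext i
    exact Fin.cases rfl (fun _ => rfl) i

@[simp] theorem eval_sumOver (n : ℕ) (f : Fin n → Prog ℝ ℝ) :
    eval sol (sumOver n f) = ∑ i, eval sol (f i) := by
  induction n with
  | zero => simp [sumOver]
  | succ n ih => simp [sumOver, ih, Fin.sum_univ_succ]

@[simp] theorem eval_allOf (n : ℕ) (f : Fin n → Prog ℝ Bool) :
    eval sol (allOf n f) = decide (∀ i, eval sol (f i) = true) := by
  induction n with
  | zero => simp [allOf]
  | succ n ih => simp [allOf, ih, Fin.forall_fin_succ]

theorem coinFree_bind {p : Prog ℝ β} {g : β → Prog ℝ δ} (hp : CoinFree p)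
    (hg : ∀ b, CoinFree (g b)) : CoinFree (p >>= g) := by
  rw [bind_eq]
  induction p <;> simp_all [-Bool.forall_bool, bind, CoinFree]

@[simp] theorem coinFree_pure (b : β) : CoinFree (pure b : Prog ℝ β) := trivial
@[simp] theorem coinFree_const (k : ℕ) : CoinFree (const k : Prog ℝ ℝ) := fun _ => trivial
@[simp] theorem coinFree_add (x y : ℝ) : CoinFree (add x y) := fun _ => trivial
@[simp] theorem coinFree_sub (x y : ℝ) : CoinFree (sub x y) := fun _ => trivial
@[simp] theorem coinFree_mul (x y : ℝ) : CoinFree (mul x y) := fun _ => trivial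
@[simp] theorem coinFree_div (x y : ℝ) : CoinFree (div x y) := fun _ => trivial
@[simp] theorem coinFree_leq (x y : ℝ) : CoinFree (leq x y) := fun _ => trivial
@[simp] theorem coinFree_solveDual {n m : ℕ} (x : Fin n → Fin m → ℝ) (S : Finset (Fin n)) :
    CoinFree (solveDual x S) := fun _ => trivial
@[simp] theorem coinFree_tick (p : Prog ℝ β) : CoinFree (tick p) ↔ CoinFree p := Iff.rfl

theorem coinFree_ite {c : Prop} [Decidable c] {p q : Prog ℝ β} (hp : CoinFree p)
    (hq : CoinFree q) : CoinFree (if c then p else q) := by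
  split_ifs <;> assumption

theorem coinFree_tabulate (n : ℕ) {f : Fin n → Prog ℝ β} (h : ∀ i, CoinFree (f i)) :
    CoinFree (tabulate n f) := by
  induction n with
  | zero => trivial
  | succ n ih => exact coinFree_bind (h 0) fun _ => coinFree_bind (ih fun i => h _) fun _ => trivial

theorem coinFree_sumOver (n : ℕ) {f : Fin n → Prog ℝ ℝ} (h : ∀ i, CoinFree (f i)) :
    CoinFree (sumOver n f) := by
  induction n with
  | zero => exact coinFree_const 0
  | succ n ih =>
    exact coinFree_bind (h 0) fun _ => coinFree_bind (ih fun i => h _) fun _ => coinFree_add _ _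

theorem coinFree_allOf (n : ℕ) {f : Fin n → Prog ℝ Bool} (h : ∀ i, CoinFree (f i)) :
    CoinFree (allOf n f) := by
  induction n with
  | zero => trivial
  | succ n ih => exact coinFree_bind (h 0) fun _ => coinFree_bind (ih fun i => h _) fun _ => trivial

theorem coinFree_forEach {ι : Type} (l : List ι) (s : β) {body : β → ι → Prog ℝ β}
    (h : ∀ s i, CoinFree (body s i)) : CoinFree (forEach l s body) := by
  induction l generalizing s with
  | nil => trivial
  | cons i l ih => exact coinFree_bind (h s i) fun s' => ih s'

/-! ### Running times -/

/-- With `u` uniform in `b`, running times need no knowledge of the intermediate values. -/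
theorem time_bind_le (T : ℕ → ℕ → ℕ) {p : Prog ℝ β} {g : β → Prog ℝ δ} {t u : ℕ}
    (hp : time sol T p ≤ t) (hg : ∀ b, time sol T (g b) ≤ u) :
    time sol T (p >>= g) ≤ t + u := by
  suffices h : time sol T (p >>= g) ≤ time sol T p + u by omega
  clear hp
  rw [bind_eq]
  induction p with
  | ret b => simpa [bind, time] using hg b
  | tick p ih => simp only [bind, time]; omega
  | lit k f ih => simp only [bind, time]; have := ih k; omega
  | arith op x y f ih => simp only [bind, time]; have := ih (evalArith op x y); omega
  | le x y f ih => simp only [bind, time]; have := ih (decide (x ≤ y)); omega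
  | coin p f ih => simp only [bind, time]; have := ih true; have := ih false; omega
  | dual n m x S f ih => simp only [bind, time]; have := ih (sol n m x S); omega

theorem time_ite_le (T : ℕ → ℕ → ℕ) {c : Prop} [Decidable c] {p q : Prog ℝ β} {t : ℕ}
    (hp : time sol T p ≤ t) (hq : time sol T q ≤ t) :
    time sol T (if c then p else q) ≤ t := by
  split_ifs <;> assumption

theorem time_pure (T : ℕ → ℕ → ℕ) (b : β) : time sol T (pure b : Prog ℝ β) = 0 := rfl
theorem time_const (T : ℕ → ℕ → ℕ) (k : ℕ) : time sol T (const k : Prog ℝ ℝ) = 1 := rfl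
theorem time_add (T : ℕ → ℕ → ℕ) (x y : ℝ) : time sol T (add x y) = 1 := rfl
theorem time_sub (T : ℕ → ℕ → ℕ) (x y : ℝ) : time sol T (sub x y) = 1 := rfl
theorem time_mul (T : ℕ → ℕ → ℕ) (x y : ℝ) : time sol T (mul x y) = 1 := rfl
theorem time_div (T : ℕ → ℕ → ℕ) (x y : ℝ) : time sol T (div x y) = 1 := rfl
theorem time_leq (T : ℕ → ℕ → ℕ) (x y : ℝ) : time sol T (leq x y) = 1 := rfl
theorem time_flip (T : ℕ → ℕ → ℕ) (p : ℝ) : time sol T (flip p) = 1 := rfl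

theorem time_tabulate_le (T : ℕ → ℕ → ℕ) (n : ℕ) {f : Fin n → Prog ℝ β} {t : ℕ}
    (h : ∀ i, time sol T (f i) ≤ t) : time sol T (tabulate n f) ≤ n * t := by
  induction n with
  | zero => exact Nat.zero_le _
  | succ n ih =>
    refine (time_bind_le sol T (h 0) fun b => time_bind_le sol T (ih fun i => h i.succ) fun v =>
      (time_pure sol T _).le).trans_eq ?_
    ring

theorem time_sumOver_le (T : ℕ → ℕ → ℕ) (n : ℕ) {f : Fin n → Prog ℝ ℝ} {t : ℕ}
    (h : ∀ i, time sol T (f i) ≤ t) : time sol T (sumOver n f) ≤ n * (t + 1) + 1 := by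
  induction n with
  | zero => simpa [sumOver] using (time_const sol T 0).le
  | succ n ih =>
    refine (time_bind_le sol T (h 0) fun b => time_bind_le sol T (ih fun i => h i.succ) fun v =>
      (time_add sol T _ _).le).trans_eq ?_
    ring

theorem time_allOf_le (T : ℕ → ℕ → ℕ) (n : ℕ) {f : Fin n → Prog ℝ Bool} {t : ℕ}
    (h : ∀ i, time sol T (f i) ≤ t) : time sol T (allOf n f) ≤ n * t + 1 := by
  induction n with
  | zero => simp [allOf, time, time_pure]
  | succ n ih =>
    refine (time_bind_le sol T (h 0) fun b => time_bind_le sol T (ih fun i => h i.succ) fun v =>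
      (time_pure sol T _).le).trans_eq ?_
    ring

theorem time_forEach_le (T : ℕ → ℕ → ℕ) {ι : Type} (l : List ι) (s : β)
    {body : β → ι → Prog ℝ β} {t : ℕ} (h : ∀ s i, time sol T (body s i) ≤ t) :
    time sol T (forEach l s body) ≤ l.length * (t + 1) := by
  induction l generalizing s with
  | nil => exact Nat.zero_le _
  | cons i l ih =>
    have := time_bind_le sol T (h s i) fun s' => ih s'
    simp only [forEach, time, List.length_cons]
    refine (Nat.add_le_add_right this 1).trans_eq ?_
    ring

end Prog

/-! ## Positive semidefinite matrices and Gaussian elimination -/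

theorem Matrix.IsHermitian.apply_comm {ι : Type*} {A : Matrix ι ι ℝ} (hA : A.IsHermitian)
    (i j : ι) : A i j = A j i := by
  simpa using hA.apply j i

section PosSemidef

variable {ι : Type*} [Fintype ι]

theorem posSemidef_iff_real (A : Matrix ι ι ℝ) :
    A.PosSemidef ↔ A.IsHermitian ∧ ∀ z : ι → ℝ, 0 ≤ z ⬝ᵥ (A *ᵥ z) := by
  simp [Matrix.posSemidef_iff_dotProduct_mulVec]

theorem Matrix.PosSemidef.quad_nonneg {A : Matrix ι ι ℝ} (hA : A.PosSemidef) (z : ι → ℝ) :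
    0 ≤ z ⬝ᵥ (A *ᵥ z) := ((posSemidef_iff_real A).1 hA).2 z

theorem Matrix.IsHermitian.dotProduct_mulVec_comm {A : Matrix ι ι ℝ} (hA : A.IsHermitian)
    (y z : ι → ℝ) : y ⬝ᵥ (A *ᵥ z) = z ⬝ᵥ (A *ᵥ y) := by
  have hT : Aᵀ = A := by simpa [Matrix.IsHermitian] using hA
  rw [Matrix.dotProduct_mulVec, dotProduct_comm, ← Matrix.mulVec_transpose, hT]

theorem quad_eq_sum (A : Matrix ι ι ℝ) (z : ι → ℝ) :
    z ⬝ᵥ (A *ᵥ z) = ∑ i, ∑ j, z i * A i j * z j := by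
  simp [dotProduct, Matrix.mulVec, Finset.mul_sum, mul_assoc]

/-- The Cauchy–Schwarz inequality for a positive semidefinite matrix. -/
theorem Matrix.PosSemidef.cauchy_schwarz {A : Matrix ι ι ℝ} (hA : A.PosSemidef) (y z : ι → ℝ) :
    (y ⬝ᵥ (A *ᵥ z)) ^ 2 ≤ (y ⬝ᵥ (A *ᵥ y)) * (z ⬝ᵥ (A *ᵥ z)) := by
  have h : ∀ t : ℝ, 0 ≤ (z ⬝ᵥ (A *ᵥ z)) * (t * t) + (2 * (y ⬝ᵥ (A *ᵥ z))) * t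
      + y ⬝ᵥ (A *ᵥ y) := by
    intro t
    have := hA.quad_nonneg (y + t • z)
    simp only [Matrix.mulVec_add, Matrix.mulVec_smul, dotProduct_add, add_dotProduct,
      smul_dotProduct, dotProduct_smul, smul_eq_mul] at this
    rw [hA.isHermitian.dotProduct_mulVec_comm z y] at this
    linarith
  have := discrim_le_zero h
  rw [discrim] at this
  nlinarith

end PosSemidef

section Pivot

variable {m : ℕ}

/-- The Schur complement of the entry `A 0 0`. -/
noncomputable def schurMatrix (A : Matrix (Fin (m + 1)) (Fin (m + 1)) ℝ) :
    Matrix (Fin m) (Fin m) ℝ :=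
  Matrix.of fun i j => A i.succ j.succ - A i.succ 0 * A 0 j.succ / A 0 0

theorem quad_cons {A : Matrix (Fin (m + 1)) (Fin (m + 1)) ℝ} (hA : A.IsHermitian) (t : ℝ)
    (y : Fin m → ℝ) :
    (Fin.cons t y : Fin (m + 1) → ℝ) ⬝ᵥ (A *ᵥ (Fin.cons t y : Fin (m + 1) → ℝ)) =
      A 0 0 * t ^ 2 + 2 * t * (∑ j, A 0 j.succ * y j)
        + ∑ i, ∑ j, y i * A i.succ j.succ * y j := by
  have h : ∀ i : Fin m, A i.succ 0 = A 0 i.succ := fun i => hA.apply_comm _ _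
  rw [quad_eq_sum]
  simp only [Fin.sum_univ_succ, Fin.cons_zero, Fin.cons_succ, h, Finset.sum_add_distrib]
  have h1 : ∑ i, t * A 0 (Fin.succ i) * y i = t * ∑ j, A 0 j.succ * y j := by
    simp [Finset.mul_sum, mul_assoc]
  have h2 : ∑ i, y i * A 0 (Fin.succ i) * t = t * ∑ j, A 0 j.succ * y j := by
    rw [Finset.mul_sum]
    exact Finset.sum_congr rfl fun _ _ => by ring
  rw [h1, h2]
  ring

theorem quad_schurMatrix {A : Matrix (Fin (m + 1)) (Fin (m + 1)) ℝ} (hA : A.IsHermitian)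
    (y : Fin m → ℝ) :
    y ⬝ᵥ (schurMatrix A *ᵥ y) =
      ∑ i, ∑ j, y i * A i.succ j.succ * y j - (∑ j, A 0 j.succ * y j) ^ 2 / A 0 0 := by
  have h : ∀ i : Fin m, A i.succ 0 = A 0 i.succ := fun i => hA.apply_comm _ _
  rw [quad_eq_sum]
  simp only [schurMatrix, Matrix.of_apply, h, mul_sub, sub_mul, Finset.sum_sub_distrib]
  congr 1
  rw [sq, Finset.sum_mul_sum, Finset.sum_div]
  refine Finset.sum_congr rfl fun i _ => ?_
  rw [Finset.sum_div]
  exact Finset.sum_congr rfl fun j _ => by ring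

theorem isHermitian_schurMatrix {A : Matrix (Fin (m + 1)) (Fin (m + 1)) ℝ}
    (hA : A.IsHermitian) : (schurMatrix A).IsHermitian := by
  ext i j
  simp only [schurMatrix, Matrix.conjTranspose_apply, Matrix.of_apply, star_trivial]
  rw [hA.apply_comm j.succ i.succ, hA.apply_comm j.succ 0,
    hA.apply_comm 0 i.succ]
  ring

/-- Completing the square in the pivot variable splits the form of `A` into a nonnegative square and
the form of the Schur complement. -/
theorem posSemidef_iff_schurMatrix {A : Matrix (Fin (m + 1)) (Fin (m + 1)) ℝ}
    (hA : A.IsHermitian) (h0 : 0 < A 0 0) : A.PosSemidef ↔ (schurMatrix A).PosSemidef := by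
  rw [posSemidef_iff_real, posSemidef_iff_real]
  refine ⟨fun h => ⟨isHermitian_schurMatrix hA, fun y => ?_⟩, fun h => ⟨hA, fun z => ?_⟩⟩
  -- The first coordinate minimizes the form for given `y`, so the square vanishes.
  · have := h.2 (Fin.cons (-(∑ j, A 0 j.succ * y j) / A 0 0) y)
    rw [quad_cons hA] at this
    rw [quad_schurMatrix hA]
    refine this.trans_eq ?_
    field_simp
    ring
  · have := h.2 (Fin.tail z)
    rw [quad_schurMatrix hA] at this
    have hz := quad_cons hA (z 0) (Fin.tail z)
    rw [Fin.cons_self_tail] at hz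
    rw [hz]
    set s := ∑ j, A 0 j.succ * Fin.tail z j
    have h1 : 0 ≤ A 0 0 * (z 0 + s / A 0 0) ^ 2 := by positivity
    have h2 : A 0 0 * (z 0 + s / A 0 0) ^ 2 = A 0 0 * z 0 ^ 2 + 2 * z 0 * s + s ^ 2 / A 0 0 := by
      field_simp
      ring
    linarith

/-- Subtracting multiples of row 0 from the other rows preserves the determinant and clears column 0
below the pivot. -/
theorem det_eq_mul_det_schurMatrix {A : Matrix (Fin (m + 1)) (Fin (m + 1)) ℝ}
    (h0 : A 0 0 ≠ 0) : A.det = A 0 0 * (schurMatrix A).det := by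
  set B : Matrix (Fin (m + 1)) (Fin (m + 1)) ℝ :=
    Matrix.of fun i j => A i j - (if i = 0 then 0 else A i 0 / A 0 0) * A 0 j with hB
  have hAB : A.det = B.det := by
    refine Matrix.det_eq_of_forall_row_eq_smul_add_const
      (fun i => if i = 0 then 0 else A i 0 / A 0 0) 0 (by simp) fun i j => ?_
    simp [hB]
  have hcol : ∀ i : Fin m, B i.succ 0 = 0 := fun i => by
    simp [hB, Fin.succ_ne_zero, h0]
  rw [hAB, Matrix.det_succ_column_zero, Fin.sum_univ_succ]
  have hS : B.submatrix (Fin.succAbove 0) Fin.succ = schurMatrix A := by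
    ext i j
    simp only [hB, schurMatrix, Matrix.submatrix_apply, Matrix.of_apply, Fin.zero_succAbove,
      Fin.succ_ne_zero, if_false]
    ring
  rw [hS]
  simp [hcol]
  simp [hB]

/-- Cauchy–Schwarz for unit vectors: `(A 0 j)² ≤ A 0 0 * A j j`. -/
theorem row_eq_zero_of_pivot_nonpos {A : Matrix (Fin (m + 1)) (Fin (m + 1)) ℝ}
    (hA : A.PosSemidef) (h0 : A 0 0 ≤ 0) (j : Fin (m + 1)) : A 0 j = 0 := by
  have h00 : A 0 0 = 0 := le_antisymm h0 hA.diag_nonneg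
  have := hA.cauchy_schwarz (Pi.single 0 1) (Pi.single j 1)
  simp only [Matrix.mulVec_single_one, single_one_dotProduct, Matrix.col_apply, h00,
    zero_mul] at this
  exact pow_eq_zero_iff two_ne_zero |>.1 (le_antisymm this (sq_nonneg _))

theorem posSemidef_iff_of_row_eq_zero {A : Matrix (Fin (m + 1)) (Fin (m + 1)) ℝ}
    (hA : A.IsHermitian) (h0 : ∀ j, A 0 j = 0) :
    A.PosSemidef ↔ (A.submatrix Fin.succ Fin.succ).PosSemidef := by
  refine ⟨fun h => h.submatrix _, fun h => (posSemidef_iff_real A).2 ⟨hA, fun z => ?_⟩⟩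
  have hz := quad_cons hA (z 0) (Fin.tail z)
  rw [Fin.cons_self_tail] at hz
  have := h.quad_nonneg (Fin.tail z)
  rw [quad_eq_sum] at this
  rw [hz]
  simpa [h0] using this

end Pivot

/-! ### Correctness of the linear algebra programs -/

namespace Prog

variable (sol : DualSolver)

theorem eval_schur (m : ℕ) (A : Fin (m + 1) → Fin (m + 1) → ℝ) :
    Matrix.of (eval sol (schur m A)) = schurMatrix (Matrix.of A) := by
  ext i j
  simp [schur, schurMatrix]

/-- Semidefiniteness justifies stopping at a pivot that is not positive: its row is then zero. It
passes to the Schur complement, so no row exchanges are needed. -/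
theorem eval_psdDet (m : ℕ) (A : Fin m → Fin m → ℝ) (hA : (Matrix.of A).PosSemidef) :
    eval sol (psdDet m A) = (Matrix.of A).det := by
  induction m with
  | zero => simp [psdDet]
  | succ m ih =>
    simp only [psdDet, eval_bind, eval_const, eval_leq, Nat.cast_zero, decide_eq_true_eq]
    split_ifs with h0
    · rw [eval_pure, Matrix.det_eq_zero_of_row_eq_zero 0
        (row_eq_zero_of_pivot_nonpos hA h0)]
    · have h0' : 0 < (Matrix.of A) 0 0 := not_le.1 h0
      have hS := (posSemidef_iff_schurMatrix hA.isHermitian h0').1 hA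
      rw [← eval_schur sol] at hS
      rw [det_eq_mul_det_schurMatrix h0'.ne', ← eval_schur sol]
      simp [ih _ hS]

theorem eval_isPSD (m : ℕ) (A : Fin m → Fin m → ℝ) (hA : (Matrix.of A).IsHermitian) :
    eval sol (isPSD m A) = true ↔ (Matrix.of A).PosSemidef := by
  induction m with
  | zero =>
    simp only [isPSD, eval_tick, eval_pure, true_iff]
    exact (posSemidef_iff_real _).2 ⟨hA, fun z => by simp⟩
  | succ m ih =>
    simp only [isPSD, eval_bind, eval_const, eval_leq, Nat.cast_zero, decide_eq_true_eq]
    split_ifs with h0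
    · simp only [eval_bind, eval_allOf, eval_leq, eval_pure, Bool.and_eq_true, decide_eq_true_eq]
      split_ifs with hr
      · have hr' : ∀ j, (Matrix.of A) 0 j = 0 := fun j => le_antisymm (hr j).1 (hr j).2
        rw [posSemidef_iff_of_row_eq_zero hA hr']
        exact ih _ (hA.submatrix _)
      · simp only [eval_pure, Bool.false_eq_true, false_iff]
        intro h
        refine hr fun j => ?_
        have := row_eq_zero_of_pivot_nonpos h h0 j
        exact ⟨this.le, this.ge⟩
    · have h0' : 0 < (Matrix.of A) 0 0 := not_le.1 h0
      rw [posSemidef_iff_schurMatrix hA h0', ← eval_schur sol, eval_bind]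
      refine ih _ ?_
      rw [eval_schur]
      exact isHermitian_schurMatrix hA

theorem coinFree_schur (m : ℕ) (A : Fin (m + 1) → Fin (m + 1) → ℝ) : CoinFree (schur m A) :=
  coinFree_tabulate _ fun _ => coinFree_tabulate _ fun _ =>
    coinFree_bind (coinFree_mul _ _) fun _ => coinFree_bind (coinFree_div _ _) fun _ =>
      coinFree_sub _ _

theorem coinFree_psdDet (m : ℕ) (A : Fin m → Fin m → ℝ) : CoinFree (psdDet m A) := by
  induction m with
  | zero => exact coinFree_const 1
  | succ m ih =>
    exact coinFree_bind (coinFree_const 0) fun _ => coinFree_bind (coinFree_leq _ _) fun _ =>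
      coinFree_ite trivial (coinFree_bind (coinFree_schur m A) fun B =>
        coinFree_bind (ih B) fun _ => coinFree_mul _ _)

theorem coinFree_isPSD (m : ℕ) (A : Fin m → Fin m → ℝ) : CoinFree (isPSD m A) := by
  induction m with
  | zero => trivial
  | succ m ih =>
    refine coinFree_bind (coinFree_const 0) fun _ => coinFree_bind (coinFree_leq _ _) fun _ =>
      coinFree_ite (coinFree_bind (coinFree_allOf _ fun _ => ?_) fun _ => ?_)
        (coinFree_bind (coinFree_schur m A) fun B => ih B)
    · exact coinFree_bind (coinFree_leq _ _) fun _ => coinFree_bind (coinFree_leq _ _) fun _ =>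
        trivial
    · exact coinFree_ite (ih _) trivial

theorem coinFree_sqDist {d : ℕ} (x y : Fin d → ℝ) : CoinFree (sqDist x y) :=
  coinFree_sumOver _ fun _ => coinFree_bind (coinFree_sub _ _) fun _ => coinFree_mul _ _

theorem eval_sqDist {d : ℕ} (x y : Fin d → ℝ) :
    eval sol (sqDist x y) = ∑ j, (x j - y j) ^ 2 := by
  simp [sqDist, sq]

theorem coinFree_sumOn {n : ℕ} (S : Finset (Fin n)) {f : Fin n → Prog ℝ ℝ}
    (h : ∀ i, CoinFree (f i)) : CoinFree (sumOn S f) :=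
  coinFree_sumOver _ fun i => coinFree_ite (h i) (coinFree_const 0)

@[simp] theorem eval_sumOn {n : ℕ} (S : Finset (Fin n)) (f : Fin n → Prog ℝ ℝ) :
    eval sol (sumOn S f) = ∑ i ∈ S, eval sol (f i) := by
  have : ∀ i, eval sol (if i ∈ S then f i else const 0) =
      if i ∈ S then eval sol (f i) else 0 := fun i => by split_ifs <;> simp
  simp [sumOn, this]

end Prog

/-! ## Ellipsoids: membership, volume, condition number -/

section Factor

variable {ι : Type*} [Fintype ι]

open scoped MatrixOrder in
theorem Matrix.PosSemidef.exists_transpose_mul_self {A : Matrix ι ι ℝ} (hA : A.PosSemidef) :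
    ∃ B : Matrix ι ι ℝ, A = Bᵀ * B := by
  classical
  obtain ⟨B, hB⟩ := CStarAlgebra.nonneg_iff_eq_star_mul_self.mp hA.nonneg
  exact ⟨B, by simpa [Matrix.star_eq_conjTranspose] using hB⟩

theorem dotProduct_transpose_mul_self_mulVec (B : Matrix ι ι ℝ) (z : ι → ℝ) :
    z ⬝ᵥ ((Bᵀ * B) *ᵥ z) = (B *ᵥ z) ⬝ᵥ (B *ᵥ z) := by
  rw [← Matrix.mulVec_mulVec, Matrix.dotProduct_mulVec, Matrix.vecMul_transpose]

theorem dotProduct_self_eq_norm_sq (z : ι → ℝ) : z ⬝ᵥ z = ‖WithLp.toLp 2 z‖ ^ 2 := by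
  rw [EuclideanSpace.norm_sq_eq]
  simp [dotProduct, sq]

theorem dotProduct_vecMulVec_mulVec (v z : ι → ℝ) :
    z ⬝ᵥ (Matrix.vecMulVec v v *ᵥ z) = (v ⬝ᵥ z) ^ 2 := by
  rw [Matrix.vecMulVec_mulVec]
  simp [dotProduct_comm z v, sq]

/-- The range of a symmetric matrix is the orthogonal complement of its kernel. -/
theorem Matrix.IsHermitian.exists_mulVec_eq {M : Matrix ι ι ℝ} (hM : M.IsHermitian)
    (v : ι → ℝ) (hv : ∀ z, M *ᵥ z = 0 → v ⬝ᵥ z = 0) : ∃ z, M *ᵥ z = v := by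
  classical
  have hsym := Matrix.isSymmetric_toEuclideanLin_iff.2 hM
  have hadj : LinearMap.adjoint (Matrix.toEuclideanLin M) = Matrix.toEuclideanLin M :=
    (LinearMap.isSymmetric_iff_isSelfAdjoint _).1 hsym
  have hmem : WithLp.toLp 2 v ∈ (Matrix.toEuclideanLin M).kerᗮ := by
    rw [Submodule.mem_orthogonal]
    intro u hu
    have h0 : M *ᵥ u.ofLp = 0 := congrArg WithLp.ofLp (LinearMap.mem_ker.1 hu)
    have := hv _ h0
    rw [EuclideanSpace.inner_eq_star_dotProduct]
    simpa using this
  rw [LinearMap.orthogonal_ker, hadj] at hmem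
  obtain ⟨z, hz⟩ := hmem
  exact ⟨z.ofLp, congrArg WithLp.ofLp hz⟩

end Factor

namespace EllipsoidData

variable {d : ℕ}

/-- For `v = x - c` the hypothesis says `(v ⬝ᵥ z)² ≤ zᵀ M z`. Hence `v` is orthogonal to the kernel
of `M`, so `v = M z` for some `z`, and the inequality at this `z` forces `zᵀ M z ≤ 1`. No inverse is
used, so flat candidates are covered. -/
theorem mem_toSet_of_posSemidef (E : EllipsoidData ℝ d) (hE : E.shapeMatrix.PosSemidef)
    (x : EuclideanSpace ℝ (Fin d))
    (h : (E.shapeMatrix - Matrix.vecMulVec (fun j => x j - E.center j)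
      (fun j => x j - E.center j)).PosSemidef) : x ∈ E.toSet := by
  set v : Fin d → ℝ := fun j => x j - E.center j
  have hq : ∀ z, (v ⬝ᵥ z) ^ 2 ≤ z ⬝ᵥ (E.shapeMatrix *ᵥ z) := by
    intro z
    have := h.quad_nonneg z
    rw [Matrix.sub_mulVec, dotProduct_sub, dotProduct_vecMulVec_mulVec] at this
    linarith
  obtain ⟨z, hz⟩ := hE.isHermitian.exists_mulVec_eq v fun z hz => by
    have := hq z
    rw [hz, dotProduct_zero] at this
    exact pow_eq_zero_iff two_ne_zero |>.1 (le_antisymm this (sq_nonneg _))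
  refine ⟨z, fun j => ?_, ?_⟩
  · rw [hz]
    simp [v]
  · have := hq z
    rw [hz, dotProduct_comm z v] at this ⊢
    nlinarith

/-- The affine image of the unit ball under `x ↦ c + Bᵀ x`. -/
def affineBall (c : Fin d → ℝ) (B : Matrix (Fin d) (Fin d) ℝ) : Set (EuclideanSpace ℝ (Fin d)) :=
  (fun y => WithLp.toLp 2 c + y) '' (Matrix.toEuclideanLin Bᵀ '' Metric.closedBall 0 1)

theorem volume_affineBall (c : Fin d → ℝ) (B : Matrix (Fin d) (Fin d) ℝ) :
    volume (affineBall c B) = ENNReal.ofReal (Real.sqrt (Bᵀ * B).det) *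
      volume (Metric.closedBall (0 : EuclideanSpace ℝ (Fin d)) 1) := by
  rw [affineBall, Set.image_add_left, measure_preimage_add, Measure.addHaar_image_linearMap,
    Matrix.det_mul, Matrix.det_transpose, Real.sqrt_mul_self_eq_abs]
  congr 3
  rw [Matrix.toEuclideanLin_eq_toLin_orthonormal, LinearMap.det_toLin, Matrix.det_transpose]

/-- Since `M z = Bᵀ (B z)` and `zᵀ M z = ‖B z‖²`, the vector `B z` is the required point of the unit
ball. -/
theorem toSet_subset_affineBall (E : EllipsoidData ℝ d) {B : Matrix (Fin d) (Fin d) ℝ}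
    (hB : E.shapeMatrix = Bᵀ * B) : E.toSet ⊆ affineBall E.center B := by
  rintro x ⟨z, hx, hz⟩
  refine ⟨WithLp.toLp 2 (E.shapeMatrix *ᵥ z), ⟨WithLp.toLp 2 (B *ᵥ z), ?_, ?_⟩, ?_⟩
  · rw [hB, dotProduct_transpose_mul_self_mulVec, dotProduct_self_eq_norm_sq] at hz
    rw [mem_closedBall_zero_iff]
    nlinarith [norm_nonneg (WithLp.toLp 2 (B *ᵥ z))]
  · rw [Matrix.toLpLin_toLp, Matrix.toLin'_apply, Matrix.mulVec_mulVec, hB]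
  · ext j
    simp [hx j]

theorem affineBall_subset_toSet (E : EllipsoidData ℝ d) {B : Matrix (Fin d) (Fin d) ℝ}
    (hB : E.shapeMatrix = Bᵀ * B) (hu : IsUnit B.det) : affineBall E.center B ⊆ E.toSet := by
  rintro _ ⟨_, ⟨u, hu1, rfl⟩, rfl⟩
  have h1 : B *ᵥ (B⁻¹ *ᵥ u.ofLp) = u.ofLp := by
    rw [Matrix.mulVec_mulVec, Matrix.mul_nonsing_inv _ hu, Matrix.one_mulVec]
  refine ⟨B⁻¹ *ᵥ u.ofLp, fun j => ?_, ?_⟩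
  · rw [hB, ← Matrix.mulVec_mulVec, h1]
    simp
  · rw [hB, dotProduct_transpose_mul_self_mulVec, h1, dotProduct_self_eq_norm_sq]
    rw [mem_closedBall_zero_iff] at hu1
    exact pow_le_one₀ (norm_nonneg _) hu1

theorem volume_toSet_le (E : EllipsoidData ℝ d) (hE : E.shapeMatrix.PosSemidef) :
    volume E.toSet ≤ ENNReal.ofReal (Real.sqrt E.shapeMatrix.det) *
      volume (Metric.closedBall (0 : EuclideanSpace ℝ (Fin d)) 1) := by
  obtain ⟨B, hB⟩ := hE.exists_transpose_mul_self
  rw [hB, ← volume_affineBall E.center]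
  exact measure_mono (E.toSet_subset_affineBall hB)

theorem le_volume_toSet (E : EllipsoidData ℝ d) (hE : E.shapeMatrix.PosDef) :
    ENNReal.ofReal (Real.sqrt E.shapeMatrix.det) *
      volume (Metric.closedBall (0 : EuclideanSpace ℝ (Fin d)) 1) ≤ volume E.toSet := by
  obtain ⟨B, hB⟩ := hE.posSemidef.exists_transpose_mul_self
  have hdet := hE.det_pos
  rw [hB, Matrix.det_mul, Matrix.det_transpose] at hdet
  rw [hB, ← volume_affineBall E.center]
  exact measure_mono (E.affineBall_subset_toSet hB (by
    rw [isUnit_iff_ne_zero]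
    rintro h
    simp [h] at hdet))

end EllipsoidData

section Spectral

variable {d : ℕ} {M : Matrix (Fin d) (Fin d) ℝ}

theorem Matrix.IsHermitian.posSemidef_sub_smul_one (hM : M.IsHermitian) {c : ℝ}
    (hc : ∀ i, c ≤ hM.eigenvalues i) : (M - c • (1 : Matrix (Fin d) (Fin d) ℝ)).PosSemidef := by
  have h : M - c • 1 = (hM.eigenvectorUnitary : Matrix (Fin d) (Fin d) ℝ) *
      Matrix.diagonal (fun i => hM.eigenvalues i - c) *
      (hM.eigenvectorUnitary : Matrix (Fin d) (Fin d) ℝ)ᴴ := by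
    have h1 := hM.spectral_theorem
    rw [Unitary.conjStarAlgAut_apply] at h1
    have hU : (hM.eigenvectorUnitary : Matrix (Fin d) (Fin d) ℝ) *
        (hM.eigenvectorUnitary : Matrix (Fin d) (Fin d) ℝ)ᴴ = 1 :=
      Unitary.coe_mul_star_self hM.eigenvectorUnitary
    have h2 : Matrix.diagonal (fun i => hM.eigenvalues i - c) =
        Matrix.diagonal (RCLike.ofReal ∘ hM.eigenvalues) - c • (1 : Matrix (Fin d) (Fin d) ℝ) := by
      ext i j
      by_cases hij : i = j <;> simp [hij]
    rw [h2, Matrix.mul_sub, Matrix.sub_mul, Matrix.mul_smul, Matrix.smul_mul, Matrix.mul_one, hU]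
    congr 1
  rw [h]
  exact (Matrix.posSemidef_diagonal_iff.2 fun i => sub_nonneg.2 (hc i)).mul_mul_conjTranspose_same _

theorem Matrix.IsHermitian.eigenvalue_lower_bound (hM : M.IsHermitian) {c : ℝ}
    (hc : ∀ i, c ≤ hM.eigenvalues i) (z : Fin d → ℝ) : c * (z ⬝ᵥ z) ≤ z ⬝ᵥ (M *ᵥ z) := by
  have := (hM.posSemidef_sub_smul_one hc).quad_nonneg z
  rw [Matrix.sub_mulVec, Matrix.smul_mulVec, Matrix.one_mulVec, dotProduct_sub,
    dotProduct_smul, smul_eq_mul] at this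
  linarith

theorem Matrix.IsHermitian.posSemidef_smul_one_sub (hM : M.IsHermitian) {c : ℝ}
    (hc : ∀ i, hM.eigenvalues i ≤ c) : (c • (1 : Matrix (Fin d) (Fin d) ℝ) - M).PosSemidef := by
  have h : c • 1 - M = (hM.eigenvectorUnitary : Matrix (Fin d) (Fin d) ℝ) *
      Matrix.diagonal (fun i => c - hM.eigenvalues i) *
      (hM.eigenvectorUnitary : Matrix (Fin d) (Fin d) ℝ)ᴴ := by
    have h1 := hM.spectral_theorem
    rw [Unitary.conjStarAlgAut_apply] at h1
    have hU : (hM.eigenvectorUnitary : Matrix (Fin d) (Fin d) ℝ) *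
        (hM.eigenvectorUnitary : Matrix (Fin d) (Fin d) ℝ)ᴴ = 1 :=
      Unitary.coe_mul_star_self hM.eigenvectorUnitary
    have h2 : Matrix.diagonal (fun i => c - hM.eigenvalues i) =
        c • (1 : Matrix (Fin d) (Fin d) ℝ) - Matrix.diagonal (RCLike.ofReal ∘ hM.eigenvalues) := by
      ext i j
      by_cases hij : i = j <;> simp [hij]
    rw [h2, Matrix.mul_sub, Matrix.sub_mul, Matrix.mul_smul, Matrix.smul_mul, Matrix.mul_one, hU]
    congr 1
  rw [h]
  exact (Matrix.posSemidef_diagonal_iff.2 fun i => sub_nonneg.2 (hc i)).mul_mul_conjTranspose_same _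

theorem Matrix.IsHermitian.eigenvalue_upper_bound (hM : M.IsHermitian) {c : ℝ}
    (hc : ∀ i, hM.eigenvalues i ≤ c) (z : Fin d → ℝ) : z ⬝ᵥ (M *ᵥ z) ≤ c * (z ⬝ᵥ z) := by
  have := (hM.posSemidef_smul_one_sub hc).quad_nonneg z
  rw [Matrix.sub_mulVec, Matrix.smul_mulVec, Matrix.one_mulVec, dotProduct_sub,
    dotProduct_smul, smul_eq_mul] at this
  linarith

/-- Put `z = M⁻¹ v`. Both bounds combine an eigenvalue bound for `M` itself with Cauchy–Schwarz, for
`I` in the first and for `M` in the second, and then cancel a common factor. -/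
theorem Matrix.PosDef.inv_quad_bounds (hM : M.PosDef) {l u : ℝ} (hl : 0 < l)
    (hle : ∀ i, l ≤ hM.isHermitian.eigenvalues i) (hue : ∀ i, hM.isHermitian.eigenvalues i ≤ u)
    (v : Fin d → ℝ) :
    l * (v ⬝ᵥ (M⁻¹ *ᵥ v)) ≤ v ⬝ᵥ v ∧ v ⬝ᵥ v ≤ u * (v ⬝ᵥ (M⁻¹ *ᵥ v)) := by
  have hu : IsUnit M.det := (Matrix.isUnit_iff_isUnit_det _).1 hM.isUnit
  set z := M⁻¹ *ᵥ v with hz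
  have hv : M *ᵥ z = v := by
    rw [hz, Matrix.mulVec_mulVec, Matrix.mul_nonsing_inv _ hu, Matrix.one_mulVec]
  have hzz : 0 ≤ z ⬝ᵥ z := by
    simpa using dotProduct_star_self_nonneg z
  have hvv : 0 ≤ v ⬝ᵥ v := by
    simpa using dotProduct_star_self_nonneg v
  constructor
  · have h1 := hM.isHermitian.eigenvalue_lower_bound hle z
    rw [hv, dotProduct_comm z v] at h1
    have h2 := (Matrix.PosSemidef.one (n := Fin d) (R := ℝ)).cauchy_schwarz v z
    simp only [Matrix.one_mulVec] at h2
    set t := v ⬝ᵥ z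
    rcases (mul_nonneg hl.le hzz |>.trans h1).eq_or_lt with h0 | h0
    · rw [← h0, mul_zero]
      exact hvv
    · refine le_of_mul_le_mul_right ?_ h0
      nlinarith
  · have h1 := hM.isHermitian.eigenvalue_upper_bound hue v
    have h2 := hM.posSemidef.cauchy_schwarz v z
    rw [hv, dotProduct_comm z v] at h2
    have h3 : 0 ≤ v ⬝ᵥ z := by
      rw [dotProduct_comm, ← hv]
      exact hM.posSemidef.quad_nonneg z
    rcases hvv.eq_or_lt with h0 | h0
    · have : v = 0 := dotProduct_self_eq_zero.1 h0.symm
      rw [this]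
      simp
    · refine le_of_mul_le_mul_right ?_ h0
      nlinarith

/-- A point in a ball that is centred at a point of the ellipsoid and has at most the diameter of
the ellipsoid as its radius lies in the ellipsoid blown up by three times its condition number. -/
theorem quad_le_of_condNumber {β : ℝ} (hβ : 1 ≤ β) (hM : M.PosDef)
    (hcond : ellipsoidCondNumber M hM.isHermitian ≤ β) (c x p q : Fin d → ℝ)
    (hp : (p - c) ⬝ᵥ (M⁻¹ *ᵥ (p - c)) ≤ 1) (hq : (q - c) ⬝ᵥ (M⁻¹ *ᵥ (q - c)) ≤ 1)
    (hx : (x - p) ⬝ᵥ (x - p) ≤ (p - q) ⬝ᵥ (p - q)) :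
    (x - c) ⬝ᵥ (M⁻¹ *ᵥ (x - c)) ≤ 9 * β ^ 2 := by
  rcases Nat.eq_zero_or_pos d with rfl | hd
  · simp
    positivity
  have : Nonempty (Fin d) := ⟨⟨0, hd⟩⟩
  set ev := hM.isHermitian.eigenvalues with hev
  obtain ⟨i₀, hi₀⟩ := exists_eq_ciInf_of_finite (f := ev)
  have hl : 0 < ⨅ i, ev i := hi₀ ▸ hM.eigenvalues_pos i₀
  have hle : ∀ i, (⨅ i, ev i) ≤ ev i := fun i => ciInf_le (Set.finite_range _).bddBelow i
  have hue : ∀ i, ev i ≤ ⨆ i, ev i := fun i => le_ciSup (Set.finite_range _).bddAbove i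
  set l := ⨅ i, ev i
  set u := ⨆ i, ev i
  have hu : 0 < u := hl.trans_le ((hle i₀).trans (hue i₀))
  have hlu : u ≤ β ^ 2 * l := by
    have : u / l ≤ β ^ 2 := by
      rw [← Real.sqrt_le_left (by linarith)]
      exact hcond
    rwa [div_le_iff₀ hl] at this
  have hbd := hM.inv_quad_bounds hl hle hue
  obtain ⟨A, hA⟩ := hM.inv.posSemidef.exists_transpose_mul_self
  have hn : ∀ v, v ⬝ᵥ (M⁻¹ *ᵥ v) = ‖WithLp.toLp 2 (A *ᵥ v)‖ ^ 2 := fun v => by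
    rw [hA, dotProduct_transpose_mul_self_mulVec, dotProduct_self_eq_norm_sq]
  have hp' : ‖WithLp.toLp 2 (A *ᵥ (p - c))‖ ≤ 1 := by
    rw [hn] at hp
    nlinarith [norm_nonneg (WithLp.toLp 2 (A *ᵥ (p - c)))]
  have hq' : ‖WithLp.toLp 2 (A *ᵥ (q - c))‖ ≤ 1 := by
    rw [hn] at hq
    nlinarith [norm_nonneg (WithLp.toLp 2 (A *ᵥ (q - c)))]
  have hpq : ‖WithLp.toLp 2 (A *ᵥ (p - q))‖ ≤ 2 := by
    have : WithLp.toLp 2 (A *ᵥ (p - q)) =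
        WithLp.toLp 2 (A *ᵥ (p - c)) - WithLp.toLp 2 (A *ᵥ (q - c)) := by
      rw [← WithLp.toLp_sub, ← Matrix.mulVec_sub]
      congr 2
      abel
    rw [this]
    exact (norm_sub_le _ _).trans (by linarith)
  -- Going to the Euclidean norm, where `x` and `q` are compared, and back costs the factor `√(u /
  -- l) ≤ β`.
  have hxp : ‖WithLp.toLp 2 (A *ᵥ (x - p))‖ ≤ 2 * β := by
    have h1 := (hbd (x - p)).1
    have h2 := (hbd (p - q)).2
    rw [hn] at h1 h2
    have h3 : ‖WithLp.toLp 2 (A *ᵥ (p - q))‖ ^ 2 ≤ 4 := by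
      nlinarith [norm_nonneg (WithLp.toLp 2 (A *ᵥ (p - q)))]
    have h4 : l * ‖WithLp.toLp 2 (A *ᵥ (x - p))‖ ^ 2 ≤ l * (2 * β) ^ 2 := by nlinarith
    exact le_of_sq_le_sq (le_of_mul_le_mul_left h4 hl) (by linarith)
  have hxc : ‖WithLp.toLp 2 (A *ᵥ (x - c))‖ ≤ 3 * β := by
    have : WithLp.toLp 2 (A *ᵥ (x - c)) =
        WithLp.toLp 2 (A *ᵥ (x - p)) + WithLp.toLp 2 (A *ᵥ (p - c)) := by
      rw [← WithLp.toLp_add, ← Matrix.mulVec_add]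
      congr 2
      abel
    rw [this]
    exact (norm_add_le _ _).trans (by linarith)
  rw [hn]
  nlinarith [norm_nonneg (WithLp.toLp 2 (A *ᵥ (x - c)))]

end Spectral

/-! ## Optimal designs -/

section Design

variable {n m : ℕ} (x : Fin n → Fin m → ℝ) (S : Finset (Fin n))

theorem designMatrix_apply (w : Fin n → ℝ) (j k : Fin m) :
    designMatrix x S w j k = ∑ i ∈ S, w i * (x i j * x i k) := by
  simp [designMatrix, Matrix.sum_apply, Matrix.vecMulVec_apply]

theorem isHermitian_designMatrix (w : Fin n → ℝ) : (designMatrix x S w).IsHermitian := by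
  ext j k
  simp [designMatrix_apply, mul_comm]

theorem designMatrix_mulVec (w : Fin n → ℝ) (z : Fin m → ℝ) :
    designMatrix x S w *ᵥ z = ∑ i ∈ S, (w i * (x i ⬝ᵥ z)) • x i := by
  simp only [designMatrix, Matrix.sum_mulVec, Matrix.smul_mulVec, Matrix.vecMulVec_mulVec]
  refine Finset.sum_congr rfl fun i _ => ?_
  rw [op_smul_eq_smul, smul_smul]

theorem quad_designMatrix (w : Fin n → ℝ) (z : Fin m → ℝ) :
    z ⬝ᵥ (designMatrix x S w *ᵥ z) = ∑ i ∈ S, w i * (x i ⬝ᵥ z) ^ 2 := by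
  rw [designMatrix_mulVec, dotProduct_sum]
  refine Finset.sum_congr rfl fun i _ => ?_
  rw [dotProduct_smul, dotProduct_comm, smul_eq_mul]
  ring

theorem posSemidef_designMatrix {w : Fin n → ℝ} (hw : ∀ i ∈ S, 0 ≤ w i) :
    (designMatrix x S w).PosSemidef :=
  (posSemidef_iff_real _).2 ⟨isHermitian_designMatrix x S w, fun z => by
    rw [quad_designMatrix]
    exact Finset.sum_nonneg fun i hi => mul_nonneg (hw i hi) (sq_nonneg _)⟩

theorem mul_designMatrix_mul_transpose (A : Matrix (Fin m) (Fin m) ℝ) (w : Fin n → ℝ) :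
    A * designMatrix x S w * Aᵀ = designMatrix (fun i => A *ᵥ x i) S w := by
  simp only [designMatrix, Matrix.mul_sum, Matrix.sum_mul, Matrix.mul_smul, Matrix.smul_mul,
    Matrix.mul_vecMulVec, Matrix.vecMulVec_mul, Matrix.vecMul_transpose]

theorem trace_designMatrix (w : Fin n → ℝ) :
    (designMatrix x S w).trace = ∑ i ∈ S, w i * (x i ⬝ᵥ x i) := by
  simp [designMatrix, Matrix.trace_sum, Matrix.trace_smul, Matrix.trace_vecMulVec]

theorem trace_inv_mul_designMatrix (B : Matrix (Fin m) (Fin m) ℝ) (w : Fin n → ℝ) :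
    (B * designMatrix x S w).trace = ∑ i ∈ S, w i * (x i ⬝ᵥ (B *ᵥ x i)) := by
  simp only [designMatrix, Matrix.mul_sum, Matrix.trace_sum, Matrix.mul_smul, Matrix.trace_smul,
    Matrix.mul_vecMulVec, Matrix.trace_vecMulVec, smul_eq_mul]
  exact Finset.sum_congr rfl fun i _ => by rw [dotProduct_comm]

theorem designMatrix_extend {S' : Finset (Fin n)} (h : S' ⊆ S) (w : Fin n → ℝ) :
    designMatrix x S (fun i => if i ∈ S' then w i else 0) = designMatrix x S' w := by
  simp only [designMatrix, ite_smul, zero_smul]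
  rw [← Finset.sum_filter, Finset.filter_mem_eq_inter, Finset.inter_eq_right.2 h]

theorem IsDualFeasible.extend {S' : Finset (Fin n)} (h : S' ⊆ S) {w : Fin n → ℝ}
    (hw : IsDualFeasible (m := m) S' w) :
    IsDualFeasible (m := m) S (fun i => if i ∈ S' then w i else 0) := by
  refine ⟨fun i _ => ?_, ?_⟩
  · dsimp only
    split_ifs with hi
    exacts [hw.1 i hi, le_rfl]
  · rw [← Finset.sum_filter, Finset.filter_mem_eq_inter, Finset.inter_eq_right.2 h]
    exact hw.2

theorem det_add_smul_vecMulVec {A : Matrix (Fin m) (Fin m) ℝ} (hA : IsUnit A.det) (s : ℝ)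
    (v : Fin m → ℝ) :
    (A + s • Matrix.vecMulVec v v).det = A.det * (1 + s * (v ⬝ᵥ (A⁻¹ *ᵥ v))) := by
  have h := Matrix.det_add_replicateCol_mul_replicateRow (ι := Unit) hA (s • v) v
  rw [Matrix.det_unique (1 + _)] at h
  have h1 : Matrix.replicateCol Unit (s • v) * Matrix.replicateRow Unit v =
      s • Matrix.vecMulVec v v := by
    rw [← Matrix.vecMulVec_eq, Matrix.smul_vecMulVec]
  rw [h1] at h
  rw [h, Matrix.add_apply, Matrix.one_apply_eq, Matrix.mul_assoc, ← Matrix.replicateCol_mulVec,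
    Matrix.replicateRow_mul_replicateCol_apply, Matrix.mulVec_smul, dotProduct_smul, smul_eq_mul]

variable {x S} {w : Fin n → ℝ}

/-- The Karush–Kuhn–Tucker condition: the ellipsoid given by an optimal design encloses the
points. -/
theorem IsDualOptimal.quad_le_one (hw : IsDualOptimal x S w) (hdet : 0 < (designMatrix x S w).det)
    {i : Fin n} (hi : i ∈ S) : x i ⬝ᵥ ((designMatrix x S w)⁻¹ *ᵥ x i) ≤ 1 := by
  obtain _ | k := m
  · simp
  set H := designMatrix x S w with hH
  set u := x i ⬝ᵥ (H⁻¹ *ᵥ x i) with hu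
  by_contra! hu1
  set e := u - 1 with he
  have he0 : 0 < e := sub_pos.2 hu1
  have hk : (0 : ℝ) ≤ k := k.cast_nonneg
  -- Move a fraction `t` of the design to point `i`. The determinant is multiplied by `(1 - t)^k (1
  -- - t + t (k + 1) u)`, whose derivative at `t = 0` is `(k + 1) e > 0`. This `t` is so small that,
  -- after Bernoulli's inequality, the quadratic loss is at most half of the linear gain, against
  -- optimality.
  set t : ℝ := e / (2 * (k + 1) * (1 + e)) with ht
  have ht0 : 0 < t := by positivity
  have ht1 : t < 1 := by
    rw [ht, div_lt_one (by positivity)]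
    nlinarith [mul_nonneg hk he0.le]
  have hte : t * (2 * (k + 1) * (1 + e)) = e := div_mul_cancel₀ _ (by positivity)
  set s : ℝ := t * (k + 1) / (1 - t) with hs
  have hst : (1 - t) * s = t * (k + 1) := mul_div_cancel₀ _ (by linarith)
  set w' : Fin n → ℝ := fun j => (1 - t) * w j + if j = i then t * (k + 1) else 0 with hw'
  have hfeas : IsDualFeasible (m := k + 1) S w' := by
    refine ⟨fun j hj => ?_, ?_⟩
    · have h1 : 0 ≤ (1 - t) * w j := mul_nonneg (by linarith) (hw.1.1 j hj)
      simp only [hw']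
      split_ifs <;> nlinarith
    · have h1 := hw.1.2
      simp only [hw', Finset.sum_add_distrib, ← Finset.mul_sum, Finset.sum_ite_eq', hi, if_true]
      push_cast at h1 ⊢
      nlinarith
  have hmat : designMatrix x S w' = (1 - t) • (H + s • Matrix.vecMulVec (x i) (x i)) := by
    rw [smul_add, smul_smul, hst, hH]
    simp only [designMatrix, hw', add_smul, Finset.sum_add_distrib, Finset.smul_sum, smul_smul,
      ite_smul, zero_smul, Finset.sum_ite_eq', hi, if_true]
  have hle := hw.2 w' hfeas
  rw [hmat, Matrix.det_smul, det_add_smul_vecMulVec hdet.ne'.isUnit, ← hH, ← hu,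
    Fintype.card_fin] at hle
  have h2 : (1 - t) ^ (k + 1) * (1 + s * u) ≤ 1 := by
    refine le_of_mul_le_mul_right ?_ hdet
    linarith
  have h3 : (1 - t) ^ (k + 1) * (1 + s * u) = (1 - t) ^ k * (1 - t + t * (k + 1) * u) := by
    rw [← hst]
    ring
  have h4 : 1 - k * t ≤ (1 - t) ^ k := by
    have := one_add_mul_le_pow (a := -t) (by linarith) k
    rw [← sub_eq_add_neg] at this
    linarith
  have h5 : 0 < 1 - t + t * (k + 1) * u := by
    have : 0 < t * (k + 1) * u := mul_pos (by positivity) (by linarith)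
    linarith
  have h6 : (1 - k * t) * (1 - t + t * (k + 1) * u) ≤ 1 :=
    (mul_le_mul_of_nonneg_right h4 h5.le).trans (h3 ▸ h2)
  have h7 : t * ((k + 1) * e - t * (k ^ 2 + k * (k + 1) * e)) ≤ 0 := by
    have : u = 1 + e := by simp [he]
    rw [this] at h6
    nlinarith
  have h8 : t * (k ^ 2 + k * (k + 1) * e) ≤ t * ((k + 1) ^ 2 * (1 + e)) := by
    refine mul_le_mul_of_nonneg_left ?_ ht0.le
    nlinarith [mul_nonneg hk he0.le]
  have h9 : t * ((k + 1) ^ 2 * (1 + e)) = (k + 1) * e / 2 := by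
    have h11 : (k + 1) * (t * (2 * (k + 1) * (1 + e))) / 2 = (k + 1) * e / 2 := by rw [hte]
    rw [← h11]
    ring
  have h10 : 0 < (k + 1) * e - t * (k ^ 2 + k * (k + 1) * e) := by
    have : 0 < (k + 1) * e := by positivity
    linarith
  exact absurd h7 (not_le.2 (mul_pos ht0 h10))

theorem sum_mul_quad_inv_designMatrix
    (hdet : 0 < (designMatrix x S w).det) :
    ∑ i ∈ S, w i * (x i ⬝ᵥ ((designMatrix x S w)⁻¹ *ᵥ x i)) = m := by
  rw [← trace_inv_mul_designMatrix, Matrix.nonsing_inv_mul _ hdet.ne'.isUnit, Matrix.trace_one,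
    Fintype.card_fin]

/-- An optimal design of full rank has full weight. -/
theorem IsDualOptimal.sum_eq (hw : IsDualOptimal x S w) (hdet : 0 < (designMatrix x S w).det) :
    ∑ i ∈ S, w i = m := by
  refine le_antisymm hw.1.2 ((sum_mul_quad_inv_designMatrix hdet).symm.trans_le ?_)
  exact Finset.sum_le_sum fun i hi =>
    mul_le_of_le_one_right (hw.1.1 i hi) (hw.quad_le_one hdet hi)

/-- Complementary slackness. -/
theorem IsDualOptimal.mul_quad_eq (hw : IsDualOptimal x S w)
    (hdet : 0 < (designMatrix x S w).det) {i : Fin n} (hi : i ∈ S) :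
    w i * (x i ⬝ᵥ ((designMatrix x S w)⁻¹ *ᵥ x i)) = w i :=
  (Finset.sum_eq_sum_iff_of_le fun i hi =>
    mul_le_of_le_one_right (hw.1.1 i hi) (hw.quad_le_one hdet hi)).1
    ((sum_mul_quad_inv_designMatrix hdet).trans (hw.sum_eq hdet).symm) i hi

theorem posDef_designMatrix (hw : ∀ i ∈ S, 0 ≤ w i) (hdet : 0 < (designMatrix x S w).det) :
    (designMatrix x S w).PosDef :=
  (posSemidef_designMatrix x S hw).posDef_iff_det_ne_zero.2 hdet.ne'

/-- The enclosing property in dual form, `x_i x_iᵀ ≤ H`, by Cauchy–Schwarz for `z` and `H⁻¹ x_i`. It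
can be tested against directions without inverting anything. -/
theorem IsDualOptimal.sq_dotProduct_le (hw : IsDualOptimal x S w)
    (hdet : 0 < (designMatrix x S w).det) {i : Fin n} (hi : i ∈ S) (z : Fin m → ℝ) :
    (x i ⬝ᵥ z) ^ 2 ≤ ∑ j ∈ S, w j * (x j ⬝ᵥ z) ^ 2 := by
  have hpd := posDef_designMatrix hw.1.1 hdet
  rw [← quad_designMatrix]
  set H := designMatrix x S w
  have h1 := hpd.posSemidef.cauchy_schwarz z (H⁻¹ *ᵥ x i)
  have h2 : H *ᵥ (H⁻¹ *ᵥ x i) = x i := by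
    rw [Matrix.mulVec_mulVec, Matrix.mul_nonsing_inv _ hdet.ne'.isUnit, Matrix.one_mulVec]
  rw [h2, dotProduct_comm z, dotProduct_comm (H⁻¹ *ᵥ x i)] at h1
  exact h1.trans (mul_le_of_le_one_right (hpd.posSemidef.quad_nonneg z) (hw.quad_le_one hdet hi))

/-- Truncating the coin bias is therefore harmless for designs of full rank. For `h = H⁻¹ x_i`,
slackness gives `x_i ⬝ᵥ h = 1`; then `hᵀ H h = 1` is a sum of nonnegative terms, one of which is `w
i`. -/
theorem IsDualOptimal.weight_le_one (hw : IsDualOptimal x S w)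
    (hdet : 0 < (designMatrix x S w).det) {i : Fin n} (hi : i ∈ S) : w i ≤ 1 := by
  by_contra! h
  have hpd := posDef_designMatrix hw.1.1 hdet
  have hslack := hw.mul_quad_eq hdet hi
  have hq := quad_designMatrix x S w ((designMatrix x S w)⁻¹ *ᵥ x i)
  rw [Matrix.mulVec_mulVec, Matrix.mul_nonsing_inv _ hdet.ne'.isUnit, Matrix.one_mulVec,
    dotProduct_comm] at hq
  have hone : x i ⬝ᵥ ((designMatrix x S w)⁻¹ *ᵥ x i) = 1 :=
    mul_left_cancel₀ (by linarith : w i ≠ 0) (hslack.trans (mul_one _).symm)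
  have hsingle := Finset.single_le_sum
    (f := fun j => w j * (x j ⬝ᵥ ((designMatrix x S w)⁻¹ *ᵥ x i)) ^ 2)
    (fun j hj => mul_nonneg (hw.1.1 j hj) (sq_nonneg _)) hi
  rw [← hq] at hsingle
  simp only [hone, one_pow, mul_one] at hsingle
  linarith

end Design

/-! ### Determinant inequalities -/

section Det

variable {m : ℕ}

/-- Multiply `λ ≤ exp (λ - 1)` over the eigenvalues. -/
theorem det_le_one_of_trace_le {L : Matrix (Fin m) (Fin m) ℝ} (hL : L.PosSemidef)
    (ht : L.trace ≤ m) : L.det ≤ 1 := by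
  have h1 := hL.isHermitian.det_eq_prod_eigenvalues
  have h2 := hL.isHermitian.trace_eq_sum_eigenvalues
  simp only [RCLike.ofReal_real_eq_id, id_eq] at h1 h2
  rw [h1]
  calc ∏ i, hL.isHermitian.eigenvalues i
      ≤ ∏ i, Real.exp (hL.isHermitian.eigenvalues i - 1) :=
        Finset.prod_le_prod (fun i _ => hL.eigenvalues_nonneg i) fun i _ => by
          have := Real.add_one_le_exp (hL.isHermitian.eigenvalues i - 1)
          linarith
    _ = Real.exp (L.trace - m) := by
        rw [← Real.exp_sum, Finset.sum_sub_distrib, ← h2]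
        simp
    _ ≤ 1 := Real.exp_le_one_iff.2 (by linarith)

/-- The inequality of arithmetic and geometric means for the determinant. -/
theorem det_le_pow_of_trace_le (hm : 0 < m) {L : Matrix (Fin m) (Fin m) ℝ} (hL : L.PosSemidef)
    {t : ℝ} (ht0 : 0 < t) (ht : L.trace ≤ t) : L.det ≤ (t / m) ^ m := by
  have hm' : (0 : ℝ) < m := Nat.cast_pos.2 hm
  have h : ((m / t : ℝ) • L).det ≤ 1 := by
    refine det_le_one_of_trace_le (hL.smul (by positivity)) ?_
    rw [Matrix.trace_smul, smul_eq_mul, div_mul_eq_mul_div, div_le_iff₀ ht0]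
    exact mul_le_mul_of_nonneg_left ht hm'.le
  rw [Matrix.det_smul, Fintype.card_fin] at h
  calc L.det = (t / m) ^ m * ((m / t) ^ m * L.det) := by
        rw [← mul_assoc, ← mul_pow, div_mul_div_cancel₀ hm'.ne', div_self ht0.ne', one_pow, one_mul]
    _ ≤ (t / m) ^ m * 1 := mul_le_mul_of_nonneg_left h (by positivity)
    _ = _ := mul_one _

theorem det_one_sub_smul {P : Matrix (Fin m) (Fin m) ℝ} (hP : P.IsHermitian) (c : ℝ) :
    (1 - c • P).det = ∏ i, (1 - c * hP.eigenvalues i) := by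
  have h1 := hP.spectral_theorem
  rw [Unitary.conjStarAlgAut_apply] at h1
  set U : Matrix (Fin m) (Fin m) ℝ := (hP.eigenvectorUnitary : Matrix (Fin m) (Fin m) ℝ)
  have hU : U * star U = 1 := Unitary.coe_mul_star_self hP.eigenvectorUnitary
  have h2 : 1 - c • P = U * Matrix.diagonal (fun i => 1 - c * hP.eigenvalues i) * star U := by
    have h3 : Matrix.diagonal (fun i => 1 - c * hP.eigenvalues i) =
        1 - c • Matrix.diagonal (RCLike.ofReal ∘ hP.eigenvalues) := by
      ext i j
      by_cases hij : i = j <;> simp [hij]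
    rw [h3, Matrix.mul_sub, Matrix.sub_mul, Matrix.mul_smul, Matrix.smul_mul, Matrix.mul_one, hU,
      ← h1]
  rw [h2, Matrix.det_mul_right_comm, hU, one_mul, Matrix.det_diagonal]

/-- Weighted inequality of arithmetic and geometric means for the determinant of the contraction
`I - (1 - θ) P`. -/
theorem rpow_trace_le_det {P : Matrix (Fin m) (Fin m) ℝ} (hP : P.PosSemidef)
    (hP1 : (1 - P).PosSemidef) {θ : ℝ} (hθ : 0 < θ) :
    θ ^ P.trace ≤ (1 - (1 - θ) • P).det := by
  have h2 := hP.isHermitian.trace_eq_sum_eigenvalues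
  simp only [RCLike.ofReal_real_eq_id, id_eq] at h2
  rw [det_one_sub_smul hP.isHermitian, h2, Real.rpow_sum_of_pos hθ]
  refine Finset.prod_le_prod (fun i _ => (Real.rpow_pos_of_pos hθ _).le) fun i _ => ?_
  have h0 := hP.eigenvalues_nonneg i
  have h1 : hP.isHermitian.eigenvalues i ≤ 1 := by
    set v := (hP.isHermitian.eigenvectorBasis i)
    have hv := hP.isHermitian.mulVec_eigenvectorBasis i
    have hvv : v.ofLp ⬝ᵥ v.ofLp = 1 := by
      rw [dotProduct_self_eq_norm_sq]
      simp [v]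
    have := hP1.quad_nonneg v.ofLp
    rw [Matrix.sub_mulVec, Matrix.one_mulVec, hv, dotProduct_sub, hvv, dotProduct_smul, hvv] at this
    simpa using this
  -- The means of `θ` and `1` with weights `λ` and `1 - λ`: `θ ^ λ ≤ 1 - (1 - θ) λ`.
  have := Real.geom_mean_le_arith_mean2_weighted h0 (sub_nonneg.2 h1) hθ.le zero_le_one (by ring)
  rw [Real.one_rpow, mul_one] at this
  linarith

end Det

/-! ## Designs for lifted points -/

section Lift

variable {n d : ℕ} (a : Fin n → Fin d → ℝ) (S : Finset (Fin n))

/-- The lifted points `(a_i, 1)`. -/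
def lifted (i : Fin n) : Fin (d + 1) → ℝ := Prog.liftPoint (1 : ℝ) (a i)

/-- The mean of the points with respect to the weights `w` of total `W`. -/
noncomputable def weightedMean (w : Fin n → ℝ) (W : ℝ) : Fin d → ℝ :=
  fun j => (∑ i ∈ S, w i * a i j) / W

@[simp] theorem lifted_castSucc (i : Fin n) (j : Fin d) : lifted a i j.castSucc = a i j := by
  simp [lifted, Prog.liftPoint]

@[simp] theorem lifted_last (i : Fin n) : lifted a i (Fin.last d) = 1 := by
  simp [lifted, Prog.liftPoint]

variable {S}

theorem sum_weight_mul_sub_weightedMean {w : Fin n → ℝ} {W : ℝ} (hW : ∑ i ∈ S, w i = W)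
    (hW0 : W ≠ 0) (j : Fin d) : ∑ i ∈ S, w i * (a i j - weightedMean a S w W j) = 0 := by
  simp only [mul_sub, Finset.sum_sub_distrib, ← Finset.sum_mul, hW, weightedMean]
  field_simp
  ring

/-- After rotating the constant coordinate to the front, the pivot is `W` and its Schur complement
is the scatter matrix about the mean. -/
theorem det_designMatrix_lifted {w : Fin n → ℝ} {W : ℝ} (hW : ∑ i ∈ S, w i = W) (hW0 : W ≠ 0) :
    (designMatrix (lifted a) S w).det =
      W * (designMatrix (fun i => a i - weightedMean a S w W) S w).det := by
  set A := (designMatrix (lifted a) S w).submatrix (finRotate (d + 1)).symm (finRotate (d + 1)).symm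
    with hA
  have h0 : (finRotate (d + 1)).symm 0 = Fin.last d := by
    rw [Equiv.symm_apply_eq, finRotate_last]
  have hs : ∀ i : Fin d, (finRotate (d + 1)).symm i.succ = i.castSucc := fun i => by
    rw [Equiv.symm_apply_eq]
    ext
    simp
  have h00 : A 0 0 = W := by simp [hA, h0, designMatrix_apply, hW]
  rw [← Matrix.det_submatrix_equiv_self (finRotate (d + 1)).symm, ← hA,
    det_eq_mul_det_schurMatrix (h00.trans_ne hW0), h00]
  congr 2
  ext j k
  simp only [schurMatrix, Matrix.of_apply, h00]
  simp only [hA, Matrix.submatrix_apply, h0, hs, designMatrix_apply, lifted_castSucc, lifted_last,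
    mul_one, one_mul, Pi.sub_apply]
  have h1 := sum_weight_mul_sub_weightedMean a hW hW0 k
  have h2 : ∑ i ∈ S, w i * ((a i j - weightedMean a S w W j) * (a i k - weightedMean a S w W k)) =
      ∑ i ∈ S, w i * (a i j * a i k) - weightedMean a S w W k * ∑ i ∈ S, w i * a i j
        - weightedMean a S w W j * ∑ i ∈ S, w i * (a i k - weightedMean a S w W k) := by
    rw [Finset.mul_sum, Finset.mul_sum, ← Finset.sum_sub_distrib, ← Finset.sum_sub_distrib]
    exact Finset.sum_congr rfl fun i _ => by ring
  rw [h2, h1, weightedMean]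
  ring

/-- The parallel axis identity: replacing the mean by `c` adds `W ‖δ‖²`, as the cross term vanishes.
-/
theorem weightedMean_minimizes (A : Matrix (Fin d) (Fin d) ℝ) {w : Fin n → ℝ} {W : ℝ}
    (hW : ∑ i ∈ S, w i = W) (hW0 : 0 < W) (c : Fin d → ℝ) :
    ∑ i ∈ S, w i * ((A *ᵥ (a i - weightedMean a S w W)) ⬝ᵥ (A *ᵥ (a i - weightedMean a S w W))) ≤
      ∑ i ∈ S, w i * ((A *ᵥ (a i - c)) ⬝ᵥ (A *ᵥ (a i - c))) := by
  set c' := weightedMean a S w W with hc'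
  set δ := A *ᵥ (c' - c)
  have h1 : ∀ i, A *ᵥ (a i - c) = A *ᵥ (a i - c') + δ := fun i => by
    rw [← Matrix.mulVec_add]
    congr 1
    abel
  have h2 : ∑ i ∈ S, w i • (a i - c') = 0 := by
    ext j
    simpa using sum_weight_mul_sub_weightedMean a hW hW0.ne' j
  have h3 : ∑ i ∈ S, w i * ((A *ᵥ (a i - c')) ⬝ᵥ δ) = 0 := by
    have : ∑ i ∈ S, w i * ((A *ᵥ (a i - c')) ⬝ᵥ δ) = (A *ᵥ ∑ i ∈ S, w i • (a i - c')) ⬝ᵥ δ := by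
      simp only [Matrix.mulVec_sum, sum_dotProduct, Matrix.mulVec_smul, smul_dotProduct, smul_eq_mul]
    rw [this, h2]
    simp
  have h4 : 0 ≤ δ ⬝ᵥ δ := by simpa using dotProduct_star_self_nonneg δ
  have h5 : ∑ i ∈ S, w i * ((A *ᵥ (a i - c)) ⬝ᵥ (A *ᵥ (a i - c))) =
      ∑ i ∈ S, w i * ((A *ᵥ (a i - c')) ⬝ᵥ (A *ᵥ (a i - c')))
        + 2 * ∑ i ∈ S, w i * ((A *ᵥ (a i - c')) ⬝ᵥ δ) + W * (δ ⬝ᵥ δ) := by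
    rw [← hW, Finset.sum_mul, Finset.mul_sum, ← Finset.sum_add_distrib, ← Finset.sum_add_distrib]
    refine Finset.sum_congr rfl fun i _ => ?_
    rw [h1, add_dotProduct, dotProduct_add, dotProduct_add, dotProduct_comm δ]
    ring
  rw [h5, h3]
  have := mul_nonneg hW0.le h4
  linarith

/-- Whiten by `A` with `M⁻¹ = Aᵀ A`. The trace of the whitened scatter about `c` is at most `t`, and
about the mean it is no larger; then apply the determinant–trace inequality and undo the whitening.
-/
theorem det_scatter_le (hd : 1 ≤ d) {M : Matrix (Fin d) (Fin d) ℝ} (hM : M.PosDef)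
    (c : Fin d → ℝ) {w : Fin n → ℝ} (hw : ∀ i ∈ S, 0 ≤ w i) {W t : ℝ} (hW : ∑ i ∈ S, w i = W)
    (hW0 : 0 < W) (ht0 : 0 < t)
    (ht : ∑ i ∈ S, w i * ((a i - c) ⬝ᵥ (M⁻¹ *ᵥ (a i - c))) ≤ t) :
    (designMatrix (fun i => a i - weightedMean a S w W) S w).det ≤ M.det * (t / d) ^ d := by
  obtain ⟨A, hA⟩ := hM.inv.posSemidef.exists_transpose_mul_self
  have hdetM := hM.det_pos
  have hdetA : M.det * (A.det * A.det) = 1 := by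
    have : M.det * (M⁻¹).det = 1 := by
      rw [Matrix.det_nonsing_inv, Ring.mul_inverse_cancel _ hdetM.ne'.isUnit]
    rwa [hA, Matrix.det_mul, Matrix.det_transpose] at this
  have hle : (designMatrix (fun i => A *ᵥ (a i - weightedMean a S w W)) S w).det ≤ (t / d) ^ d := by
    refine det_le_pow_of_trace_le hd (posSemidef_designMatrix _ S hw) ht0 ?_
    rw [trace_designMatrix]
    refine (weightedMean_minimizes a A hW hW0 c).trans (ht.trans' ?_)
    simp only [hA, dotProduct_transpose_mul_self_mulVec, le_refl]
  rw [← mul_designMatrix_mul_transpose, Matrix.det_mul, Matrix.det_mul, Matrix.det_transpose] at hle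
  calc _ = M.det * (A.det * (designMatrix (fun i => a i - weightedMean a S w W) S w).det * A.det) := by
        linear_combination (-(designMatrix (fun i => a i - weightedMean a S w W) S w).det) * hdetA
    _ ≤ _ := mul_le_mul_of_nonneg_left hle hdetM.le

/-- The effect of scaling down by `θ` the weights of the points in `B` in an optimal design. -/
theorem IsDualOptimal.det_mul_rpow_le {m : ℕ} {x : Fin n → Fin m → ℝ} {w : Fin n → ℝ}
    (hw : IsDualOptimal x S w) (hdet : 0 < (designMatrix x S w).det) (B : Finset (Fin n)) {θ : ℝ}
    (hθ : 0 < θ) :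
    (designMatrix x S w).det * θ ^ (∑ i ∈ S ∩ B, w i) ≤
      (designMatrix x S fun i => if i ∈ B then θ * w i else w i).det := by
  set H := designMatrix x S w with hH
  set w₁ : Fin n → ℝ := fun i => if i ∈ B then w i else 0 with hw₁
  set H₁ := designMatrix x S w₁ with hH₁
  have hK : (designMatrix x S fun i => if i ∈ B then θ * w i else w i) = H - (1 - θ) • H₁ := by
    simp only [hH, hH₁, designMatrix, Finset.smul_sum, ← Finset.sum_sub_distrib, smul_smul,
      ← sub_smul, hw₁]
    refine Finset.sum_congr rfl fun i _ => ?_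
    congr 1
    split_ifs <;> ring
  have hHH₁ : H - H₁ = designMatrix x S fun i => if i ∈ B then 0 else w i := by
    simp only [hH, hH₁, designMatrix, ← Finset.sum_sub_distrib, ← sub_smul, hw₁]
    refine Finset.sum_congr rfl fun i _ => ?_
    congr 1
    split_ifs <;> ring
  obtain ⟨F, hF⟩ := (posSemidef_designMatrix x S hw.1.1).exists_transpose_mul_self
  rw [← hH] at hF
  have hFdet : H.det = F.det * F.det := by rw [hF, Matrix.det_mul, Matrix.det_transpose]
  have hFu : IsUnit F.det := by
    rw [isUnit_iff_ne_zero]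
    rintro h
    rw [hFdet, h] at hdet
    simp at hdet
  have hFR : F * F⁻¹ = 1 := Matrix.mul_nonsing_inv _ hFu
  have hRF : F⁻¹ * F = 1 := Matrix.nonsing_inv_mul _ hFu
  have hRF' : Fᵀ * (F⁻¹)ᵀ = 1 := by rw [← Matrix.transpose_mul, hRF, Matrix.transpose_one]
  have hFR' : (F⁻¹)ᵀ * Fᵀ = 1 := by rw [← Matrix.transpose_mul, hFR, Matrix.transpose_one]
  have hinv : H⁻¹ = F⁻¹ * (F⁻¹)ᵀ := by
    rw [hF, Matrix.mul_inv_rev, Matrix.transpose_nonsing_inv]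
  set P := (F⁻¹)ᵀ * H₁ * F⁻¹ with hP
  have hone : (F⁻¹)ᵀ * H * F⁻¹ = 1 := by
    rw [hF, ← Matrix.mul_assoc, hFR', one_mul, hFR]
  have hP0 : P.PosSemidef := by
    have := (posSemidef_designMatrix x S (w := w₁) fun i hi => by
      simp only [hw₁]
      split_ifs
      exacts [hw.1.1 i hi, le_rfl]).conjTranspose_mul_mul_same F⁻¹
    simpa only [Matrix.conjTranspose_eq_transpose_of_trivial] using this
  have hP1 : (1 - P).PosSemidef := by
    have h1 : 1 - P = (F⁻¹)ᵀ * (H - H₁) * F⁻¹ := by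
      rw [Matrix.mul_sub, Matrix.sub_mul, hone]
    rw [h1, hHH₁]
    have := (posSemidef_designMatrix x S (w := fun i => if i ∈ B then 0 else w i) fun i hi => by
      split_ifs
      exacts [le_rfl, hw.1.1 i hi]).conjTranspose_mul_mul_same F⁻¹
    simpa only [Matrix.conjTranspose_eq_transpose_of_trivial] using this
  have htr : P.trace = ∑ i ∈ S ∩ B, w i := by
    rw [hP, Matrix.trace_mul_comm, ← Matrix.mul_assoc, ← hinv, hH₁, trace_inv_mul_designMatrix,
      ← Finset.sum_ite_mem]
    refine Finset.sum_congr rfl fun i hi => ?_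
    simp only [hw₁]
    split_ifs
    exacts [hw.mul_quad_eq hdet hi, zero_mul _]
  have hKP : H - (1 - θ) • H₁ = Fᵀ * (1 - (1 - θ) • P) * F := by
    have h1 : Fᵀ * P * F = H₁ := by
      rw [hP, Matrix.mul_assoc, Matrix.mul_assoc, Matrix.mul_assoc, hRF, Matrix.mul_one,
        ← Matrix.mul_assoc, hRF', Matrix.one_mul]
    rw [Matrix.mul_sub, Matrix.sub_mul, Matrix.mul_one, Matrix.mul_smul, Matrix.smul_mul, h1, hF]
  rw [hK, hKP, Matrix.det_mul, Matrix.det_mul, Matrix.det_transpose, mul_right_comm, ← hFdet, ← htr]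
  exact mul_le_mul_of_nonneg_left (rpow_trace_le_det hP0 hP1 hθ) hdet.le

/-- An optimal design of the lifted points, in which points in the ellipsoid `(c, M)` blown up by
`3 β` are present that lie outside of that ellipsoid, but with a small weight. -/
theorem IsDualOptimal.det_lifted_le (hd : 1 ≤ d) {M : Matrix (Fin d) (Fin d) ℝ} (hM : M.PosDef)
    (c : Fin d → ℝ) {w : Fin n → ℝ} (hw : IsDualOptimal (lifted a) S w) {β : ℝ} (hβ : 1 ≤ β)
    (B : Finset (Fin n))
    (hbad : ∀ i ∈ S, (a i - c) ⬝ᵥ (M⁻¹ *ᵥ (a i - c)) ≤ 9 * β ^ 2)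
    (hgood : ∀ i ∈ S, i ∉ B → (a i - c) ⬝ᵥ (M⁻¹ *ᵥ (a i - c)) ≤ 1)
    {κ : ℝ} (hκ : ∑ i ∈ S ∩ B, w i ≤ κ) :
    (designMatrix (lifted a) S w).det ≤
      (4 * β) ^ (2 * κ) * M.det * ((d + 1) * ((d + 1) / d) ^ d) := by
  have hdetM := hM.det_pos
  have hd' : (0 : ℝ) < d := Nat.cast_pos.2 hd
  rcases le_or_gt (designMatrix (lifted a) S w).det 0 with h0 | hdet
  · exact h0.trans (by positivity)
  have hsum := hw.sum_eq hdet
  push_cast at hsum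
  -- With this scaling a point of `B`, at squared distance at most `9β²`, contributes no more to the
  -- trace than its original weight.
  set θ : ℝ := (9 * β ^ 2)⁻¹ with hθ
  have hθ0 : 0 < θ := by positivity
  have hθ1 : θ ≤ 1 := inv_le_one_of_one_le₀ (by nlinarith)
  set v : Fin n → ℝ := fun i => if i ∈ B then θ * w i else w i with hv
  have hv0 : ∀ i ∈ S, 0 ≤ v i := fun i hi => by
    have := hw.1.1 i hi
    simp only [hv]
    split_ifs <;> positivity
  have hvw : ∀ i ∈ S, v i ≤ w i := fun i hi => by
    have := hw.1.1 i hi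
    simp only [hv]
    split_ifs
    exacts [mul_le_of_le_one_left this hθ1, le_rfl]
  have hwv : ∀ i ∈ S, θ * w i ≤ v i := fun i hi => by
    have := hw.1.1 i hi
    simp only [hv]
    split_ifs
    exacts [le_rfl, mul_le_of_le_one_left this hθ1]
  have hW : ∑ i ∈ S, v i ≤ d + 1 := (Finset.sum_le_sum hvw).trans_eq hsum
  have hW0 : 0 < ∑ i ∈ S, v i := by
    refine lt_of_lt_of_le ?_ (Finset.sum_le_sum hwv)
    rw [← Finset.mul_sum, hsum]
    positivity
  have htr : ∑ i ∈ S, v i * ((a i - c) ⬝ᵥ (M⁻¹ *ᵥ (a i - c))) ≤ d + 1 := by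
    rw [← hsum]
    refine Finset.sum_le_sum fun i hi => ?_
    have h1 := hw.1.1 i hi
    by_cases hiB : i ∈ B
    · have h2 : θ * ((a i - c) ⬝ᵥ (M⁻¹ *ᵥ (a i - c))) ≤ 1 := by
        rw [hθ, inv_mul_le_iff₀ (by positivity), mul_one]
        exact hbad i hi
      simp only [hv, hiB, if_true]
      nlinarith
    · simp only [hv, hiB, if_false]
      exact mul_le_of_le_one_right h1 (hgood i hi hiB)
  have hK := hw.det_mul_rpow_le hdet B hθ0
  rw [← hv, det_designMatrix_lifted a rfl hW0.ne'] at hK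
  have hC := det_scatter_le a hd hM c hv0 rfl hW0 (by positivity) htr
  have hb0 : 0 ≤ ∑ i ∈ S ∩ B, w i :=
    Finset.sum_nonneg fun i hi => hw.1.1 i (Finset.mem_inter.1 hi).1
  -- Here `9β²` is rounded up to `(4β)²`, which is where the base `4β` comes from.
  have hθκ : (4 * β) ^ (-(2 * κ)) ≤ θ ^ (∑ i ∈ S ∩ B, w i) := by
    calc (4 * β) ^ (-(2 * κ)) ≤ (4 * β) ^ (-(2 * ∑ i ∈ S ∩ B, w i)) :=
          Real.rpow_le_rpow_of_exponent_le (by linarith) (by linarith)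
      _ = (((4 * β) ^ (2 : ℝ))⁻¹) ^ (∑ i ∈ S ∩ B, w i) := by
          rw [Real.rpow_neg (by positivity), Real.rpow_mul (by positivity),
            Real.inv_rpow (by positivity)]
      _ ≤ _ := by
          refine Real.rpow_le_rpow (by positivity) ?_ hb0
          rw [hθ, Real.rpow_two]
          exact inv_anti₀ (by positivity) (by nlinarith)
  have h1 : (designMatrix (lifted a) S w).det * (4 * β) ^ (-(2 * κ)) ≤
      (d + 1) * (M.det * ((d + 1) / d) ^ d) :=
    (mul_le_mul_of_nonneg_left hθκ hdet.le).trans (hK.trans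
      (mul_le_mul hW hC (posSemidef_designMatrix _ S hv0).det_nonneg (by positivity)))
  rw [Real.rpow_neg (by positivity), mul_inv_le_iff₀ (by positivity)] at h1
  linarith

/-- The minimum volume ellipsoid that is given by an optimal design encloses the points. -/
theorem IsDualOptimal.posSemidef_enclosing (hd : 1 ≤ d) {w : Fin n → ℝ}
    (hw : IsDualOptimal (lifted a) S w) (hdet : 0 < (designMatrix (lifted a) S w).det)
    {i : Fin n} (hi : i ∈ S) :
    (((d : ℝ) / (d + 1)) • designMatrix (fun i => a i - weightedMean a S w (d + 1)) S w -
      Matrix.vecMulVec (a i - weightedMean a S w (d + 1))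
        (a i - weightedMean a S w (d + 1))).PosSemidef := by
  have hd' : (0 : ℝ) < d := Nat.cast_pos.2 hd
  have hsum := hw.sum_eq hdet
  push_cast at hsum
  set c := weightedMean a S w (d + 1) with hc
  refine (posSemidef_iff_real _).2 ⟨?_, fun z => ?_⟩
  · refine Matrix.IsHermitian.sub ?_ (Matrix.posSemidef_vecMulVec_self_star _).isHermitian
    ext j k
    simp [designMatrix_apply, mul_comm]
  rw [Matrix.sub_mulVec, dotProduct_sub, dotProduct_vecMulVec_mulVec, Matrix.smul_mulVec,
    dotProduct_smul, quad_designMatrix, smul_eq_mul]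
  -- The lifted direction `(z, r - c ⬝ᵥ z)` has product `(a j - c) ⬝ᵥ z + r` with the `j`-th lifted
  -- point. This `r` makes the resulting inequality sharpest and produces the factor `d / (d + 1)`.
  set r := ((a i - c) ⬝ᵥ z) / d with hr
  have hri : (a i - c) ⬝ᵥ z = d * r := (mul_div_cancel₀ _ hd'.ne').symm
  have h1 := hw.sq_dotProduct_le hdet hi (Fin.snoc (α := fun _ => ℝ) z (r - c ⬝ᵥ z))
  have h2 : ∀ j, lifted a j ⬝ᵥ (Fin.snoc (α := fun _ => ℝ) z (r - c ⬝ᵥ z)) =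
      (a j - c) ⬝ᵥ z + r := fun j => by
    rw [sub_dotProduct, dotProduct, Fin.sum_univ_castSucc]
    simp only [lifted_castSucc, lifted_last, Fin.snoc_castSucc, Fin.snoc_last, dotProduct]
    ring
  have h3 : ∑ j ∈ S, w j * ((a j - c) ⬝ᵥ z) = 0 := by
    have h4 : ∑ j ∈ S, w j • (a j - c) = 0 := by
      ext j
      simpa using sum_weight_mul_sub_weightedMean a hsum (by positivity) j
    have : ∑ j ∈ S, w j * ((a j - c) ⬝ᵥ z) = (∑ j ∈ S, w j • (a j - c)) ⬝ᵥ z := by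
      simp only [sum_dotProduct, smul_dotProduct, smul_eq_mul]
    rw [this, h4, zero_dotProduct]
  simp only [h2] at h1
  have h5 : ∑ j ∈ S, w j * ((a j - c) ⬝ᵥ z + r) ^ 2 =
      ∑ j ∈ S, w j * ((a j - c) ⬝ᵥ z) ^ 2 + 2 * r * ∑ j ∈ S, w j * ((a j - c) ⬝ᵥ z)
        + (d + 1) * r ^ 2 := by
    rw [← hsum, Finset.sum_mul, Finset.mul_sum, ← Finset.sum_add_distrib, ← Finset.sum_add_distrib]
    exact Finset.sum_congr rfl fun j _ => by ring
  rw [h5, h3, hri] at h1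
  rw [hri, div_mul_eq_mul_div, sub_nonneg, le_div_iff₀ (by positivity)]
  nlinarith

end Lift

namespace EllipsoidData

variable {d : ℕ}

/-- The ellipsoid with centre `c` and shape matrix `M`. -/
def ofMatrix (c : Fin d → ℝ) (M : Matrix (Fin d) (Fin d) ℝ) : EllipsoidData ℝ d :=
  ⟨c, fun j k => M j k⟩

@[simp] theorem center_ofMatrix (c : Fin d → ℝ) (M : Matrix (Fin d) (Fin d) ℝ) :
    (ofMatrix c M).center = c := rfl

@[simp] theorem shapeMatrix_ofMatrix (c : Fin d → ℝ) (M : Matrix (Fin d) (Fin d) ℝ) :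
    (ofMatrix c M).shapeMatrix = M := rfl

end EllipsoidData

open EllipsoidData


namespace Prog

/-! ## Values of the deterministic parts of the algorithm -/

section Deterministic

variable (sol : DualSolver) {n d : ℕ} (a : Fin n → Fin d → ℝ) (S : Finset (Fin n))

theorem eval_weightedEllipsoid (w : Fin n → ℝ) (W s : ℝ) :
    eval sol (weightedEllipsoid a S w W s) =
      ofMatrix (weightedMean a S w W)
        (s • designMatrix (fun i => a i - weightedMean a S w W) S w) := by
  simp only [weightedEllipsoid, ofMatrix, eval_bind, eval_tabulate, eval_sumOn, eval_mul, eval_div, eval_sub,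
    eval_pure]
  congr
  funext j k
  simp [designMatrix_apply, weightedMean]

theorem coinFree_weightedEllipsoid (w : Fin n → ℝ) (W s : ℝ) :
    CoinFree (weightedEllipsoid a S w W s) :=
  coinFree_bind (coinFree_tabulate _ fun _ => coinFree_bind
    (coinFree_sumOn _ fun _ => coinFree_mul _ _) fun _ => coinFree_div _ _) fun _ =>
  coinFree_bind (coinFree_tabulate _ fun _ => coinFree_tabulate _ fun _ => coinFree_bind
    (coinFree_sumOn _ fun _ => coinFree_bind (coinFree_sub _ _) fun _ =>
      coinFree_bind (coinFree_sub _ _) fun _ => coinFree_bind (coinFree_mul _ _) fun _ =>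
        coinFree_mul _ _) fun _ => coinFree_mul _ _) fun _ => trivial

theorem coinFree_pointEllipsoid (d : ℕ) : CoinFree (pointEllipsoid d : Prog ℝ _) :=
  coinFree_bind (coinFree_const 0) fun _ => trivial

theorem eval_pointEllipsoid (d : ℕ) :
    eval sol (pointEllipsoid d : Prog ℝ _) = ofMatrix 0 0 := by
  simp [pointEllipsoid, ofMatrix]
  rfl

theorem coinFree_enclosingEllipsoid : CoinFree (enclosingEllipsoid a S) :=
  coinFree_bind (coinFree_const 1) fun _ => coinFree_bind (coinFree_solveDual _ _) fun _ =>
  coinFree_bind (coinFree_tabulate _ fun _ => coinFree_tabulate _ fun _ => coinFree_sumOn _ fun _ =>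
    coinFree_bind (coinFree_mul _ _) fun _ => coinFree_mul _ _) fun _ =>
  coinFree_bind (coinFree_psdDet _ _) fun _ => coinFree_bind (coinFree_const 0) fun _ =>
  coinFree_bind (coinFree_leq _ _) fun _ => coinFree_ite
    (coinFree_bind (coinFree_sumOn _ fun _ => coinFree_const 1) fun _ =>
      coinFree_bind (coinFree_leq _ _) fun _ => coinFree_ite (coinFree_weightedEllipsoid _ _ _ _ _)
        (coinFree_pointEllipsoid d))
    (coinFree_bind (coinFree_const d) fun _ => coinFree_bind (coinFree_const (d + 1)) fun _ =>
      coinFree_bind (coinFree_div _ _) fun _ => coinFree_weightedEllipsoid _ _ _ _ _)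

/-- The case distinction made by `enclosingEllipsoid`. -/
theorem eval_enclosingEllipsoid (hsol : sol.IsExact) :
    eval sol (enclosingEllipsoid a S) =
      if (designMatrix (lifted a) S (sol n (d + 1) (lifted a) S)).det ≤ 0 then
        if S.Nonempty then
          ofMatrix (weightedMean a S (fun _ => 1) S.card)
            (designMatrix (fun i => a i - weightedMean a S (fun _ => 1) S.card) S fun _ => 1)
        else ofMatrix 0 0
      else
        ofMatrix (weightedMean a S (sol n (d + 1) (lifted a) S) (d + 1))
          (((d : ℝ) / (d + 1)) • designMatrix
            (fun i => a i - weightedMean a S (sol n (d + 1) (lifted a) S) (d + 1)) S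
            (sol n (d + 1) (lifted a) S)) := by
  have hlift : ∀ i, liftPoint (1 : ℝ) (a i) = lifted a i := fun _ => rfl
  simp only [enclosingEllipsoid, eval_bind, eval_const, eval_solveDual, hlift, eval_tabulate,
    eval_sumOn, eval_mul, eval_leq, Nat.cast_zero, Nat.cast_one, decide_eq_true_eq]
  have hH : (Matrix.of fun j k => ∑ i ∈ S, sol n (d + 1) (lifted a) S i *
      (lifted a i j * lifted a i k)) =
      designMatrix (lifted a) S (sol n (d + 1) (lifted a) S) := by
    ext j k
    rw [designMatrix_apply, Matrix.of_apply]
  rw [eval_psdDet, hH]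
  · by_cases h1 : (designMatrix (lifted a) S (sol n (d + 1) (lifted a) S)).det ≤ 0
    · rw [if_pos h1, if_pos h1]
      simp only [eval_bind, eval_sumOn, eval_const, eval_leq, Nat.cast_one, decide_eq_true_eq,
        Finset.sum_const, nsmul_eq_mul, mul_one, Nat.one_le_cast, Finset.one_le_card]
      by_cases h2 : S.Nonempty
      · rw [if_pos h2, if_pos h2, eval_weightedEllipsoid, one_smul]
      · rw [if_neg h2, if_neg h2, eval_pointEllipsoid]
    · rw [if_neg h1, if_neg h1]
      simp only [eval_bind, eval_const, eval_div, eval_weightedEllipsoid]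
      push_cast
      rfl
  · rw [hH]
    exact posSemidef_designMatrix _ _ (hsol _ _ _ _).1.1

theorem posSemidef_enclosingEllipsoid (hsol : sol.IsExact) :
    (eval sol (enclosingEllipsoid a S)).shapeMatrix.PosSemidef := by
  rw [eval_enclosingEllipsoid sol a S hsol]
  split_ifs <;> rw [shapeMatrix_ofMatrix]
  · exact posSemidef_designMatrix _ _ fun _ _ => zero_le_one
  · exact Matrix.PosSemidef.zero
  · exact (posSemidef_designMatrix _ _ (hsol _ _ _ _).1.1).smul (by positivity)

theorem enclosingEllipsoid_encloses (hd : 1 ≤ d) (hsol : sol.IsExact) {i : Fin n} (hi : i ∈ S) :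
    ((eval sol (enclosingEllipsoid a S)).shapeMatrix -
      Matrix.vecMulVec (a i - (eval sol (enclosingEllipsoid a S)).center)
        (a i - (eval sol (enclosingEllipsoid a S)).center)).PosSemidef := by
  rw [eval_enclosingEllipsoid sol a S hsol, if_pos (show S.Nonempty from ⟨i, hi⟩)]
  split_ifs with h
  -- In the flat case, removing the rank-one term of `i` leaves the scatter of the other points
  -- about the same centre.
  · have h1 : designMatrix (fun i => a i - weightedMean a S (fun _ => 1) S.card) S (fun _ => 1) -
        Matrix.vecMulVec (a i - weightedMean a S (fun _ => 1) S.card)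
          (a i - weightedMean a S (fun _ => 1) S.card) =
        designMatrix (fun i => a i - weightedMean a S (fun _ => 1) S.card) (S.erase i)
          (fun _ => 1) := by
      rw [sub_eq_iff_eq_add, designMatrix, designMatrix, ← Finset.sum_erase_add _ _ hi]
      simp only [one_smul]
    rw [shapeMatrix_ofMatrix, center_ofMatrix, h1]
    exact posSemidef_designMatrix _ _ fun _ _ => zero_le_one
  · exact (hsol _ _ _ _).posSemidef_enclosing a hd (not_le.1 h) hi

/-- The shape matrix is `d / (d + 1)` times the scatter matrix, and the lifted determinant is `d +
1` times that of the scatter matrix. Together these account for the factor in the hypothesis. -/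
theorem det_enclosingEllipsoid_le (hd : 1 ≤ d) (hsol : sol.IsExact) {R : ℝ} (hR : 0 ≤ R)
    (h : ∀ w : Fin n → ℝ, IsDualFeasible (m := d + 1) S w →
      (designMatrix (lifted a) S w).det ≤ R * ((d + 1) * ((d + 1) / d) ^ d)) :
    (eval sol (enclosingEllipsoid a S)).shapeMatrix.det ≤ R := by
  have hd' : (0 : ℝ) < d := Nat.cast_pos.2 hd
  rw [eval_enclosingEllipsoid sol a S hsol]
  split_ifs with h1 h2
  · refine le_trans ?_ hR
    have hN : (0 : ℝ) < S.card := Nat.cast_pos.2 h2.card_pos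
    change (designMatrix (fun i => a i - weightedMean a S (fun _ => 1) S.card) S
      fun _ => 1).det ≤ 0
    have h3 := det_designMatrix_lifted a (S := S) (w := fun _ => 1) (W := S.card) (by simp) hN.ne'
    -- If the optimum is degenerate, so is the uniform design, and the unweighted scatter matrix is
    -- singular.
    have h4 := ((hsol _ _ _ _).2 (fun _ => ((d + 1 : ℕ) : ℝ) / S.card)
      ⟨fun _ _ => by positivity, by
        rw [Finset.sum_const, nsmul_eq_mul, mul_div_cancel₀ _ hN.ne']⟩).trans h1
    have h5 : designMatrix (lifted a) S (fun _ => ((d + 1 : ℕ) : ℝ) / S.card) =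
        (((d + 1 : ℕ) : ℝ) / S.card) • designMatrix (lifted a) S fun _ => 1 := by
      simp [designMatrix, Finset.smul_sum]
    rw [h5, Matrix.det_smul, h3] at h4
    by_contra! h6
    have : 0 < (((d + 1 : ℕ) : ℝ) / S.card) ^ Fintype.card (Fin (d + 1)) * (S.card *
        (designMatrix (fun i => a i - weightedMean a S (fun _ => 1) S.card) S fun _ => 1).det) := by
      positivity
    linarith
  · have : Nonempty (Fin d) := ⟨⟨0, hd⟩⟩
    rwa [shapeMatrix_ofMatrix, Matrix.det_zero]
  · have hopt := hsol n (d + 1) (lifted a) S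
    have hsum := hopt.sum_eq (not_le.1 h1)
    push_cast at hsum
    have h3 := det_designMatrix_lifted a hsum (by positivity)
    have h4 := h _ hopt.1
    rw [h3] at h4
    set C := designMatrix
      (fun i => a i - weightedMean a S (sol n (d + 1) (lifted a) S) (d + 1)) S
      (sol n (d + 1) (lifted a) S)
    change (((d : ℝ) / (d + 1)) • C).det ≤ R
    rw [Matrix.det_smul, Fintype.card_fin]
    have h5 : C.det ≤ R * ((d + 1) / d) ^ d := by
      refine le_of_mul_le_mul_left (h4.trans_eq ?_) (by positivity : (0 : ℝ) < d + 1)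
      ring
    calc ((d : ℝ) / (d + 1)) ^ d * C.det ≤ ((d : ℝ) / (d + 1)) ^ d * (R * ((d + 1) / d) ^ d) :=
          mul_le_mul_of_nonneg_left h5 (by positivity)
      _ = R * ((d : ℝ) / (d + 1) * ((d + 1) / d)) ^ d := by rw [mul_pow]; ring
      _ = R := by
        rw [div_mul_div_cancel₀ (by positivity), div_self hd'.ne', one_pow, mul_one]

theorem coinFree_isInside (x : Fin d → ℝ) (E : EllipsoidData ℝ d) : CoinFree (isInside x E) :=
  coinFree_bind (coinFree_tabulate _ fun _ => coinFree_sub _ _) fun _ =>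
  coinFree_bind (coinFree_tabulate _ fun _ => coinFree_tabulate _ fun _ =>
    coinFree_bind (coinFree_mul _ _) fun _ => coinFree_sub _ _) fun _ => coinFree_isPSD _ _

theorem eval_isInside (x : Fin d → ℝ) (E : EllipsoidData ℝ d) (hE : E.shapeMatrix.PosSemidef) :
    eval sol (isInside x E) = true ↔
      (E.shapeMatrix - Matrix.vecMulVec (x - E.center) (x - E.center)).PosSemidef := by
  have h : (Matrix.of fun j k => E.shape j k - (x j - E.center j) * (x k - E.center k)) =
      E.shapeMatrix - Matrix.vecMulVec (x - E.center) (x - E.center) := by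
    ext j k
    simp [EllipsoidData.shapeMatrix, Matrix.vecMulVec_apply]
  simp only [isInside, eval_bind, eval_tabulate, eval_sub, eval_mul]
  rw [eval_isPSD, h]
  rw [h]
  refine hE.isHermitian.sub ?_
  ext j k
  simp [Matrix.vecMulVec_apply, mul_comm]

theorem coinFree_coversEnough (c : ℕ) (α γ : ℝ) (E : EllipsoidData ℝ d) :
    CoinFree (coversEnough c a α γ E) :=
  coinFree_bind (coinFree_sumOver _ fun _ => coinFree_bind (coinFree_isInside _ _) fun _ =>
    coinFree_ite (coinFree_const 1) (coinFree_const 0)) fun _ =>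
  coinFree_bind (coinFree_mul _ _) fun _ => coinFree_bind (coinFree_const c) fun _ =>
  coinFree_bind (coinFree_mul _ _) fun _ => coinFree_bind (coinFree_sub _ _) fun _ =>
  coinFree_bind (coinFree_const n) fun _ => coinFree_bind (coinFree_mul _ _) fun _ =>
  coinFree_leq _ _

theorem eval_coversEnough (c : ℕ) {α γ : ℝ} (hγ : 0 < γ) (E : EllipsoidData ℝ d) :
    eval sol (coversEnough c a α γ E) = true ↔
      (1 - c * (α / γ)) * n ≤
        ((Finset.univ.filter fun i => eval sol (isInside (a i) E) = true).card : ℝ) := by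
  have h : ∀ i, eval sol (if eval sol (isInside (a i) E) = true then const 1 else const 0) =
      if eval sol (isInside (a i) E) = true then (1 : ℝ) else 0 := fun i => by
    split_ifs <;> simp
  simp only [coversEnough, eval_bind, eval_sumOver, eval_mul, eval_const, eval_sub, eval_leq, h,
    decide_eq_true_eq]
  rw [Finset.sum_boole, ← mul_le_mul_iff_left₀ hγ (b := (1 - c * (α / γ)) * n)]
  have : (1 - c * (α / γ)) * n * γ = (γ - c * α) * n := by
    field_simp
  rw [this]

theorem coinFree_pointsInBall (k₁ k₂ : Fin n) : CoinFree (pointsInBall a k₁ k₂) :=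
  coinFree_bind (coinFree_sqDist _ _) fun _ => coinFree_forEach _ _ fun _ _ =>
    coinFree_bind (coinFree_sqDist _ _) fun _ => coinFree_bind (coinFree_leq _ _) fun _ =>
      coinFree_ite trivial trivial

theorem mem_eval_pointsInBall (k₁ k₂ i : Fin n) :
    i ∈ eval sol (pointsInBall a k₁ k₂) ↔
      ∑ j, (a i j - a k₁ j) ^ 2 ≤ ∑ j, (a k₁ j - a k₂ j) ^ 2 := by
  simp only [pointsInBall, eval_bind, eval_sqDist]
  have key : ∀ (l : List (Fin n)) (S : Finset (Fin n)),
      i ∈ eval sol (forEach l S fun S i => do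
        let s ← sqDist (a i) (a k₁)
        let inside ← leq s (∑ j, (a k₁ j - a k₂ j) ^ 2)
        if inside then pure (insert i S) else pure S) ↔
      i ∈ S ∨ (i ∈ l ∧ ∑ j, (a i j - a k₁ j) ^ 2 ≤ ∑ j, (a k₁ j - a k₂ j) ^ 2) := by
    intro l
    induction l with
    | nil => intro S; simp [forEach]
    | cons b l ih =>
      intro S
      simp only [forEach, eval_tick, eval_bind, eval_sqDist, eval_leq, decide_eq_true_eq]
      rw [ih]
      split_ifs with h
      · rw [eval_pure, Finset.mem_insert, List.mem_cons]
        constructor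
        · rintro ((rfl | h1) | h1)
          exacts [Or.inr ⟨Or.inl rfl, h⟩, Or.inl h1, Or.inr ⟨Or.inr h1.1, h1.2⟩]
        · rintro (h1 | ⟨h1 | h1, h2⟩)
          exacts [Or.inl (Or.inr h1), Or.inl (Or.inl h1), Or.inr ⟨h1, h2⟩]
      · rw [eval_pure, List.mem_cons]
        constructor
        · rintro (h1 | h1)
          exacts [Or.inl h1, Or.inr ⟨Or.inr h1.1, h1.2⟩]
        · rintro (h1 | ⟨rfl | h1, h2⟩)
          exacts [Or.inl h1, absurd h2 h, Or.inr ⟨h1, h2⟩]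
  rw [key]
  simp

theorem coinFree_keepSmaller (best : Option (EllipsoidData ℝ d)) (E : EllipsoidData ℝ d) :
    CoinFree (keepSmaller best E) := by
  cases best with
  | none => trivial
  | some F =>
    exact coinFree_bind (coinFree_psdDet _ _) fun _ => coinFree_bind (coinFree_psdDet _ _) fun _ =>
      coinFree_bind (coinFree_leq _ _) fun _ => coinFree_ite trivial trivial

theorem eval_keepSmaller_none (E : EllipsoidData ℝ d) :
    eval sol (keepSmaller none E) = some E := rfl

theorem eval_keepSmaller_some {F E : EllipsoidData ℝ d} (hF : F.shapeMatrix.PosSemidef)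
    (hE : E.shapeMatrix.PosSemidef) :
    eval sol (keepSmaller (some F) E) =
      if F.shapeMatrix.det ≤ E.shapeMatrix.det then some F else some E := by
  simp only [keepSmaller, eval_bind, eval_leq, eval_psdDet sol d F.shape hF,
    eval_psdDet sol d E.shape hE, decide_eq_true_eq]
  change eval sol (if F.shapeMatrix.det ≤ E.shapeMatrix.det then _ else _) = _
  split_ifs <;> rfl

end Deterministic

end Prog

namespace Prog

/-! ## Loops -/

section Loops

variable (sol : DualSolver) {σ ι : Type} {body : σ → ι → Prog ℝ σ} {I : σ → Prop}

theorem sat_forEach (h : ∀ s i, I s → Sat sol (body s i) I) (l : List ι) {s : σ} (hs : I s) :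
    Sat sol (forEach l s body) I := by
  induction l generalizing s with
  | nil => exact hs
  | cons i l ih =>
    simp only [forEach, sat_tick, sat_bind]
    exact (h s i hs).mono fun s' hs' => ih hs'

theorem expect_forEach_cons (i : ι) (l : List ι) (s : σ) (f : σ → ℝ) :
    expect sol (forEach (i :: l) s body) f =
      expect sol (body s i) fun s' => expect sol (forEach l s' body) f := by
  simp only [forEach, expect_tick, expect_bind]

theorem expect_forEach_le {f : σ → ℝ} (h : ∀ s i, I s → Sat sol (body s i) I)
    (hf : ∀ s i, I s → expect sol (body s i) f ≤ f s) (l : List ι) {s : σ} (hs : I s) :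
    expect sol (forEach l s body) f ≤ f s := by
  induction l generalizing s with
  | nil => exact le_rfl
  | cons i l ih =>
    rw [expect_forEach_cons]
    exact (expect_le_of_sat sol (h s i hs) fun s' hs' => ih hs').trans (hf s i hs)

/-- One contracting step suffices if no other step increases `f` in expectation. It is used for the
single good pair among all pairs of indices. -/
theorem expect_forEach_le_mul {f : σ → ℝ} {ρ : ℝ} (hρ : 0 ≤ ρ)
    (h : ∀ s i, I s → Sat sol (body s i) I)
    (hf : ∀ s i, I s → expect sol (body s i) f ≤ f s) {l : List ι} {i₀ : ι} (hi₀ : i₀ ∈ l)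
    (hf₀ : ∀ s, I s → expect sol (body s i₀) f ≤ ρ * f s) {s : σ} (hs : I s) :
    expect sol (forEach l s body) f ≤ ρ * f s := by
  induction l generalizing s with
  | nil => simp at hi₀
  | cons i l ih =>
    rw [expect_forEach_cons]
    rcases List.mem_cons.1 hi₀ with rfl | hi
    · exact (expect_le_of_sat sol (h s i₀ hs) fun s' hs' =>
        expect_forEach_le sol h hf l hs').trans (hf₀ s hs)
    · refine (expect_le_of_sat sol (h s i hs) fun s' hs' => ih hi hs').trans ?_
      rw [expect_const_mul]
      exact mul_le_mul_of_nonneg_left (hf s i hs) hρ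

theorem expect_forEach_le_pow {f : σ → ℝ} {ρ : ℝ} (hρ : 0 ≤ ρ)
    (h : ∀ s i, I s → Sat sol (body s i) I)
    (hf : ∀ s i, I s → expect sol (body s i) f ≤ ρ * f s) (l : List ι) {s : σ} (hs : I s) :
    expect sol (forEach l s body) f ≤ ρ ^ l.length * f s := by
  induction l generalizing s with
  | nil => simp [forEach]
  | cons i l ih =>
    rw [expect_forEach_cons]
    refine (expect_le_of_sat sol (h s i hs) fun s' hs' => ih hs').trans ?_
    rw [expect_const_mul, List.length_cons, pow_succ, mul_assoc]
    exact mul_le_mul_of_nonneg_left (hf s i hs) (pow_nonneg hρ _)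

end Loops

/-! ## Removal rounds -/

section Removal

variable (sol : DualSolver) {n d : ℕ} (a : Fin n → Fin d → ℝ)

/-- The weights that are used in a removal round for the active points `S`. -/
noncomputable def roundWeights (S : Finset (Fin n)) : Fin n → ℝ := sol n (d + 1) (lifted a) S

theorem sat_removalRound (S : Finset (Fin n)) : Sat sol (removalRound a S) (· ⊆ S) := by
  simp only [removalRound, sat_bind]
  rw [CoinFree.sat_iff (coinFree_const 1), CoinFree.sat_iff (coinFree_solveDual _ _)]
  refine sat_forEach sol (fun s i hs => ?_) _ subset_rfl
  split_ifs
  · simp only [sat_bind, sat_flip]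
    exact ⟨(Finset.erase_subset _ _).trans hs, hs⟩
  · exact hs

/-- Only additive statistics of the survivors are needed, so linearity of expectation suffices.
`Nodup` ensures that each point is tossed for at most once. -/
theorem expect_dropLoop (S : Finset (Fin n)) (w g : Fin n → ℝ) {l : List (Fin n)} (hl : l.Nodup)
    (T : Finset (Fin n)) :
    expect sol (forEach l T fun S' i =>
      if i ∈ S then do
        let drop ← flip (w i)
        if drop then pure (S'.erase i) else pure S'
      else pure S') (fun S' => ∑ i ∈ S', g i) =
      ∑ i ∈ T, g i * if i ∈ l ∧ i ∈ S then 1 - clamp (w i) else 1 := by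
  induction l generalizing T with
  | nil => simp [forEach]
  | cons i l ih =>
    rw [List.nodup_cons] at hl
    rw [expect_forEach_cons]
    have hcongr : ∀ j ∈ T, j ≠ i →
        (g j * if j ∈ i :: l ∧ j ∈ S then 1 - clamp (w j) else 1) =
          g j * if j ∈ l ∧ j ∈ S then 1 - clamp (w j) else 1 := fun j _ hj => by
      simp [hj]
    by_cases hiS : i ∈ S
    · simp only [if_pos hiS, expect_bind, expect_flip, if_true, Bool.false_eq_true, if_false,
        expect_pure, ih hl.2]
      by_cases hiT : i ∈ T
      · rw [← Finset.add_sum_erase T _ hiT, ← Finset.add_sum_erase T _ hiT]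
        rw [Finset.sum_congr rfl fun j hj => hcongr j (Finset.mem_of_mem_erase hj)
          (Finset.ne_of_mem_erase hj)]
        simp only [hl.1, hiS, List.mem_cons, true_or, and_self, if_true, false_and, if_false]
        ring
      · rw [Finset.erase_eq_of_notMem hiT, Finset.sum_congr rfl fun j hj =>
          hcongr j hj (ne_of_mem_of_not_mem hj hiT)]
        ring
    · simp only [if_neg hiS, expect_pure, ih hl.2]
      refine Finset.sum_congr rfl fun j hj => ?_
      by_cases hji : j = i
      · simp [hji, hiS]
      · exact (hcongr j hj hji).symm

theorem expect_removalRound (S : Finset (Fin n)) (g : Fin n → ℝ) :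
    expect sol (removalRound a S) (fun S' => ∑ i ∈ S', g i) =
      ∑ i ∈ S, g i - ∑ i ∈ S, g i * clamp (roundWeights sol a S i) := by
  simp only [removalRound, expect_bind]
  rw [CoinFree.expect_eq (coinFree_const 1), CoinFree.expect_eq (coinFree_solveDual _ _)]
  rw [expect_dropLoop _ _ _ _ (List.nodup_finRange n), ← Finset.sum_sub_distrib]
  refine Finset.sum_congr rfl fun i hi => ?_
  have hw : eval sol (solveDual (fun i => liftPoint (eval sol (const 1)) (a i)) S) =
      roundWeights sol a S := by
    simp only [eval_const, Nat.cast_one, eval_solveDual]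
    rfl
  simp only [List.mem_finRange, hi, and_self, if_true, hw]
  ring

/-- The number of rounds that are performed for the indices in `l`. -/
noncomputable def roundCount (c n d : ℕ) (α γ : ℝ) (l : List ℕ) : ℕ :=
  l.countP fun j => ¬ ((c * n : ℕ) : ℝ) * α ≤ ((j * d : ℕ) : ℝ) * γ

theorem roundCount_range {c n d : ℕ} {α γ : ℝ} (hd : 1 ≤ d) (hγ : 0 < γ)
    (hαγ : α < γ) :
    roundCount c n d α γ (List.range (c * n)) = ⌈(c * n * α) / (d * γ)⌉₊ := by
  have hd' : (1 : ℝ) ≤ d := Nat.one_le_cast.2 hd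
  have hiff : ∀ j : ℕ, ¬ ((c * n : ℕ) : ℝ) * α ≤ ((j * d : ℕ) : ℝ) * γ ↔
      j < ⌈(c * n * α) / (d * γ)⌉₊ := fun j => by
    rw [Nat.lt_ceil, lt_div_iff₀ (by positivity), not_le]
    push_cast
    rw [mul_assoc]
  -- The list of length `c * n` does not cut the rounds short: this uses `α < γ` and `1 ≤ d`.
  have hle : ⌈(c * n * α) / (d * γ)⌉₊ ≤ c * n := by
    rw [Nat.ceil_le, div_le_iff₀ (by positivity)]
    push_cast
    exact mul_le_mul_of_nonneg_left (by nlinarith) (by positivity)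
  rw [roundCount, List.countP_eq_length_filter]
  simp only [hiff]
  rw [← List.toFinset_card_of_nodup (List.nodup_range.filter _), List.toFinset_filter,
    List.toFinset_range]
  have : (Finset.range (c * n)).filter (fun j => decide (j < ⌈(c * n * α) / (d * γ)⌉₊) = true) =
      Finset.range ⌈(c * n * α) / (d * γ)⌉₊ := by
    ext j
    simp only [Finset.mem_filter, Finset.mem_range, decide_eq_true_eq]
    omega
  rw [this, Finset.card_range]

/-- The loop of `removalRounds`, for an arbitrary list of indices. -/
noncomputable def roundsLoop (c : ℕ) (α γ : ℝ) (l : List ℕ) (S : Finset (Fin n)) :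
    Prog ℝ (Finset (Fin n)) :=
  forEach l S fun S' j =>
    if ((c * n : ℕ) : ℝ) * α ≤ ((j * d : ℕ) : ℝ) * γ then pure S' else removalRound a S'

theorem expect_roundsLoop_cons (c : ℕ) (α γ : ℝ) (j : ℕ) (l : List ℕ) (S : Finset (Fin n))
    (f : Finset (Fin n) → ℝ) :
    expect sol (roundsLoop a c α γ (j :: l) S) f =
      expect sol (if ((c * n : ℕ) : ℝ) * α ≤ ((j * d : ℕ) : ℝ) * γ then pure S
        else removalRound a S) fun S' => expect sol (roundsLoop a c α γ l S') f :=
  expect_forEach_cons sol _ _ _ _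

theorem expect_removalRounds (c : ℕ) (α γ : ℝ) (S : Finset (Fin n)) (f : Finset (Fin n) → ℝ) :
    expect sol (removalRounds c a α γ S) f =
      expect sol (roundsLoop a c α γ (List.range (c * n)) S) f := by
  rw [removalRounds, roundsLoop]
  induction List.range (c * n) generalizing S with
  | nil => rfl
  | cons j l ih =>
    rw [expect_forEach_cons, expect_forEach_cons]
    simp only [ih, expect_bind]
    rw [CoinFree.expect_eq (coinFree_const _), CoinFree.expect_eq (coinFree_mul _ _),
      CoinFree.expect_eq (coinFree_const _), CoinFree.expect_eq (coinFree_mul _ _),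
      CoinFree.expect_eq (coinFree_leq _ _)]
    simp

theorem sat_roundsLoop (c : ℕ) (α γ : ℝ) (l : List ℕ) (S : Finset (Fin n)) :
    Sat sol (roundsLoop a c α γ l S) (· ⊆ S) := by
  refine sat_forEach sol (fun s i hs => ?_) _ subset_rfl
  split_ifs
  · exact hs
  · exact (sat_removalRound sol a s).mono fun s' hs' => hs'.trans hs

variable {sol}

/-- The expected loss in a round is at most the total weight of a feasible design, hence at most `d
+ 1`. -/
theorem expect_card_roundsLoop (hsol : sol.IsExact) (c : ℕ) (α γ : ℝ) (l : List ℕ)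
    (S : Finset (Fin n)) :
    (S.card : ℝ) - (d + 1) * roundCount c n d α γ l ≤
      expect sol (roundsLoop a c α γ l S) fun S' => (S'.card : ℝ) := by
  induction l generalizing S with
  | nil => simp [roundCount, roundsLoop, forEach]
  | cons j l ih =>
    rw [expect_roundsLoop_cons]
    by_cases hj : ((c * n : ℕ) : ℝ) * α ≤ ((j * d : ℕ) : ℝ) * γ
    · simp only [if_pos hj, expect_pure]
      rw [roundCount, List.countP_cons_of_neg (by simpa using hj)]
      exact ih S
    · simp only [if_neg hj]
      rw [roundCount, List.countP_cons_of_pos (by simpa using hj)]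
      refine le_trans ?_ (expect_mono sol _ ih)
      rw [expect_sub, expect_const]
      have h1 := expect_removalRound sol a S fun _ => 1
      simp only [Finset.sum_const, nsmul_eq_mul, mul_one, one_mul] at h1
      have h2 : ∑ i ∈ S, clamp (roundWeights sol a S i) ≤ d + 1 := by
        have hfeas := (hsol n (d + 1) (lifted a) S).1
        have h3 := hfeas.2
        push_cast at h3
        exact (Finset.sum_le_sum fun i hi => clamp_le_self (hfeas.1 i hi)).trans h3
      rw [h1, ← roundCount]
      push_cast
      linarith

open Classical in
/-- The potential argument: as long as the active points are in a bad state, each round removes at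
least `κ` points of `B` in expectation. -/
theorem mul_expect_bad_le (c : ℕ) (α γ : ℝ) {S₀ B : Finset (Fin n)} {Bad : Finset (Fin n) → Prop}
    {κ : ℝ} (hκ : 0 ≤ κ) (hanti : ∀ T S, T ⊆ S → Bad T → Bad S)
    (hbad : ∀ S, S ⊆ S₀ → Bad S → κ ≤ ∑ i ∈ S ∩ B, clamp (roundWeights sol a S i)) (l : List ℕ)
    {S : Finset (Fin n)} (hS : S ⊆ S₀) :
    roundCount c n d α γ l * (κ * expect sol (roundsLoop a c α γ l S) fun S' =>
      if Bad S' then 1 else 0) ≤ (S ∩ B).card := by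
  induction l generalizing S with
  | nil => simp [roundCount]
  | cons j l ih =>
    by_cases hB : Bad S
    swap
    -- Active sets only shrink and badness passes to supersets, so a set that is not bad never
    -- becomes bad.
    · have h0 : expect sol (roundsLoop a c α γ (j :: l) S) (fun S' => if Bad S' then 1 else 0) ≤ 0 :=
        expect_le_const sol (sat_roundsLoop sol a c α γ (j :: l) S) fun T hT => by
          rw [if_neg fun h => hB (hanti _ _ hT h)]
      have h1 : κ * expect sol (roundsLoop a c α γ (j :: l) S)
          (fun S' => if Bad S' then 1 else 0) ≤ 0 := mul_nonpos_of_nonneg_of_nonpos hκ h0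
      exact (mul_nonpos_of_nonneg_of_nonpos (Nat.cast_nonneg _) h1).trans (Nat.cast_nonneg _)
    rw [expect_roundsLoop_cons]
    by_cases hj : ((c * n : ℕ) : ℝ) * α ≤ ((j * d : ℕ) : ℝ) * γ
    · simp only [if_pos hj, expect_pure]
      rw [roundCount, List.countP_cons_of_neg (by simpa using hj)]
      exact ih hS
    · simp only [if_neg hj]
      rw [roundCount, List.countP_cons_of_pos (by simpa using hj), ← roundCount]
      set F : Finset (Fin n) → ℝ := fun S' => expect sol (roundsLoop a c α γ l S') fun S' =>
        if Bad S' then 1 else 0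
      -- The later rounds are paid for by the points of `B` that survive this round. The extra
      -- summand, at most `κ`, is paid for by those it removes in expectation.
      have h1 : roundCount c n d α γ l * (κ * expect sol (removalRound a S) F) ≤
          expect sol (removalRound a S) fun S' => ((S' ∩ B).card : ℝ) := by
        rw [← expect_const_mul, ← expect_const_mul]
        exact expect_le_of_sat sol (sat_removalRound sol a S) fun T hT => ih (hT.trans hS)
      have h2 : (expect sol (removalRound a S) fun S' => ((S' ∩ B).card : ℝ)) =
          (S ∩ B).card - ∑ i ∈ S ∩ B, clamp (roundWeights sol a S i) := by
        have h3 := expect_removalRound sol a S fun i => if i ∈ B then 1 else 0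
        simp only [Finset.sum_boole, Finset.filter_mem_eq_inter, ite_mul, one_mul, zero_mul,
          Finset.sum_ite_mem] at h3
        exact h3
      have h4 : expect sol (removalRound a S) F ≤ 1 :=
        expect_le_const sol (sat_true sol _) fun T _ =>
          expect_le_const sol (sat_true sol _) fun T' _ => by split_ifs <;> norm_num
      have h5 := hbad S hS hB
      have h6 : κ * expect sol (removalRound a S) F ≤ κ := mul_le_of_le_one_right hκ h4
      push_cast
      linarith

end Removal

end Prog

/-! ### Success of one trial and amplification by repetition -/

namespace Prog

section Success

variable {sol : DualSolver} {n d : ℕ} (a : Fin n → Fin d → ℝ)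

/-- Some design for the lifted points `S` has a determinant larger than `D`. -/
def HasLargeDesign (D : ℝ) (S : Finset (Fin n)) : Prop :=
  ∃ w : Fin n → ℝ, IsDualFeasible (m := d + 1) S w ∧ D < (designMatrix (lifted a) S w).det

/-- Extend the design by zero weights. This is the monotonicity that `mul_expect_bad_le` requires.
-/
theorem HasLargeDesign.mono {a : Fin n → Fin d → ℝ} {D : ℝ} {T S : Finset (Fin n)} (h : T ⊆ S)
    (hT : HasLargeDesign a D T) : HasLargeDesign a D S := by
  obtain ⟨w, hw, hD⟩ := hT
  exact ⟨_, hw.extend S h, by rwa [designMatrix_extend _ _ h]⟩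

-- A union bound: staying bad costs 1/4 by the potential argument, and losing too many points costs
-- 1/4 by Markov's inequality. The number `q` is the natural unit of rounds, with `d γ q = α n` and
-- `d q = n α / γ`.
open Classical in
theorem expect_failure_le (hsol : sol.IsExact) (hd : 1 ≤ d) {α γ β : ℝ} (hα : 0 < α)
    (hγ : 0 < γ) (hγ1 : γ < 1) (hαγ : α < γ) (hn : γ * d ≤ α * n) (hβ : 1 ≤ β)
    {M : Matrix (Fin d) (Fin d) ℝ} (hM : M.PosDef) (c : Fin d → ℝ)
    (hcov : (1 - α) * n ≤
      ((Finset.univ.filter fun i => (a i - c) ⬝ᵥ (M⁻¹ *ᵥ (a i - c)) ≤ 1).card : ℝ))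
    {S₀ : Finset (Fin n)} (hS₀ : ∀ i ∈ S₀, (a i - c) ⬝ᵥ (M⁻¹ *ᵥ (a i - c)) ≤ 9 * β ^ 2)
    (hgood : ∀ i, (a i - c) ⬝ᵥ (M⁻¹ *ᵥ (a i - c)) ≤ 1 → i ∈ S₀) :
    expect sol (removalRounds 2 a α γ S₀) (fun S' =>
      if HasLargeDesign a ((4 * β) ^ (2 * (2 * γ * (d + 1))) * M.det *
          ((d + 1) * ((d + 1) / d) ^ d)) S' ∨ (S'.card : ℝ) < (1 - 25 * (α / γ)) * n
        then 1 else 0) ≤ 1 / 2 := by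
  have hd' : (1 : ℝ) ≤ d := Nat.one_le_cast.2 hd
  set Bad := HasLargeDesign a ((4 * β) ^ (2 * (2 * γ * (d + 1))) * M.det *
          ((d + 1) * ((d + 1) / d) ^ d)) with hBad
  set G := Finset.univ.filter fun i => (a i - c) ⬝ᵥ (M⁻¹ *ᵥ (a i - c)) ≤ 1 with hG
  have hGS : G ⊆ S₀ := fun i hi => hgood i (Finset.mem_filter.1 hi).2
  set q : ℝ := n * α / (d * γ) with hq
  have hdγ : 0 < d * γ := by positivity
  have hqd : d * γ * q = n * α := mul_div_cancel₀ _ hdγ.ne'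
  have hq1 : 1 ≤ q := by
    rw [hq, le_div_iff₀ hdγ]
    linarith
  have hqd' : d * q = n * (α / γ) := by
    rw [hq]
    field_simp
  set r := roundCount 2 n d α γ (List.range (2 * n)) with hr
  have hr' : r = ⌈2 * q⌉₊ := by
    rw [hr, roundCount_range hd hγ hαγ, hq]
    congr 1
    push_cast
    ring
  have hr1 : 2 * q ≤ r := by rw [hr']; exact Nat.le_ceil _
  -- Rounding up costs at most one round, and `1 ≤ q` is the hypothesis `γ d ≤ α n`.
  have hr2 : (r : ℝ) ≤ 3 * q := by
    rw [hr']
    have := (Nat.ceil_lt_add_one (a := 2 * q) (by linarith)).le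
    linarith
  rw [expect_removalRounds]
  set p := expect sol (roundsLoop a 2 α γ (List.range (2 * n)) S₀) fun S' =>
    if Bad S' then (1 : ℝ) else 0 with hp
  have hp0 : 0 ≤ p := const_le_expect sol (sat_true sol _) fun T _ => by split_ifs <;> norm_num
  have h1 : r * ((2 * γ * (d + 1)) * p) ≤ (S₀ ∩ Gᶜ).card := by
    refine mul_expect_bad_le a 2 α γ (by positivity) (fun T S h hT => hT.mono h) ?_ _ subset_rfl
    intro S hS ⟨w, hw, hD⟩
    have hopt := hsol n (d + 1) (lifted a) S
    have hD' := hD.trans_le (hopt.2 w hw)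
    have hdet : 0 < (designMatrix (lifted a) S (sol n (d + 1) (lifted a) S)).det := by
      have := hM.det_pos
      exact lt_of_le_of_lt (by positivity) hD'
    -- A small weight on the outliers would contradict badness by `det_lifted_le`. The determinant
    -- is positive, so truncation does not change the weights.
    by_contra! hlt
    refine absurd hD' (not_lt.2 (hopt.det_lifted_le a hd hM c hβ Gᶜ (fun i hi => hS₀ i (hS hi))
      (fun i _ hi => ?_) (hlt.le.trans' (Finset.sum_le_sum fun i hi => ?_))))
    · simpa [hG] using hi
    · have hiS := (Finset.mem_inter.1 hi).1
      exact (clamp_eq_self (hopt.1.1 i hiS) (hopt.weight_le_one hdet hiS)).ge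
  have h2 : ((S₀ ∩ Gᶜ).card : ℝ) ≤ d * γ * q := by
    have h3 : ((S₀ ∩ Gᶜ).card : ℝ) ≤ (Gᶜ.card : ℝ) :=
      Nat.cast_le.2 (Finset.card_le_card Finset.inter_subset_right)
    rw [Finset.card_compl, Nat.cast_sub (Finset.card_le_univ _), Fintype.card_fin] at h3
    rw [hqd]
    linarith
  have hp1 : p ≤ 1 / 4 := by
    have h3 : (d * γ * q) * (4 * p) ≤ (d * γ * q) * 1 := by
      calc (d * γ * q) * (4 * p) ≤ (2 * q) * ((2 * γ * (d + 1)) * p) := by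
            have : 0 ≤ γ * q * p := by positivity
            nlinarith
        _ ≤ r * ((2 * γ * (d + 1)) * p) := mul_le_mul_of_nonneg_right hr1 (by positivity)
        _ ≤ _ := by linarith
    have := le_of_mul_le_mul_left h3 (by positivity)
    linarith
  have h4 := expect_card_roundsLoop a hsol 2 α γ (List.range (2 * n)) S₀
  rw [← hr] at h4
  set m := expect sol (roundsLoop a 2 α γ (List.range (2 * n)) S₀) fun S' => (S'.card : ℝ)
  have h5 : S₀.card - m ≤ 6 * (d * q) := by
    have : (d + 1) * (r : ℝ) ≤ (2 * d) * (3 * q) :=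
      mul_le_mul (by linarith) hr2 (by positivity) (by positivity)
    linarith
  have hcard : (1 - α) * n ≤ S₀.card :=
    hcov.trans (Nat.cast_le.2 (Finset.card_le_card hGS))
  have hαn : α * n ≤ d * q := by
    rw [hqd', mul_comm]
    refine mul_le_mul_of_nonneg_left ?_ (Nat.cast_nonneg _)
    rw [le_div_iff₀ hγ]
    nlinarith
  have hdq : 0 < d * q := by positivity
  -- Markov's inequality pointwise. `S₀` misses at most `α n ≤ d q` points, so falling short by `25
  -- d q` means that more than `24 d q` were removed, four times the bound on the expectation.
  have h6 : expect sol (roundsLoop a 2 α γ (List.range (2 * n)) S₀) (fun S' =>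
      if Bad S' ∨ (S'.card : ℝ) < (1 - 25 * (α / γ)) * n then (1 : ℝ) else 0) ≤
      expect sol (roundsLoop a 2 α γ (List.range (2 * n)) S₀) fun S' =>
        (if Bad S' then (1 : ℝ) else 0) + (24 * (d * q))⁻¹ * (S₀.card - S'.card) := by
    refine expect_le_of_sat sol (sat_roundsLoop sol a 2 α γ _ S₀) fun T hT => ?_
    have hTc : (T.card : ℝ) ≤ S₀.card := Nat.cast_le.2 (Finset.card_le_card hT)
    have h7 : 0 ≤ (24 * (d * q))⁻¹ * ((S₀.card : ℝ) - T.card) :=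
      mul_nonneg (by positivity) (by linarith)
    by_cases hBT : Bad T
    · simp only [hBT, true_or, if_true]
      linarith
    · simp only [hBT, false_or, if_false, zero_add]
      split_ifs with hlt
      · rw [le_inv_mul_iff₀ (by positivity)]
        have : (1 - 25 * (α / γ)) * n = n - 25 * (d * q) := by rw [hqd']; ring
        linarith
      · exact h7
  refine h6.trans ?_
  rw [expect_add, expect_const_mul, expect_sub, expect_const]
  have h8 : (24 * (d * q))⁻¹ * (S₀.card - m) ≤ 1 / 4 := by
    rw [inv_mul_le_iff₀ (by positivity)]
    linarith
  linarith

/-- All ellipsoids that are kept as candidates. -/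
def IsCandidate (sol : DualSolver) (c : ℕ) (α γ : ℝ) (E : EllipsoidData ℝ d) : Prop :=
  E.shapeMatrix.PosSemidef ∧ eval sol (coversEnough c a α γ E) = true

/-- The invariant of the main loop. -/
def IsState (sol : DualSolver) (c : ℕ) (α γ : ℝ) (s : Option (EllipsoidData ℝ d)) : Prop :=
  ∀ E ∈ s, IsCandidate a sol c α γ E

/-- A candidate with a small determinant has been found. -/
def Succeeded (R : ℝ) (s : Option (EllipsoidData ℝ d)) : Prop :=
  ∃ E ∈ s, E.shapeMatrix.det ≤ R

/-- The deterministic part of one pass of the main step. -/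
noncomputable def considerPoints (cCov : ℕ) (α γ : ℝ) (best : Option (EllipsoidData ℝ d))
    (S : Finset (Fin n)) : Prog ℝ (Option (EllipsoidData ℝ d)) := do
  let E ← enclosingEllipsoid a S
  let good ← coversEnough cCov a α γ E
  if good then keepSmaller best E else pure best

theorem tryBall_eq (cIter cCov : ℕ) (α γ : ℝ) (best : Option (EllipsoidData ℝ d))
    (k₁ k₂ : Fin n) :
    tryBall cIter cCov a α γ best k₁ k₂ = (do
      let S ← pointsInBall a k₁ k₂
      let S' ← removalRounds cIter a α γ S
      considerPoints a cCov α γ best S') := rfl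

theorem coinFree_considerPoints (cCov : ℕ) (α γ : ℝ) (best : Option (EllipsoidData ℝ d))
    (S : Finset (Fin n)) : CoinFree (considerPoints a cCov α γ best S) :=
  coinFree_bind (coinFree_enclosingEllipsoid a S) fun _ =>
    coinFree_bind (coinFree_coversEnough _ _ _ _ _) fun _ =>
      coinFree_ite (coinFree_keepSmaller _ _) trivial

variable {a}

/-- Semidefiniteness belongs to the invariant because the comparison uses elimination, which is
known to give the determinant only for such matrices. -/
theorem isState_keepSmaller {c : ℕ} {α γ : ℝ} {s : Option (EllipsoidData ℝ d)}
    (hs : IsState a sol c α γ s) {E : EllipsoidData ℝ d} (hE : IsCandidate a sol c α γ E) :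
    IsState a sol c α γ (eval sol (keepSmaller s E)) := by
  cases s with
  | none =>
    rintro F hF
    rw [eval_keepSmaller_none, Option.mem_some_iff] at hF
    exact hF ▸ hE
  | some F =>
    rw [eval_keepSmaller_some sol (hs F rfl).1 hE.1]
    split_ifs
    · exact hs
    · rintro F' hF'
      rw [Option.mem_some_iff] at hF'
      exact hF' ▸ hE

theorem succeeded_keepSmaller {c : ℕ} {α γ R : ℝ} {s : Option (EllipsoidData ℝ d)}
    (hs : IsState a sol c α γ s) {E : EllipsoidData ℝ d} (hE : IsCandidate a sol c α γ E)
    (h : Succeeded R s ∨ E.shapeMatrix.det ≤ R) :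
    Succeeded R (eval sol (keepSmaller s E)) := by
  cases s with
  | none =>
    refine ⟨E, rfl, ?_⟩
    rcases h with ⟨F, hF, _⟩ | h
    · cases hF
    · exact h
  | some F =>
    rw [eval_keepSmaller_some sol (hs F rfl).1 hE.1]
    split_ifs with hFE
    · refine ⟨F, rfl, ?_⟩
      rcases h with ⟨F', hF', h⟩ | h
      · rwa [Option.mem_some_iff.1 hF']
      · exact hFE.trans h
    · refine ⟨E, rfl, ?_⟩
      rcases h with ⟨F', hF', h⟩ | h
      · rw [Option.mem_some_iff] at hF'
        subst hF'
        exact (not_le.1 hFE).le.trans h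
      · exact h

theorem eval_considerPoints (cCov : ℕ) (α γ : ℝ) (best : Option (EllipsoidData ℝ d))
    (S : Finset (Fin n)) :
    eval sol (considerPoints a cCov α γ best S) =
      if eval sol (coversEnough cCov a α γ (eval sol (enclosingEllipsoid a S))) = true then
        eval sol (keepSmaller best (eval sol (enclosingEllipsoid a S))) else best := by
  simp only [considerPoints, eval_bind]
  split_ifs <;> rfl

theorem isState_considerPoints (hsol : sol.IsExact) {c : ℕ} {α γ R : ℝ}
    {s : Option (EllipsoidData ℝ d)} (hs : IsState a sol c α γ s) (S : Finset (Fin n)) :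
    IsState a sol c α γ (eval sol (considerPoints a c α γ s S)) ∧
      (Succeeded R s → Succeeded R (eval sol (considerPoints a c α γ s S))) := by
  rw [eval_considerPoints]
  split_ifs with h
  · have hE : IsCandidate a sol c α γ (eval sol (enclosingEllipsoid a S)) :=
      ⟨posSemidef_enclosingEllipsoid sol a S hsol, h⟩
    exact ⟨isState_keepSmaller hs hE, fun hR => succeeded_keepSmaller hs hE (Or.inl hR)⟩
  · exact ⟨hs, id⟩

/-- The coverage test passes because the ellipsoid encloses the remaining points; a small
determinant then survives the comparison with the current best. -/
theorem succeeded_considerPoints (hsol : sol.IsExact) (hd : 1 ≤ d) {c : ℕ} {α γ R : ℝ}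
    (hγ : 0 < γ) (hR : 0 ≤ R) {s : Option (EllipsoidData ℝ d)} (hs : IsState a sol c α γ s)
    {S : Finset (Fin n)} (hS : ¬ HasLargeDesign a (R * ((d + 1) * ((d + 1) / d) ^ d)) S)
    (hcard : (1 - c * (α / γ)) * n ≤ (S.card : ℝ)) :
    Succeeded R (eval sol (considerPoints a c α γ s S)) := by
  have hpsd := posSemidef_enclosingEllipsoid sol a S hsol
  have hcov : eval sol (coversEnough c a α γ (eval sol (enclosingEllipsoid a S))) = true := by
    rw [eval_coversEnough sol a c hγ]
    refine hcard.trans (Nat.cast_le.2 (Finset.card_le_card fun i hi => ?_))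
    rw [Finset.mem_filter, eval_isInside sol _ _ hpsd]
    exact ⟨Finset.mem_univ _, enclosingEllipsoid_encloses sol a S hd hsol hi⟩
  rw [eval_considerPoints, if_pos hcov]
  refine succeeded_keepSmaller hs ⟨hpsd, hcov⟩ (Or.inr ?_)
  refine det_enclosingEllipsoid_le sol a S hd hsol hR fun w hw => ?_
  by_contra! h
  exact hS ⟨w, hw, h⟩

theorem sat_tryBall (hsol : sol.IsExact) (cIter : ℕ) {c : ℕ} {α γ : ℝ} (R : ℝ)
    {s : Option (EllipsoidData ℝ d)} (hs : IsState a sol c α γ s) (k₁ k₂ : Fin n) :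
    Sat sol (tryBall cIter c a α γ s k₁ k₂) fun s' =>
      IsState a sol c α γ s' ∧ (Succeeded R s → Succeeded R s') := by
  simp only [tryBall_eq, sat_bind]
  refine (sat_true sol _).mono fun S _ => (sat_true sol _).mono fun S' _ => ?_
  rw [CoinFree.sat_iff (coinFree_considerPoints _ _ _ _ _ _)]
  exact isState_considerPoints hsol hs S'

open Classical in
/-- The indicator function of failure. -/
noncomputable def failure (R : ℝ) (s : Option (EllipsoidData ℝ d)) : ℝ :=
  if Succeeded R s then 0 else 1

theorem failure_nonneg (R : ℝ) (s : Option (EllipsoidData ℝ d)) : 0 ≤ failure R s := by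
  unfold failure
  split_ifs <;> norm_num

theorem failure_le_one (R : ℝ) (s : Option (EllipsoidData ℝ d)) : failure R s ≤ 1 := by
  unfold failure
  split_ifs <;> norm_num

theorem expect_tryBall_le (hsol : sol.IsExact) (cIter : ℕ) {c : ℕ} {α γ : ℝ} (R : ℝ)
    {s : Option (EllipsoidData ℝ d)} (hs : IsState a sol c α γ s) (k₁ k₂ : Fin n) :
    expect sol (tryBall cIter c a α γ s k₁ k₂) (failure R) ≤ failure R s := by
  refine expect_le_const sol (sat_tryBall hsol cIter R hs k₁ k₂) fun s' hs' => ?_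
  by_cases h : Succeeded R s
  · simp [failure, h, hs'.2 h]
  · simpa [failure, h] using failure_le_one R s'

/-- The centre and the radius of a ball that contains the covered points and no points far away
from the ellipsoid. -/
theorem exists_good_ball {α β : ℝ} (hα1 : α < 1) (hn : 0 < n) (hβ : 1 ≤ β)
    {M : Matrix (Fin d) (Fin d) ℝ} (hM : M.PosDef)
    (hcond : ellipsoidCondNumber M hM.isHermitian ≤ β) (c : Fin d → ℝ) {G : Finset (Fin n)}
    (hG : ∀ i, i ∈ G ↔ (a i - c) ⬝ᵥ (M⁻¹ *ᵥ (a i - c)) ≤ 1) (hcov : (1 - α) * n ≤ (G.card : ℝ)) :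
    ∃ k₁ k₂ : Fin n,
      (∀ i ∈ eval sol (pointsInBall a k₁ k₂),
        (a i - c) ⬝ᵥ (M⁻¹ *ᵥ (a i - c)) ≤ 9 * β ^ 2) ∧
      ∀ i, (a i - c) ⬝ᵥ (M⁻¹ *ᵥ (a i - c)) ≤ 1 → i ∈ eval sol (pointsInBall a k₁ k₂) := by
  have hn' : (0 : ℝ) < n := Nat.cast_pos.2 hn
  have hne : G.Nonempty := by
    rw [← Finset.card_pos, ← Nat.cast_pos (α := ℝ)]
    exact lt_of_lt_of_le (mul_pos (by linarith) hn') hcov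
  obtain ⟨k₁, hk₁⟩ := hne
  -- Farthest from `k₁`: the ball reaches all of `G`, yet its radius is a distance between two
  -- points of the ellipsoid.
  obtain ⟨k₂, hk₂, hmax⟩ := G.exists_max_image (fun i => ∑ j, (a i j - a k₁ j) ^ 2) ⟨k₁, hk₁⟩
  have hdot : ∀ u v : Fin d → ℝ, (u - v) ⬝ᵥ (u - v) = ∑ j, (u j - v j) ^ 2 := fun u v => by
    simp [dotProduct, sq]
  have hsymm : ∑ j, (a k₁ j - a k₂ j) ^ 2 = ∑ j, (a k₂ j - a k₁ j) ^ 2 :=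
    Finset.sum_congr rfl fun j _ => by ring
  refine ⟨k₁, k₂, fun i hi => ?_, fun i hi => ?_⟩
  · rw [mem_eval_pointsInBall] at hi
    refine quad_le_of_condNumber hβ hM hcond c (a i) (a k₁) (a k₂) ((hG _).1 hk₁) ((hG _).1 hk₂) ?_
    rwa [hdot, hdot]
  · rw [mem_eval_pointsInBall, hsymm]
    exact hmax i ((hG i).2 hi)

-- The bound holds from every state satisfying the invariant, whatever happened before, so the
-- factors 1/2 multiply over the passes.
open Classical in
theorem expect_tryBall_good_le (hsol : sol.IsExact) (hd : 1 ≤ d) {α γ β : ℝ} (hα : 0 < α)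
    (hγ : 0 < γ) (hγ1 : γ < 1) (hαγ : α < γ) (hn : γ * d ≤ α * n) (hβ : 1 ≤ β)
    {M : Matrix (Fin d) (Fin d) ℝ} (hM : M.PosDef) (c : Fin d → ℝ)
    (hcov : (1 - α) * n ≤
      ((Finset.univ.filter fun i => (a i - c) ⬝ᵥ (M⁻¹ *ᵥ (a i - c)) ≤ 1).card : ℝ))
    {k₁ k₂ : Fin n}
    (hS₀ : ∀ i ∈ eval sol (pointsInBall a k₁ k₂),
      (a i - c) ⬝ᵥ (M⁻¹ *ᵥ (a i - c)) ≤ 9 * β ^ 2)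
    (hgood : ∀ i, (a i - c) ⬝ᵥ (M⁻¹ *ᵥ (a i - c)) ≤ 1 → i ∈ eval sol (pointsInBall a k₁ k₂))
    {s : Option (EllipsoidData ℝ d)} (hs : IsState a sol 25 α γ s) :
    expect sol (tryBall 2 25 a α γ s k₁ k₂)
      (failure ((4 * β) ^ (2 * (2 * γ * (d + 1))) * M.det)) ≤
      1 / 2 * failure ((4 * β) ^ (2 * (2 * γ * (d + 1))) * M.det) s := by
  set R := (4 * β) ^ (2 * (2 * γ * (d + 1))) * M.det with hR
  have hR0 : 0 ≤ R := by
    have := hM.det_pos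
    positivity
  by_cases h : Succeeded R s
  · have h0 : failure R s = 0 := by simp [failure, h]
    have := expect_tryBall_le hsol 2 R hs k₁ k₂
    rw [h0] at this ⊢
    linarith
  · have h1 : failure R s = 1 := by simp [failure, h]
    rw [h1, mul_one, tryBall_eq, expect_bind, CoinFree.expect_eq (coinFree_pointsInBall _ _ _),
      expect_bind]
    refine le_trans (expect_mono sol _ fun S' => ?_)
      (expect_failure_le a hsol hd hα hγ hγ1 hαγ hn hβ hM c hcov hS₀ hgood)
    rw [CoinFree.expect_eq (coinFree_considerPoints _ _ _ _ _ _)]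
    split_ifs with hS
    · exact failure_le_one _ _
    · rw [not_or, not_lt] at hS
      have := succeeded_considerPoints hsol hd hγ hR0 hs hS.1 (c := 25) (by exact_mod_cast hS.2)
      simp [failure, this]

/-- The main loop of the algorithm. -/
noncomputable def mainLoop (a : Fin n → Fin d → ℝ) (cIter cCov cRep : ℕ) (α γ : ℝ) :
    Prog ℝ (Option (EllipsoidData ℝ d)) :=
  forEach (List.range (cRep * (Nat.log 2 n + 1))) none fun s _ =>
    forEach (List.finRange n) s fun s k₁ =>
      forEach (List.finRange n) s fun s k₂ => tryBall cIter cCov a α γ s k₁ k₂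

theorem isState_none (c : ℕ) (α γ : ℝ) : IsState a sol c α γ none := by
  rintro E hE
  cases hE

theorem sat_tryBall_isState (hsol : sol.IsExact) {cIter c : ℕ} {α γ : ℝ}
    (s : Option (EllipsoidData ℝ d)) (k₁ k₂ : Fin n) (hs : IsState a sol c α γ s) :
    Sat sol (tryBall cIter c a α γ s k₁ k₂) (IsState a sol c α γ) :=
  (sat_tryBall hsol cIter 0 hs k₁ k₂).mono fun _ h => h.1

theorem sat_mainLoop (hsol : sol.IsExact) (cIter cCov cRep : ℕ) (α γ : ℝ) :
    Sat sol (mainLoop a cIter cCov cRep α γ) (IsState a sol cCov α γ) :=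
  sat_forEach sol (fun _ _ hs => sat_forEach sol (fun _ _ hs =>
    sat_forEach sol (fun s k₂ hs => sat_tryBall_isState hsol s _ k₂ hs) _ hs) _ hs) _
    (isState_none _ _ _)

-- Each pass contains the good pair and no pair increases the failure probability, so a pass halves
-- it; finally `n ≤ 2 ^ (Nat.log 2 n + 1)`.
open Classical in
theorem expect_mainLoop_le (hsol : sol.IsExact) (hd : 1 ≤ d) {α γ β : ℝ} (hα : 0 < α)
    (hα1 : α < 1) (hγ : 0 < γ) (hγ1 : γ < 1) (hαγ : α < γ) (hn : γ * d ≤ α * n) (hβ : 1 ≤ β)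
    {M : Matrix (Fin d) (Fin d) ℝ} (hM : M.PosDef)
    (hcond : ellipsoidCondNumber M hM.isHermitian ≤ β) (c : Fin d → ℝ)
    (hcov : (1 - α) * n ≤
      ((Finset.univ.filter fun i => (a i - c) ⬝ᵥ (M⁻¹ *ᵥ (a i - c)) ≤ 1).card : ℝ)) :
    expect sol (mainLoop a 2 25 1 α γ)
      (failure ((4 * β) ^ (2 * (2 * γ * (d + 1))) * M.det)) ≤ 1 / n := by
  have hd' : (1 : ℝ) ≤ d := Nat.one_le_cast.2 hd
  have hn0 : 0 < n := by
    rw [← Nat.cast_pos (α := ℝ)]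
    refine pos_of_mul_pos_right (lt_of_lt_of_le ?_ hn) hα.le
    positivity
  obtain ⟨k₁, k₂, hS₀, hgood⟩ := exists_good_ball (sol := sol) (a := a) hα1 hn0 hβ hM hcond c
    (G := Finset.univ.filter fun i => (a i - c) ⬝ᵥ (M⁻¹ *ᵥ (a i - c)) ≤ 1) (by simp) hcov
  set R := (4 * β) ^ (2 * (2 * γ * (d + 1))) * M.det
  have hsat := fun s k₁ k₂ => sat_tryBall_isState (a := a) hsol (cIter := 2) (c := 25)
    (α := α) (γ := γ) s k₁ k₂
  have hsat' : ∀ (s : Option (EllipsoidData ℝ d)) (k₁ : Fin n), IsState a sol 25 α γ s →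
      Sat sol (forEach (List.finRange n) s fun s k₂ => tryBall 2 25 a α γ s k₁ k₂)
        (IsState a sol 25 α γ) := fun s k₁ hs =>
    sat_forEach sol (fun s k₂ hs => hsat s k₁ k₂ hs) _ hs
  have hle := fun (s : Option (EllipsoidData ℝ d)) (k₁ k₂ : Fin n) (hs : IsState a sol 25 α γ s) =>
    expect_tryBall_le hsol 2 R hs k₁ k₂
  have hle' : ∀ (s : Option (EllipsoidData ℝ d)) (k₁ : Fin n), IsState a sol 25 α γ s →
      expect sol (forEach (List.finRange n) s fun s k₂ => tryBall 2 25 a α γ s k₁ k₂)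
        (failure R) ≤ failure R s := fun s k₁ hs =>
    expect_forEach_le sol (fun s k₂ hs => hsat s k₁ k₂ hs) (fun s k₂ hs => hle s k₁ k₂ hs) _ hs
  have hpass : ∀ (s : Option (EllipsoidData ℝ d)), IsState a sol 25 α γ s →
      expect sol (forEach (List.finRange n) s fun s k₁ =>
        forEach (List.finRange n) s fun s k₂ => tryBall 2 25 a α γ s k₁ k₂) (failure R) ≤
        1 / 2 * failure R s := fun s hs =>
    expect_forEach_le_mul sol (by norm_num) hsat' hle' (List.mem_finRange k₁)
      (fun s hs => expect_forEach_le_mul sol (by norm_num) (fun s k₂ hs => hsat s k₁ k₂ hs)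
        (fun s k₂ hs => hle s k₁ k₂ hs) (List.mem_finRange k₂)
        (fun s hs => expect_tryBall_good_le hsol hd hα hγ hγ1 hαγ hn hβ hM c hcov hS₀ hgood hs)
        hs) hs
  have h1 := expect_forEach_le_pow sol (body := fun (s : Option (EllipsoidData ℝ d)) (_ : ℕ) =>
      forEach (List.finRange n) s fun s k₁ =>
        forEach (List.finRange n) s fun s k₂ => tryBall 2 25 a α γ s k₁ k₂)
    (by norm_num : (0 : ℝ) ≤ 1 / 2) (fun s _ hs => sat_forEach sol hsat' _ hs)
    (fun s _ hs => hpass s hs) (List.range (1 * (Nat.log 2 n + 1)))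
    (isState_none (a := a) (sol := sol) 25 α γ)
  refine h1.trans ?_
  have h2 : (n : ℝ) ≤ 2 ^ (Nat.log 2 n + 1) := by
    exact_mod_cast (Nat.lt_pow_succ_log_self one_lt_two n).le
  rw [List.length_range, one_mul, one_div, inv_pow, one_div]
  calc (2 ^ (Nat.log 2 n + 1))⁻¹ * failure R none ≤ ((2 : ℝ) ^ (Nat.log 2 n + 1))⁻¹ * 1 :=
        mul_le_mul_of_nonneg_left (failure_le_one _ _) (by positivity)
    _ ≤ (n : ℝ)⁻¹ := by
        rw [mul_one]
        exact inv_anti₀ (Nat.cast_pos.2 hn0) h2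

end Success

end Prog

namespace Prog

/-! ## The running time -/

section Time

variable (sol : DualSolver) (T : ℕ → ℕ → ℕ)

theorem time_sqDist_le {d : ℕ} (x y : Fin d → ℝ) : time sol T (sqDist x y) ≤ d * 3 + 1 :=
  time_sumOver_le sol T d fun _ => time_bind_le sol T (u := 1) (time_sub sol T _ _).le fun _ =>
    (time_mul sol T _ _).le

theorem time_schur_le (m : ℕ) (A : Fin (m + 1) → Fin (m + 1) → ℝ) :
    time sol T (schur m A) ≤ m * (m * 3) :=
  time_tabulate_le sol T m fun _ => time_tabulate_le sol T m fun _ =>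
    time_bind_le sol T (u := 2) (time_mul sol T _ _).le fun _ =>
      time_bind_le sol T (u := 1) (time_div sol T _ _).le fun _ => (time_sub sol T _ _).le

theorem time_psdDet_le (m : ℕ) (A : Fin m → Fin m → ℝ) :
    time sol T (psdDet m A) ≤ 3 * m ^ 3 + 3 * m + 1 := by
  induction m with
  | zero => simpa [psdDet] using (time_const sol T 1).le
  | succ m ih =>
    refine (time_bind_le sol T (time_const sol T 0).le fun _ => time_bind_le sol T
      (time_leq sol T _ _).le fun _ => time_ite_le sol T (t := m * (m * 3) +
        ((3 * m ^ 3 + 3 * m + 1) + 1)) (Nat.zero_le _) (time_bind_le sol T (time_schur_le sol T m A)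
          fun B => time_bind_le sol T (ih B) fun _ => (time_mul sol T _ _).le)).trans ?_
    ring_nf
    nlinarith [Nat.zero_le (m ^ 2)]

theorem time_isPSD_le (m : ℕ) (A : Fin m → Fin m → ℝ) :
    time sol T (isPSD m A) ≤ 3 * m ^ 3 + 5 * m + 1 := by
  induction m with
  | zero => simp [isPSD, time, time_pure]
  | succ m ih =>
    refine (time_bind_le sol T (time_const sol T 0).le fun _ => time_bind_le sol T
      (time_leq sol T _ _).le fun _ => time_ite_le sol T (t := (m * (m * 3) + ((m + 1) * 2 + 1)) +
        (3 * m ^ 3 + 5 * m + 1)) ?_ ?_).trans ?_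
    · refine time_bind_le sol T ((time_allOf_le sol T (m + 1) (t := 2) fun j => ?_).trans
        (Nat.le_add_left _ _)) fun _ => time_ite_le sol T (ih _) (Nat.zero_le _)
      exact time_bind_le sol T (u := 1) (time_leq sol T _ _).le fun _ =>
        time_bind_le sol T (u := 0) (time_leq sol T _ _).le fun _ => le_rfl
    · exact time_bind_le sol T ((time_schur_le sol T m A).trans (Nat.le_add_right _ _))
        fun B => ih B
    · ring_nf
      nlinarith [Nat.zero_le (m ^ 2)]

/-- `1 ≤ t` pays for the zero that is loaded at each index outside `S`. -/
theorem time_sumOn_le {n : ℕ} (S : Finset (Fin n)) {f : Fin n → Prog ℝ ℝ} {t : ℕ} (ht : 1 ≤ t)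
    (h : ∀ i, time sol T (f i) ≤ t) : time sol T (sumOn S f) ≤ n * (t + 1) + 1 :=
  time_sumOver_le sol T n fun i => time_ite_le sol T (h i) ht

variable {n d N : ℕ} (a : Fin n → Fin d → ℝ)

theorem time_isInside_le (hd : d ≤ N) (hN : 1 ≤ N) (x : Fin d → ℝ) (E : EllipsoidData ℝ d) :
    time sol T (isInside x E) ≤ 12 * N ^ 3 := by
  refine (time_bind_le sol T (time_tabulate_le sol T d fun _ => (time_sub sol T _ _).le) fun _ =>
    time_bind_le sol T (time_tabulate_le sol T d fun _ => time_tabulate_le sol T d fun _ =>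
      time_bind_le sol T (u := 1) (time_mul sol T _ _).le fun _ => (time_sub sol T _ _).le)
      fun _ => time_isPSD_le sol T d _).trans ?_
  have h1 : d ^ 3 ≤ N ^ 3 := Nat.pow_le_pow_left hd 3
  have h2 : d * d ≤ N ^ 2 := by rw [← sq]; exact Nat.pow_le_pow_left hd 2
  have h3 : N ^ 2 ≤ N ^ 3 := Nat.pow_le_pow_right hN (by norm_num)
  have h4 : N ≤ N ^ 3 := Nat.le_self_pow (by norm_num) N
  nlinarith

theorem time_coversEnough_le (hn : n ≤ N) (hd : d ≤ N) (hN : 1 ≤ N) (c : ℕ) (α γ : ℝ)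
    (E : EllipsoidData ℝ d) : time sol T (coversEnough c a α γ E) ≤ 22 * N ^ 4 := by
  refine (time_bind_le sol T (time_sumOver_le sol T n fun i => time_bind_le sol T
    (time_isInside_le sol T hd hN _ _) fun _ => time_ite_le sol T (t := 1)
      (time_const sol T 1).le (time_const sol T 0).le) fun _ =>
    time_bind_le sol T (u := 6) (time_mul sol T _ _).le fun _ =>
    time_bind_le sol T (u := 5) (time_const sol T _).le fun _ =>
    time_bind_le sol T (u := 4) (time_mul sol T _ _).le fun _ =>
    time_bind_le sol T (u := 3) (time_sub sol T _ _).le fun _ =>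
    time_bind_le sol T (u := 2) (time_const sol T _).le fun _ =>
    time_bind_le sol T (u := 1) (time_mul sol T _ _).le fun _ =>
    (time_leq sol T _ _).le).trans ?_
  have h1 : n * (12 * N ^ 3 + 1 + 1) ≤ N * (12 * N ^ 3 + 1 + 1) := Nat.mul_le_mul_right _ hn
  have h2 : N ≤ N ^ 4 := Nat.le_self_pow (by norm_num) N
  have h3 : N * (12 * N ^ 3 + 1 + 1) = 12 * N ^ 4 + 2 * N := by ring
  omega

theorem time_weightedEllipsoid_le (hn : n ≤ N) (hd : d ≤ N) (hN : 1 ≤ N) (S : Finset (Fin n))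
    (w : Fin n → ℝ) (W s : ℝ) : time sol T (weightedEllipsoid a S w W s) ≤ 11 * N ^ 3 := by
  refine (time_bind_le sol T (time_tabulate_le sol T d fun _ => time_bind_le sol T
      (time_sumOn_le sol T S le_rfl fun _ => (time_mul sol T _ _).le) fun _ =>
        (time_div sol T _ _).le) fun _ =>
    time_bind_le sol T (u := 0) (time_tabulate_le sol T d fun _ => time_tabulate_le sol T d fun _ =>
      time_bind_le sol T (time_sumOn_le sol T S (t := 4) (by norm_num) fun _ =>
        time_bind_le sol T (u := 3) (time_sub sol T _ _).le fun _ =>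
        time_bind_le sol T (u := 2) (time_sub sol T _ _).le fun _ =>
        time_bind_le sol T (u := 1) (time_mul sol T _ _).le fun _ => (time_mul sol T _ _).le)
          fun _ => (time_mul sol T _ _).le) fun _ => le_rfl).trans ?_
  calc d * (n * (1 + 1) + 1 + 1) + (d * (d * (n * (4 + 1) + 1 + 1)) + 0)
      ≤ N * (N * (1 + 1) + 1 + 1) + (N * (N * (N * (4 + 1) + 1 + 1)) + 0) := by gcongr
    _ = 5 * N ^ 3 + 4 * N ^ 2 + 2 * N := by ring
    _ ≤ 11 * N ^ 3 := by
      have h3 : N ^ 2 ≤ N ^ 3 := Nat.pow_le_pow_right hN (by norm_num)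
      have h4 : N ≤ N ^ 3 := Nat.le_self_pow (by norm_num) N
      omega

theorem time_pointEllipsoid (d : ℕ) : time sol T (pointEllipsoid d : Prog ℝ _) = 1 := rfl

theorem time_solveDual_le (hn : n ≤ N) (hd : d + 1 ≤ N) (x : Fin n → Fin (d + 1) → ℝ)
    (S : Finset (Fin n)) : time sol T (solveDual x S) ≤ N ^ 2 + sdpTime T n d := by
  have hS : S.card ≤ n := (Finset.card_le_univ S).trans_eq (Fintype.card_fin n)
  have h1 : T S.card (d + 1) ≤ sdpTime T n d :=
    Finset.le_sup (f := fun N => T N (d + 1)) (Finset.mem_range.2 (Nat.lt_succ_of_le hS))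
  have h2 : S.card * (d + 1) ≤ N * N := Nat.mul_le_mul (hS.trans hn) hd
  change 0 + (S.card * (d + 1) + T S.card (d + 1)) ≤ _
  rw [sq]
  omega

theorem time_enclosingEllipsoid_le (hn : n ≤ N) (hd : d + 1 ≤ N) (hN : 1 ≤ N)
    (S : Finset (Fin n)) :
    time sol T (enclosingEllipsoid a S) ≤ sdpTime T n d + 40 * N ^ 3 := by
  have hw := fun w W s => time_weightedEllipsoid_le sol T a hn (Nat.le_of_succ_le hd) hN S w W s
  refine (time_bind_le sol T (time_const sol T 1).le fun _ =>
    time_bind_le sol T (time_solveDual_le sol T hn hd _ _) fun _ =>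
    time_bind_le sol T (time_tabulate_le sol T (d + 1) fun _ => time_tabulate_le sol T (d + 1)
      fun _ => time_sumOn_le sol T S (t := 2) (by norm_num) fun _ =>
        time_bind_le sol T (u := 1) (time_mul sol T _ _).le fun _ => (time_mul sol T _ _).le) fun _ =>
    time_bind_le sol T (time_psdDet_le sol T (d + 1) _) fun _ =>
    time_bind_le sol T (time_const sol T 0).le fun _ =>
    time_bind_le sol T (time_leq sol T _ _).le fun _ =>
    time_ite_le sol T (t := (N * (1 + 1) + 1) + (1 + 11 * N ^ 3))
      (time_bind_le sol T ((time_sumOn_le sol T S le_rfl fun _ => (time_const sol T 1).le).trans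
        (by gcongr)) fun _ =>
        time_bind_le sol T (time_leq sol T _ _).le fun _ =>
          time_ite_le sol T (hw _ _ _) ((time_pointEllipsoid sol T d).le.trans ?_))
      ((time_bind_le sol T (time_const sol T d).le fun _ =>
        time_bind_le sol T (time_const sol T (d + 1)).le fun _ =>
        time_bind_le sol T (time_div sol T _ _).le fun _ => hw _ _ _).trans ?_)).trans ?_
  · have := Nat.pow_le_pow_left hN 3
    omega
  · omega
  · have h1 : (d + 1) * ((d + 1) * (n * (2 + 1) + 1)) ≤ N * (N * (N * (2 + 1) + 1)) := by gcongr
    have h2 : N * (N * (N * (2 + 1) + 1)) = 3 * N ^ 3 + N ^ 2 := by ring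
    have h3 : N ^ 2 ≤ N ^ 3 := Nat.pow_le_pow_right hN (by norm_num)
    have h4 : N ≤ N ^ 3 := Nat.le_self_pow (by norm_num) N
    have h5 : (d + 1) ^ 3 ≤ N ^ 3 := Nat.pow_le_pow_left hd 3
    omega

theorem time_pointsInBall_le (hn : n ≤ N) (hd : d + 1 ≤ N) (k₁ k₂ : Fin n) :
    time sol T (pointsInBall a k₁ k₂) ≤ 10 * N ^ 2 := by
  refine (time_bind_le sol T (time_sqDist_le sol T _ _) fun _ => time_forEach_le sol T _ _
    fun _ _ => time_bind_le sol T (time_sqDist_le sol T _ _) fun _ =>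
      time_bind_le sol T (u := 0) (time_leq sol T _ _).le fun _ =>
        time_ite_le sol T le_rfl le_rfl).trans ?_
  rw [List.length_finRange]
  have h1 : n * (d * 3 + 1 + (1 + 0) + 1) ≤ N * (N * 3 + 1 + (1 + 0) + 1) := by
    gcongr
    omega
  have h2 : N * (N * 3 + 1 + (1 + 0) + 1) = 3 * N ^ 2 + 3 * N := by ring
  have h3 : N ≤ N ^ 2 := Nat.le_self_pow (by norm_num) N
  omega

theorem time_removalRound_le (hn : n ≤ N) (hd : d + 1 ≤ N) (S : Finset (Fin n)) :
    time sol T (removalRound a S) ≤ sdpTime T n d + 4 * N ^ 2 := by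
  refine (time_bind_le sol T (time_const sol T 1).le fun _ =>
    time_bind_le sol T (time_solveDual_le sol T hn hd _ _) fun _ => time_forEach_le sol T _ _
      fun _ _ => time_ite_le sol T (t := 1) (time_bind_le sol T (u := 0) (time_flip sol T _).le
        fun _ => time_ite_le sol T le_rfl le_rfl) (Nat.zero_le _)).trans ?_
  rw [List.length_finRange]
  have h3 : N ≤ N ^ 2 := Nat.le_self_pow (by norm_num) N
  omega

/-- Every index is charged a full round, performed or not, so `α` and `γ` do not enter the bound. -/
theorem time_removalRounds_le (hn : n ≤ N) (hd : d + 1 ≤ N) (α γ : ℝ) (S : Finset (Fin n)) :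
    time sol T (removalRounds 2 a α γ S) ≤ 2 * N * sdpTime T n d + 20 * N ^ 3 := by
  refine (time_forEach_le sol T _ _ fun _ _ =>
    time_bind_le sol T (time_const sol T _).le fun _ =>
    time_bind_le sol T (time_mul sol T _ _).le fun _ =>
    time_bind_le sol T (time_const sol T _).le fun _ =>
    time_bind_le sol T (time_mul sol T _ _).le fun _ =>
    time_bind_le sol T (time_leq sol T _ _).le fun _ =>
    time_ite_le sol T (Nat.zero_le _) (time_removalRound_le sol T a hn hd _)).trans ?_
  rw [List.length_range]
  have hN : 1 ≤ N := (Nat.le_add_left 1 d).trans hd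
  calc 2 * n * (1 + (1 + (1 + (1 + (1 + (sdpTime T n d + 4 * N ^ 2))))) + 1)
      ≤ 2 * N * (1 + (1 + (1 + (1 + (1 + (sdpTime T n d + 4 * N ^ 2))))) + 1) := by gcongr
    _ = 2 * N * sdpTime T n d + 8 * N ^ 3 + 12 * N := by ring
    _ ≤ _ := by
      have h4 : N ≤ N ^ 3 := Nat.le_self_pow (by norm_num) N
      omega

theorem time_keepSmaller_le (hd : d + 1 ≤ N) (best : Option (EllipsoidData ℝ d))
    (E : EllipsoidData ℝ d) : time sol T (keepSmaller best E) ≤ 15 * N ^ 3 := by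
  have hN : 1 ≤ N := (Nat.le_add_left 1 d).trans hd
  have h4 : N ≤ N ^ 3 := Nat.le_self_pow (by norm_num) N
  cases best with
  | none =>
    change 0 + 1 ≤ _
    omega
  | some F =>
    refine (time_bind_le sol T (time_psdDet_le sol T d _) fun _ =>
      time_bind_le sol T (time_psdDet_le sol T d _) fun _ =>
      time_bind_le sol T (u := 0) (time_leq sol T _ _).le fun _ =>
      time_ite_le sol T le_rfl le_rfl).trans ?_
    have h5 : d ^ 3 ≤ N ^ 3 := Nat.pow_le_pow_left (Nat.le_of_succ_le hd) 3
    omega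

/-- `1 ≤ sdpTime T n d` lets the additive polynomial terms be absorbed into the product. -/
theorem time_tryBall_le (hn : n ≤ N) (hd : d + 1 ≤ N) (hT : 1 ≤ sdpTime T n d) (c : ℕ) (α γ : ℝ)
    (s : Option (EllipsoidData ℝ d)) (k₁ k₂ : Fin n) :
    time sol T (tryBall 2 c a α γ s k₁ k₂) ≤ 110 * N ^ 4 * sdpTime T n d := by
  have hN : 1 ≤ N := (Nat.le_add_left 1 d).trans hd
  refine (time_bind_le sol T (time_pointsInBall_le sol T a hn hd _ _) fun _ =>
    time_bind_le sol T (time_removalRounds_le sol T a hn hd _ _ _) fun _ =>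
    time_bind_le sol T (time_enclosingEllipsoid_le sol T a hn hd hN _) fun _ =>
    time_bind_le sol T (time_coversEnough_le sol T a hn (Nat.le_of_succ_le hd) hN _ _ _ _) fun _ =>
    time_ite_le sol T (time_keepSmaller_le sol T hd _ _) (Nat.zero_le _)).trans ?_
  have h1 : N ^ 2 ≤ N ^ 4 := Nat.pow_le_pow_right hN (by norm_num)
  have h2 : N ^ 3 ≤ N ^ 4 := Nat.pow_le_pow_right hN (by norm_num)
  have h3 : N ≤ N ^ 4 := Nat.le_self_pow (by norm_num) N
  have h4 : 1 ≤ N ^ 4 := Nat.one_le_pow _ _ hN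
  have h5 : N ^ 4 ≤ N ^ 4 * sdpTime T n d := Nat.le_mul_of_pos_right _ hT
  have h6 : sdpTime T n d ≤ N ^ 4 * sdpTime T n d := Nat.le_mul_of_pos_left _ h4
  have h7 : N * sdpTime T n d ≤ N ^ 4 * sdpTime T n d := Nat.mul_le_mul_right _ h3
  have h8 : 2 * N * sdpTime T n d = 2 * (N * sdpTime T n d) := by ring
  have h9 : 110 * N ^ 4 * sdpTime T n d = 110 * (N ^ 4 * sdpTime T n d) := by ring
  omega

theorem confidenceEllipsoid_eq (cIter cCov cRep : ℕ) (α γ : ℝ) :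
    confidenceEllipsoid cIter cCov cRep a α γ = (do
      let trivialCase ← leq γ α
      if trivialCase then pointEllipsoid d
      else do
        let best ← mainLoop a cIter cCov cRep α γ
        match best with
        | some E => pure E
        | none => pointEllipsoid d) := by
  refine congrArg (leq γ α >>= ·) (funext fun b => ?_)
  cases b
  · refine congrArg (mainLoop a cIter cCov cRep α γ >>= ·) (funext fun s => ?_)
    cases s <;> rfl
  · rfl

theorem time_confidenceEllipsoid_le (hn : n ≤ N) (hn0 : 1 ≤ n) (hd : d + 1 ≤ N)
    (hT : 1 ≤ sdpTime T n d) (c : ℕ) (α γ : ℝ) :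
    time sol T (confidenceEllipsoid 2 c 1 a α γ) ≤ 115 * N ^ 7 * sdpTime T n d := by
  have hN : 1 ≤ N := (Nat.le_add_left 1 d).trans hd
  set τ := sdpTime T n d
  have hlog : Nat.log 2 n + 1 ≤ N := (Nat.log_lt_self 2 (by omega : n ≠ 0)).trans_le hn
  rw [confidenceEllipsoid_eq]
  refine (time_bind_le sol T (time_leq sol T _ _).le fun _ => time_ite_le sol T
    (t := N * (N * (N * (110 * N ^ 4 * τ + 1) + 1) + 1) + 1)
    ((time_pointEllipsoid sol T d).le.trans (Nat.le_add_left _ _))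
    (time_bind_le sol T ((time_forEach_le sol T _ _ fun _ _ => time_forEach_le sol T _ _ fun _ _ =>
      time_forEach_le sol T _ _ fun _ _ => time_tryBall_le sol T a hn hd hT _ _ _ _ _ _).trans ?_)
      fun best => ?_)).trans ?_
  · rw [List.length_range, List.length_finRange, one_mul]
    gcongr
  · cases best with
    | none => exact (time_pointEllipsoid sol T d).le
    | some E => exact Nat.zero_le _
  · have h1 : N * (N * (N * (110 * N ^ 4 * τ + 1) + 1) + 1) + 1 =
        110 * (N ^ 7 * τ) + N ^ 3 + N ^ 2 + N + 1 := by ring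
    have h2 : N ^ 3 ≤ N ^ 7 := Nat.pow_le_pow_right hN (by norm_num)
    have h3 : N ^ 2 ≤ N ^ 7 := Nat.pow_le_pow_right hN (by norm_num)
    have h4 : N ≤ N ^ 7 := Nat.le_self_pow (by norm_num) N
    have h5 : N ^ 7 ≤ N ^ 7 * τ := Nat.le_mul_of_pos_right _ hT
    have h6 : 115 * N ^ 7 * τ = 115 * (N ^ 7 * τ) := by ring
    omega

end Time

end Prog

/-! ## The main theorem -/

section Guarantee

variable {n d : ℕ} {sol : DualSolver}

theorem card_isInside_le_coverage (a : Fin n → EuclideanSpace ℝ (Fin d)) {E : EllipsoidData ℝ d}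
    (hE : E.shapeMatrix.PosSemidef) :
    (Finset.univ.filter fun i =>
      Prog.eval sol (Prog.isInside (fun j => a i j) E) = true).card ≤ coverage a E := by
  classical
  unfold coverage
  refine Finset.card_le_card fun i hi => ?_
  rw [Finset.mem_filter, Prog.eval_isInside sol _ _ hE] at hi
  rw [Finset.mem_filter]
  exact ⟨hi.1, E.mem_toSet_of_posSemidef hE (a i) hi.2⟩

/-- Volume scales as the square root of the determinant, which halves the exponent. Only `Estar`
needs a lower volume bound, so `E` may be flat. -/
theorem volume_toSet_le_of_det_le {E Estar : EllipsoidData ℝ d} (hE : E.shapeMatrix.PosSemidef)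
    (hpos : Estar.shapeMatrix.PosDef) {b κ : ℝ} (hb : 0 < b)
    (h : E.shapeMatrix.det ≤ b ^ (2 * κ) * Estar.shapeMatrix.det) :
    volume E.toSet ≤ ENNReal.ofReal (b ^ κ) * volume Estar.toSet := by
  refine (E.volume_toSet_le hE).trans (le_trans ?_
    (mul_le_mul_right (Estar.le_volume_toSet hpos) _))
  rw [← mul_assoc, ← ENNReal.ofReal_mul (by positivity)]
  refine mul_le_mul_left (ENNReal.ofReal_le_ofReal ?_) _
  refine (Real.sqrt_le_sqrt h).trans_eq ?_
  rw [Real.sqrt_mul (by positivity), mul_comm 2 κ, Real.rpow_mul hb.le, Real.rpow_two,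
    Real.sqrt_sq (by positivity)]

theorem volume_point (hd : 1 ≤ d) (c : Fin d → ℝ) :
    volume (EllipsoidData.ofMatrix c 0).toSet = 0 := by
  have : Nonempty (Fin d) := ⟨⟨0, hd⟩⟩
  have h := (EllipsoidData.ofMatrix c 0).volume_toSet_le
    (by rw [EllipsoidData.shapeMatrix_ofMatrix]; exact Matrix.PosSemidef.zero)
  rw [EllipsoidData.shapeMatrix_ofMatrix, Matrix.det_zero] at h
  simpa using h

end Guarantee

theorem theorem1p1 :
    ∃ (cIter cCov cRep K : ℕ) (ε : ℕ → ℝ), Tendsto ε atTop (𝓝 0) ∧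
      ∀ (n d : ℕ) (a : Fin n → EuclideanSpace ℝ (Fin d)) (α γ : ℝ),
        1 ≤ d → 0 < α → α < 1 → 0 < γ → γ < 1 → γ * d ≤ α * n →
        ∀ sol : DualSolver, sol.IsExact →
          -- running time
          (∀ T : ℕ → ℕ → ℕ, (∀ N m, 1 ≤ T N m) →
            (Prog.confidenceEllipsoid cIter cCov cRep (fun i j => a i j) α γ).time sol T
              ≤ K * (n + d) ^ K * sdpTime T n d) ∧
          -- guarantee
          (∀ (β : ℝ) (Estar : EllipsoidData ℝ d) (hpos : Estar.shapeMatrix.PosDef),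
            1 ≤ β → ellipsoidCondNumber Estar.shapeMatrix hpos.isHermitian ≤ β →
            (1 - α) * n ≤ coverage a Estar →
            1 - ENNReal.ofReal (ε n) ≤
              ((Prog.confidenceEllipsoid cIter cCov cRep (fun i j => a i j) α γ).output
                sol).toOuterMeasure
                {E | E.shapeMatrix.PosSemidef ∧
                  (1 - cCov * (α / γ)) * n ≤ coverage a E ∧
                  volume E.toSet ≤
                    ENNReal.ofReal ((4 * β) ^ (2 * γ * (d + 1))) * volume Estar.toSet}) := by
  classical
  refine ⟨2, 25, 1, 115, fun n => 1 / n, tendsto_one_div_atTop_nhds_zero_nat, ?_⟩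
  intro n d a α γ hd hα hα1 hγ hγ1 hn sol hsol
  have hd' : (1 : ℝ) ≤ d := Nat.one_le_cast.2 hd
  have hn0 : 0 < n := by
    rw [← Nat.cast_pos (α := ℝ)]
    refine pos_of_mul_pos_right (lt_of_lt_of_le ?_ hn) hα.le
    positivity
  refine ⟨fun T hT => ?_, fun β Estar hpos hβ hcond hcov => ?_⟩
  · have hsdp : 1 ≤ sdpTime T n d := (hT 0 (d + 1)).trans
      (Finset.le_sup (f := fun N => T N (d + 1)) (Finset.mem_range.2 n.succ_pos))
    -- `n + d` dominates the lifted dimension `d + 1` because `1 ≤ n`. The coefficient 115 also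
    -- serves as the exponent, where 7 would do.
    refine (Prog.time_confidenceEllipsoid_le sol T (N := n + d) _ (by omega) hn0 (by omega) hsdp
      25 α γ).trans ?_
    gcongr
    · omega
    · norm_num
  · rw [Prog.output_toOuterMeasure, ← ENNReal.ofReal_one, ← ENNReal.ofReal_sub _ (by positivity)]
    refine ENNReal.ofReal_le_ofReal ?_
    set good : Set (EllipsoidData ℝ d) := {E | E.shapeMatrix.PosSemidef ∧
      (1 - (25 : ℕ) * (α / γ)) * n ≤ coverage a E ∧
      volume E.toSet ≤ ENNReal.ofReal ((4 * β) ^ (2 * γ * (d + 1))) * volume Estar.toSet} with hgood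
    rw [Prog.confidenceEllipsoid_eq, Prog.expect_bind,
      Prog.CoinFree.expect_eq (Prog.coinFree_leq _ _), Prog.eval_leq]
    simp only [decide_eq_true_eq]
    split_ifs with hγα
    -- The required coverage is not positive here, and a point has volume 0.
    · rw [Prog.CoinFree.expect_eq (Prog.coinFree_pointEllipsoid d), Prog.eval_pointEllipsoid]
      have hmem : EllipsoidData.ofMatrix 0 0 ∈ good := by
        refine ⟨Matrix.PosSemidef.zero, ?_, ?_⟩
        · have h1 : 1 ≤ α / γ := (one_le_div hγ).2 hγα
          have h2 : (1 - ((25 : ℕ) : ℝ) * (α / γ)) ≤ 0 := by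
            push_cast
            linarith
          exact (mul_nonpos_of_nonpos_of_nonneg h2 (Nat.cast_nonneg _)).trans (Nat.cast_nonneg _)
        · rw [volume_point hd]
          exact zero_le
      rw [Set.indicator_of_mem hmem]
      simp
    · have hαγ := not_le.1 hγα
      set R : ℝ := (4 * β) ^ (2 * (2 * γ * (d + 1))) * Estar.shapeMatrix.det with hR
      have hcov' : (1 - α) * n ≤ ((Finset.univ.filter fun i =>
          ((fun j => a i j) - Estar.center) ⬝ᵥ
            (Estar.shapeMatrix⁻¹ *ᵥ ((fun j => a i j) - Estar.center)) ≤ 1).card : ℝ) := by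
        refine hcov.trans (Nat.cast_le.2 (le_of_eq ?_))
        unfold coverage
        congr 1
        ext i
        simp only [Finset.mem_filter, Finset.mem_univ, true_and]
        exact Estar.mem_toSet_iff_of_posDef hpos (a i)
      have hmain := Prog.expect_mainLoop_le (a := fun i j => a i j) hsol hd hα hα1 hγ hγ1 hαγ hn hβ
        hpos hcond Estar.center hcov'
      have h1 : 1 - 1 / (n : ℝ) ≤ Prog.expect sol
          (Prog.mainLoop (fun i j => a i j) 2 25 1 α γ) fun s => 1 - Prog.failure R s := by
        rw [Prog.expect_sub, Prog.expect_const]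
        linarith
      refine h1.trans ?_
      rw [Prog.expect_bind]
      refine Prog.expect_le_of_sat sol (Prog.sat_mainLoop hsol 2 25 1 α γ) fun s hs => ?_
      by_cases hsucc : Prog.Succeeded R s
      · obtain ⟨E, hE, hdet⟩ := hsucc
        rw [Option.mem_def] at hE
        subst hE
        have hcand := hs E rfl
        have hmem : E ∈ good := by
          refine ⟨hcand.1, ?_, ?_⟩
          · exact ((Prog.eval_coversEnough sol _ 25 hγ E).1 hcand.2).trans
              (Nat.cast_le.2 (card_isInside_le_coverage a hcand.1))
          · exact volume_toSet_le_of_det_le hcand.1 hpos (by positivity) hdet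
        rw [Prog.expect_pure, Set.indicator_of_mem hmem]
        have := Prog.failure_nonneg R (some E)
        simpa using this
      · have h2 : Prog.failure R s = 1 := by simp [Prog.failure, hsucc]
        -- On failure the lower bound to be shown is 0, whatever is returned.
        rw [h2, sub_self]
        exact Prog.const_le_expect sol (Prog.sat_true sol _) fun E _ =>
          Set.indicator_nonneg (fun _ _ => zero_le_one) E
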